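/- \textbf{Setting.} Let $X$ be a complex Banach space. For $\omega\in(0,\pi)$ let $\Sigma_\omega=\{z\in\mathbb C\setminus\{0\}:|\arg z|<\omega\}$, and for $\gamma\in(0,\frac\pi2)$ let $\mathcal B_\gamma$ (the Stolz domain of angle $\gamma$) be the interior of the convex hull of $1$ and the disc $D(0,\sin\gamma)$. Write $R(\lambda,S)=(\lambda I-S)^{-1}$. A bounded operator $A$ on $X$ is \emph{sectorial of type} $\omega\in(0,\pi)$ if $\sigma(A)\subseteq\overline{\Sigma_\omega}$ and $\{zR(z,A):z\in\mathbb C\setminus\overline{\Sigma_\nu}\}$ is bounded for every $\nu\in(\omega,\pi)$. A bounded operator $T$ on $X$ is a \emph{Ritt operator of type} $\alpha\in(0,\frac\pi2)$ if $\sigma(T)\subseteq\overline{\mathcal B_\alpha}$ and $\{(1-\lambda)R(\lambda,T):\lambda\in\mathbb C\setminus\overline{\mathcal B_\beta}\}$ is bounded for every $\beta\in(\alpha,\frac\pi2)$; it is a \emph{Ritt operator} if it is one of some type $\alpha\in(0,\frac\pi2)$. Let $H_0^\infty(\prod_{i=1}^n\Sigma_{\theta_i})$ be the set of bounded holomorphic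 $f$ on $\prod_i\Sigma_{\theta_i}$ with $|f(z)|\le C\prod_{i}\frac{|z_i|^s}{1+|z_i|^{2s}}$ for some $C,s>0$ depending on $f$, and $H_0^\infty(\prod_{i=1}^n\mathcal B_{\gamma_i})$ the set of bounded holomorphic $\phi$ on $\prod_i\mathcal B_{\gamma_i}$ with $|\phi(\lambda)|\le c\prod_i|1-\lambda_i|^s$ for some $c,s>0$ depending on $\phi$. Let $\mathbf A=(A_1,\dots,A_n)$ be a commuting tuple with each $A_i$ sectorial of type $\omega_i<\theta_i$. For $f\in H_0^\infty(\prod_i\Sigma_{\theta_i})$ put $$f(\mathbf A)=\Big(\frac1{2\pi i}\Big)^n\int_{\prod_i\partial\Sigma_{\nu_i}}f(z_1,\dots,z_n)\prod_{i=1}^nR(z_i,A_i)\,dz_1\cdots dz_n,\qquad \nu_i\in(\omega_i,\theta_i),$$ and let $\mathbf T=(T_1,\dots,T_n)$ be a commuting tuple with each $T_i$ Ritt of type $\alpha_i<\gamma_i$. For $\phi\in H_0^\infty(\prod_i\mathcal B_{\gamma_i})$ put $$\phi(\mathbf T)=\Big(\frac1{2\pi i}\Big)^n\int_{\prod_i\partial\mathcal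 B_{\beta_i}}\phi(\lambda_1,\dots,\lambda_n)\prod_{i=1}^nR(\lambda_i,T_i)\,d\lambda_1\cdots d\lambda_n,\qquad \beta_i\in(\alpha_i,\gamma_i),$$ all boundaries being oriented counterclockwise (the integrals converge absolutely and do not depend on $\nu_i$, $\beta_i$). We say that $\mathbf A$ \emph{admits a joint bounded $H^\infty(\prod_i\Sigma_{\theta_i})$ functional calculus} if each $A_i$ is sectorial of some type $\omega_i<\theta_i$ and there is $C>0$ with $\|f(\mathbf A)\|\le C\sup_{\prod_i\Sigma_{\theta_i}}|f|$ for all $f\in H_0^\infty(\prod_i\Sigma_{\theta_i})$; and that $\mathbf T$ \emph{admits a joint bounded $H^\infty(\prod_i\mathcal B_{\gamma_i})$ functional calculus} if each $T_i$ is Ritt of some type $\alpha_i<\gamma_i$ and there is $C>0$ with $\|\phi(\mathbf T)\|\le C\sup_{\prod_i\mathcal B_{\gamma_i}}|\phi|$ for all $\phi\in H_0^\infty(\prod_i\mathcal B_{\gamma_i})$. \textbf{Theorem (Transfer principle).} Let $\mathbf T=(T_1,\dots,T_n)$ be a commuting tuple of Ritt operators on $X$ and let $A_i=I_X-T_i$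 for $1\le i\le n$, $\mathbf A=(A_1,\dots,A_n)$. Then the following are equivalent. \begin{enumerate} \item The tuple $\mathbf T$ admits a joint bounded $H^\infty(\prod_{i=1}^n\mathcal B_{\gamma_i})$ functional calculus for some $\gamma_i\in(0,\frac\pi2)$, $1\le i\le n$. \item The tuple $\mathbf A$ admits a joint bounded $H^\infty(\prod_{i=1}^n\Sigma_{\theta_i})$ functional calculus for some $\theta_i\in(0,\frac\pi2)$, $1\le i\le n$. \end{enumerate} -/

import Mathlib

noncomputable section

namespace RittCalculus

open MeasureTheory

/-- The open sector `Σ_ω` of angle `2ω` around the positive real axis. -/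
def sector (ω : ℝ) : Set ℂ := {z | z ≠ 0 ∧ |Complex.arg z| < ω}

/-- The Stolz domain `B_γ`: the interior of the convex hull of `1` and the disc `D(0, sin γ)`. -/
def stolz (γ : ℝ) : Set ℂ :=
  interior (convexHull ℝ ({1} ∪ Metric.ball (0 : ℂ) (Real.sin γ)))

/-- The product `∏ᵢ D i` of plane domains. -/
def prodDomain {n : ℕ} (D : Fin n → Set ℂ) : Set (Fin n → ℂ) := Set.univ.pi D

/-- The norm `‖f‖_{∞,D} = sup {|f z| : z ∈ D}`. It is only used for `f` bounded on `D ≠ ∅`. -/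
def supNorm {n : ℕ} (D : Set (Fin n → ℂ)) (f : (Fin n → ℂ) → ℂ) : ℝ :=
  sSup ((fun z => ‖f z‖) '' D)

/-- `f` restricts to a bounded holomorphic function on `D`. -/
def IsHInfty {n : ℕ} (D : Set (Fin n → ℂ)) (f : (Fin n → ℂ) → ℂ) : Prop :=
  DifferentiableOn ℂ f D ∧ ∃ M : ℝ, ∀ z ∈ D, ‖f z‖ ≤ M

/-- `f ∈ H_0^∞(∏ᵢ Σ_{θ i})`. -/
def IsHZeroSector {n : ℕ} (θ : Fin n → ℝ) (f : (Fin n → ℂ) → ℂ) : Prop :=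
  IsHInfty (prodDomain fun i => sector (θ i)) f ∧
    ∃ C s : ℝ, 0 < C ∧ 0 < s ∧ ∀ z ∈ prodDomain fun i => sector (θ i),
      ‖f z‖ ≤ C * ∏ i, (‖z i‖ ^ s / (1 + ‖z i‖ ^ (2 * s)))

/-- `φ ∈ H_0^∞(∏ᵢ B_{γ i})`. -/
def IsHZeroStolz {n : ℕ} (γ : Fin n → ℝ) (φ : (Fin n → ℂ) → ℂ) : Prop :=
  IsHInfty (prodDomain fun i => stolz (γ i)) φ ∧
    ∃ c s : ℝ, 0 < c ∧ 0 < s ∧ ∀ z ∈ prodDomain fun i => stolz (γ i),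
      ‖φ z‖ ≤ c * ∏ i, ‖1 - z i‖ ^ s

/-- The boundary of `Σ_ν`, oriented counterclockwise and parametrized by `ℝ`: inwards along the
ray of angle `ν`, then outwards along the ray of angle `-ν`. -/
def sectorBoundary (ν : ℝ) (t : ℝ) : ℂ :=
  if t ≤ 0 then ((-t : ℝ) : ℂ) * Complex.exp ((ν : ℂ) * Complex.I)
  else (t : ℂ) * Complex.exp (-((ν : ℂ) * Complex.I))

/-- The point `sin β · exp (i (π/2 - β))` at which the upper tangent from `1` touches the
circle of radius `sin β` around `0`. -/
def stolzTangent (β : ℝ) : ℂ :=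
  (Real.sin β : ℂ) * Complex.exp (((Real.pi / 2 - β : ℝ) : ℂ) * Complex.I)

/-- The boundary of `B_β`, oriented counterclockwise and parametrized by `[0, 3]`: the segment
from `1` to the upper tangent point, the arc of the circle of radius `sin β` through `-sin β`
to the lower tangent point, and the segment back to `1`. -/
def stolzBoundary (β : ℝ) (t : ℝ) : ℂ :=
  if t ≤ 1 then ((1 - t : ℝ) : ℂ) + (t : ℂ) * stolzTangent β
  else if t ≤ 2 then
    (Real.sin β : ℂ) *
      Complex.exp (((Real.pi / 2 - β + (t - 1) * (Real.pi + 2 * β) : ℝ) : ℂ) * Complex.I)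
  else ((3 - t : ℝ) : ℂ) * (starRingEnd ℂ) (stolzTangent β) + ((t - 2 : ℝ) : ℂ)

/-- The integral of `F` along the product of the piecewise smooth curves `c i : S i → ℂ`. -/
def contourIntegral {n : ℕ} {E : Type*} [NormedAddCommGroup E] [NormedSpace ℂ E]
    (S : Fin n → Set ℝ) (c : Fin n → ℝ → ℂ) (F : (Fin n → ℂ) → E) : E :=
  ∫ t in Set.univ.pi S, (∏ i, deriv (c i) (t i)) • F (fun i => c i (t i))

variable {X : Type*} [NormedAddCommGroup X] [NormedSpace ℂ X]

/-- The bounded operator `A` is sectorial of type `ω`. -/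
def IsSectorialOfType (A : X →L[ℂ] X) (ω : ℝ) : Prop :=
  ω ∈ Set.Ioo 0 Real.pi ∧ spectrum ℂ A ⊆ closure (sector ω) ∧
    ∀ ν ∈ Set.Ioo ω Real.pi,
      Bornology.IsBounded ((fun z : ℂ => z • resolvent A z) '' (closure (sector ν))ᶜ)

/-- `T` is a Ritt operator of type `α`. -/
def IsRittOfType (T : X →L[ℂ] X) (α : ℝ) : Prop :=
  α ∈ Set.Ioo 0 (Real.pi / 2) ∧ spectrum ℂ T ⊆ closure (stolz α) ∧
    ∀ β ∈ Set.Ioo α (Real.pi / 2),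
      Bornology.IsBounded ((fun z : ℂ => (1 - z) • resolvent T z) '' (closure (stolz β))ᶜ)

/-- `T` is a Ritt operator. -/
def IsRitt (T : X →L[ℂ] X) : Prop := ∃ α : ℝ, IsRittOfType T α

/-- The product `R(z_1, A_1) ⋯ R(z_n, A_n)` of resolvents, in this order. -/
def resolventProd {n : ℕ} (A : Fin n → X →L[ℂ] X) (z : Fin n → ℂ) : X →L[ℂ] X :=
  (List.ofFn fun i => resolvent (A i) (z i)).prod

/-- The operator `f(A)` for `f ∈ H_0^∞` of a product of sectors, as a Cauchy integral over the
boundaries of the sectors `Σ_{ν i}`. -/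
def sectorialCalculus {n : ℕ} (A : Fin n → X →L[ℂ] X) (ν : Fin n → ℝ)
    (f : (Fin n → ℂ) → ℂ) : X →L[ℂ] X :=
  (1 / (2 * (Real.pi : ℂ) * Complex.I)) ^ n •
    contourIntegral (fun _ => Set.univ) (fun i => sectorBoundary (ν i))
      (fun z => f z • resolventProd A z)

/-- The operator `φ(T)` for `φ ∈ H_0^∞` of a product of Stolz domains, as a Cauchy integral over
the boundaries of the Stolz domains `B_{β i}`. -/
def rittCalculus {n : ℕ} (T : Fin n → X →L[ℂ] X) (β : Fin n → ℝ)
    (φ : (Fin n → ℂ) → ℂ) : X →L[ℂ] X :=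
  (1 / (2 * (Real.pi : ℂ) * Complex.I)) ^ n •
    contourIntegral (fun _ => Set.Icc 0 3) (fun i => stolzBoundary (β i))
      (fun z => φ z • resolventProd T z)

/-- `A` admits a joint bounded `H^∞(∏ᵢ Σ_{θ i})` functional calculus: each `A i` is sectorial of
some type `ω i < θ i`, and `‖f(A)‖ ≤ C ‖f‖_∞` for all `f ∈ H_0^∞(∏ᵢ Σ_{θ i})`, where `f(A)` is
computed with any angles `ν i` strictly between `ω i` and `θ i`. -/
def HasSectorialCalculus {n : ℕ} (A : Fin n → X →L[ℂ] X) (θ : Fin n → ℝ) : Prop :=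
  ∃ ω : Fin n → ℝ, (∀ i, IsSectorialOfType (A i) (ω i) ∧ ω i < θ i) ∧
    ∃ C : ℝ, 0 < C ∧ ∀ f : (Fin n → ℂ) → ℂ, IsHZeroSector θ f →
      ∀ ν : Fin n → ℝ, (∀ i, ν i ∈ Set.Ioo (ω i) (θ i)) →
        ‖sectorialCalculus A ν f‖ ≤ C * supNorm (prodDomain fun i => sector (θ i)) f

/-- `T` admits a joint bounded `H^∞(∏ᵢ B_{γ i})` functional calculus: each `T i` is Ritt of some
type `α i < γ i`, and `‖φ(T)‖ ≤ C ‖φ‖_∞` for all `φ ∈ H_0^∞(∏ᵢ B_{γ i})`, where `φ(T)` is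
computed with any angles `β i` strictly between `α i` and `γ i`. -/
def HasRittCalculus {n : ℕ} (T : Fin n → X →L[ℂ] X) (γ : Fin n → ℝ) : Prop :=
  ∃ α : Fin n → ℝ, (∀ i, IsRittOfType (T i) (α i) ∧ α i < γ i) ∧
    ∃ C : ℝ, 0 < C ∧ ∀ φ : (Fin n → ℂ) → ℂ, IsHZeroStolz γ φ →
      ∀ β : Fin n → ℝ, (∀ i, β i ∈ Set.Ioo (α i) (γ i)) →
        ‖rittCalculus T β φ‖ ≤ C * supNorm (prodDomain fun i => stolz (γ i)) φ

end RittCalculus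

end

noncomputable section

namespace RittCalculus

open MeasureTheory Set Filter Topology

/-! Put `A i = 1 - T i`. The reflection `w = 1 - z` carries a Stolz domain of angle `β` to a bounded
set `dstolz β` inside the sector of angle `β`, with vertex `0`. Its boundary consists of two
segments of the rays of angle `±β` and a circular arc staying away from `0`. By `rittCalculus_eq`,
`φ(T)` is the contour integral of `f w = φ (1 - w)` against the resolvents of `A` over products of
such boundaries.

From `T` to `A` the argument is a change of contour. The resolvent of `A i` exists, with a bound `K
/ |w|`, off a closed reflected Stolz domain of angle slightly above the type. So for `f` in `H_0^∞`
of the sectors each sector boundary can be deformed to the boundary of the inscribed reflected Stolz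
domain, and `f(A) = φ(T)` (`sectorialCalculus_eq_rittCalculus`). The supremum of `f` over the
smaller domain is no larger, so the same angles and the same constant work.

From `A` to `T` this is not available, because `f` lives only on the reflected Stolz domains.
Variables are therefore converted one at a time, starting from sector boundaries in all variables.
In the variable being converted, the Cauchy kernel `(z - w)⁻¹` is not in `H_0^∞` of a sector, and
along a ray it is not absolutely integrable uniformly in `w`. It is replaced by the even kernel `ker
z w = (z - w)⁻¹ - (z + w)⁻¹ = 2w / (z² - w²)`, which vanishes at `0` and at infinity. At the
operator level this means replacing `R(z)` by `kerOp z = R(z) + R(-z)`, which costs nothing: `R(-z)`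
is holomorphic on the reflected Stolz domain and contributes zero.

On the two segments `z` lies outside the smaller sector of angle `θ`, and `kerOp z` is the value at
`A i` of the calculus of `ker z` (`integral_ker_smul_resolvent`). By Fubini the segments contribute
the sectorial calculus of `rayTransform`, the integral of `f` against the kernel. The modulus of the
kernel is at most a constant times `|w| / (|z|² + |w|²)`, a Poisson-type kernel whose integral over
both segments is at most `π` for every `w`, so the transform is bounded in supremum norm
(`norm_rayTransform_le`).

On the arc `kerOp z = N kerOp z₀` with a fixed `z₀ = exp (iβ)` and `N` bounded (`kerOp_factor`). A
slice of `f` times `ker z₀` is in `H_0^∞` in all variables, so the assumed calculus bounds it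
(`Conversion.slice`). Together these give `Conversion.norm_contourIntegral_le`, and induction over
the set of converted variables finishes the proof. -/

/-! ### The decay weight -/

/-- The decay weight `ρ ↦ ρ^s / (1 + ρ^(2s))` in the definition of `H_0^∞` of a sector. -/
def wt (s ρ : ℝ) : ℝ := ρ ^ s / (1 + ρ ^ (2 * s))

lemma rpow_two_mul {ρ : ℝ} (hρ : 0 ≤ ρ) (s : ℝ) : ρ ^ (2 * s) = (ρ ^ s) ^ 2 := by
  rw [mul_comm, Real.rpow_mul hρ]; norm_cast

lemma wt_eq {ρ : ℝ} (hρ : 0 ≤ ρ) (s : ℝ) : wt s ρ = ρ ^ s / (1 + (ρ ^ s) ^ 2) := by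
  rw [wt, rpow_two_mul hρ]

lemma wt_nonneg {ρ : ℝ} (hρ : 0 ≤ ρ) (s : ℝ) : 0 ≤ wt s ρ := by
  unfold wt; positivity

lemma wt_le_rpow {ρ : ℝ} (hρ : 0 ≤ ρ) (s : ℝ) : wt s ρ ≤ ρ ^ s := by
  rw [wt_eq hρ]
  exact div_le_self (by positivity) (by nlinarith [sq_nonneg (ρ ^ s)])

lemma wt_le_rpow_neg {ρ : ℝ} (hρ : 0 < ρ) (s : ℝ) : wt s ρ ≤ ρ ^ (-s) := by
  have h : 0 < ρ ^ s := by positivity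
  rw [wt_eq hρ.le, Real.rpow_neg hρ.le, div_le_iff₀ (by positivity), inv_mul_eq_div,
    le_div_iff₀ h]
  nlinarith

lemma wt_le_one {ρ : ℝ} (hρ : 0 ≤ ρ) (s : ℝ) : wt s ρ ≤ 1 := by
  rw [wt_eq hρ, div_le_one (by positivity)]
  nlinarith [sq_nonneg (ρ ^ s - 1), sq_nonneg (ρ ^ s)]

/-- For `ρ > 0` the weight is `1 / (2 cosh (s log ρ))`, which decreases in `s`. The decay exponent
of a function may thus be lowered at will. -/
lemma wt_anti {ρ s s' : ℝ} (hρ : 0 ≤ ρ) (hs' : 0 < s') (hss : s' ≤ s) : wt s ρ ≤ wt s' ρ := by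
  rw [wt_eq hρ, wt_eq hρ, div_le_div_iff₀ (by positivity) (by positivity)]
  rcases hρ.eq_or_lt with rfl | hρ0
  · rw [Real.zero_rpow (by linarith), Real.zero_rpow (by linarith)]
  have ha : 0 < ρ ^ s := by positivity
  have hb : 0 < ρ ^ s' := by positivity
  rcases le_total ρ 1 with h | h
  · have h1 : ρ ^ s ≤ ρ ^ s' := Real.rpow_le_rpow_of_exponent_ge hρ0 h hss
    have h2 : ρ ^ s' ≤ 1 := Real.rpow_le_one hρ h hs'.le
    nlinarith [mul_nonneg (sub_nonneg.2 h1) (sub_nonneg.2 (mul_le_one₀ (h1.trans h2) hb.le h2))]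
  · have h1 : ρ ^ s' ≤ ρ ^ s := Real.rpow_le_rpow_of_exponent_le h hss
    have h2 : 1 ≤ ρ ^ s' := Real.one_le_rpow h hs'.le
    have h3 : 1 ≤ ρ ^ s * ρ ^ s' := one_le_mul_of_one_le_of_one_le (h2.trans h1) h2
    nlinarith [mul_nonneg (sub_nonneg.2 h1) (sub_nonneg.2 h3)]

lemma wt_mul_le {ρ r : ℝ} (hρ : 0 ≤ ρ) (hr : 0 < r) (s : ℝ) :
    wt s (ρ * r) ≤ (r ^ s + r ^ (-s)) * wt s ρ := by
  have hB : 0 < r ^ s := by positivity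
  have hA : 0 ≤ ρ ^ s := by positivity
  rw [wt_eq hρ, wt_eq (by positivity), Real.mul_rpow hρ hr.le, Real.rpow_neg hr.le]
  set A := ρ ^ s
  set B := r ^ s
  have : (B + B⁻¹) * (A / (1 + A ^ 2)) = (B ^ 2 + 1) * A / (B * (1 + A ^ 2)) := by
    field_simp
  rw [this, div_le_div_iff₀ (by positivity) (by positivity)]
  have : 0 ≤ A * (A ^ 2 * B ^ 4 + 1) := by positivity
  nlinarith

lemma measurable_wt (s : ℝ) : Measurable (wt s) := by
  unfold wt; fun_prop

/-- A primitive of `wt s ρ / ρ` is `arctan (ρ ^ s) / s`, which is bounded. This one-dimensional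
integral is the source of all absolute convergence along rays. -/
lemma integrableOn_wt_div {s : ℝ} (hs : 0 < s) :
    IntegrableOn (fun ρ => wt s ρ / ρ) (Ioi 0) := by
  have hc : Continuous fun ρ : ℝ => Real.arctan (ρ ^ s) / s :=
    (Real.continuous_arctan.comp (Real.continuous_rpow_const hs.le)).div_const _
  refine integrableOn_Ioi_deriv_of_nonneg (g := fun ρ : ℝ => Real.arctan (ρ ^ s) / s)
    (l := Real.pi / 2 / s) hc.continuousWithinAt ?_ ?_ ?_
  · intro ρ hρ
    have hρ : 0 < ρ := hρ
    have := ((Real.hasDerivAt_rpow_const (x := ρ) (p := s) (Or.inl hρ.ne')).arctan).div_const s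
    convert! this using 1
    rw [wt_eq hρ.le, Real.rpow_sub_one hρ.ne']
    field_simp
  · intro ρ hρ
    exact div_nonneg (wt_nonneg (le_of_lt hρ) s) (le_of_lt hρ)
  · exact ((tendsto_nhds_of_tendsto_nhdsWithin Real.tendsto_arctan_atTop).comp
      (tendsto_rpow_atTop hs)).div_const s

lemma tendsto_wt_zero {s : ℝ} (hs : 0 < s) : Tendsto (wt s) (𝓝[>] 0) (𝓝 0) := by
  have h1 : Tendsto (fun ρ : ℝ => ρ ^ s) (𝓝[>] 0) (𝓝 0) := by
    have := (Real.continuous_rpow_const hs.le).tendsto (0 : ℝ)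
    rw [Real.zero_rpow hs.ne'] at this
    exact this.mono_left nhdsWithin_le_nhds
  refine tendsto_of_tendsto_of_tendsto_of_le_of_le' tendsto_const_nhds h1 ?_ ?_
  · filter_upwards [self_mem_nhdsWithin] with ρ hρ using wt_nonneg (le_of_lt hρ) s
  · filter_upwards [self_mem_nhdsWithin] with ρ hρ using wt_le_rpow (le_of_lt hρ) s

lemma tendsto_wt_atTop {s : ℝ} (hs : 0 < s) : Tendsto (wt s) atTop (𝓝 0) := by
  refine tendsto_of_tendsto_of_tendsto_of_le_of_le' tendsto_const_nhds
    (tendsto_rpow_neg_atTop hs) ?_ ?_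
  · filter_upwards [eventually_gt_atTop 0] with ρ hρ using wt_nonneg (le_of_lt hρ) s
  · filter_upwards [eventually_gt_atTop 0] with ρ hρ using wt_le_rpow_neg hρ s

/-! ### Cauchy's theorem by dilation -/

section Dilation

variable {E : Type*} [NormedAddCommGroup E] [NormedSpace ℂ E]
  {g : ℂ → E} {U : Set ℂ} {a a' : ℝ → ℂ} {t₁ t₂ : ℝ}

/-- The derivative of `s ↦ ∫ g(s a) s da` is the increment of `z ↦ z g(s z)` along `a`. -/
theorem integral_dilation_sub [CompleteSpace E] (hU : IsOpen U) (hg : DifferentiableOn ℂ g U) (ht : t₁ ≤ t₂)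
    (ha : ∀ t ∈ Icc t₁ t₂, HasDerivAt a (a' t) t) (ha' : ContinuousOn a' (Icc t₁ t₂))
    {s₀ s₁ : ℝ} (hs : s₀ ≤ s₁)
    (hmem : ∀ s ∈ Icc s₀ s₁, ∀ t ∈ Icc t₁ t₂, (s : ℂ) * a t ∈ U) :
    (∫ t in t₁..t₂, a' t • ((s₁ : ℂ) • g (s₁ * a t))) -
        ∫ t in t₁..t₂, a' t • ((s₀ : ℂ) • g (s₀ * a t)) =
      ∫ s in s₀..s₁, (a t₂ • g (s * a t₂) - a t₁ • g (s * a t₁)) := by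
  have hac : ContinuousOn a (Icc t₁ t₂) := fun t h => (ha t h).continuousAt.continuousWithinAt
  have hgc := hg.continuousOn
  have hg'c := (hg.deriv hU).continuousOn
  have hgd : ∀ z ∈ U, HasDerivAt g (deriv g z) z := fun z hz =>
    (hg.differentiableAt (hU.mem_nhds hz)).hasDerivAt
  -- `H` is at once the `t`-derivative of `a • g (s a)` and the `s`-derivative of `a' • (s • g (s
  -- a))`. Integrating it over the rectangle in the two possible orders gives the identity.
  let H : ℝ → ℝ → E := fun s t =>
    a' t • (g (s * a t) + ((s : ℂ) * a t) • deriv g (s * a t))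
  have hmaps : MapsTo (fun p : ℝ × ℝ => (p.1 : ℂ) * a p.2) (Icc s₀ s₁ ×ˢ Icc t₁ t₂) U :=
    fun p hp => hmem p.1 hp.1 p.2 hp.2
  have hac2 : ContinuousOn (fun p : ℝ × ℝ => a p.2) (Icc s₀ s₁ ×ˢ Icc t₁ t₂) :=
    hac.comp continuousOn_snd fun p hp => hp.2
  have hm : ContinuousOn (fun p : ℝ × ℝ => (p.1 : ℂ) * a p.2) (Icc s₀ s₁ ×ˢ Icc t₁ t₂) :=
    (Complex.continuous_ofReal.comp continuous_fst).continuousOn.mul hac2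
  have hHc : ContinuousOn (Function.uncurry H) (Icc s₀ s₁ ×ˢ Icc t₁ t₂) := by
    refine (ha'.comp continuousOn_snd fun p hp => hp.2).smul ((hgc.comp hm hmaps).add
      (hm.smul (hg'c.comp hm hmaps)))
  have hswap : (∫ s in s₀..s₁, ∫ t in t₁..t₂, H s t) = ∫ t in t₁..t₂, ∫ s in s₀..s₁, H s t := by
    refine intervalIntegral_intervalIntegral_swap ?_
    rw [uIoc_of_le hs, uIoc_of_le ht]
    exact (hHc.integrableOn_compact (isCompact_Icc.prod isCompact_Icc)).mono_set
      (prod_mono Ioc_subset_Icc_self Ioc_subset_Icc_self)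
  have h1 : ∀ s ∈ Icc s₀ s₁, ∫ t in t₁..t₂, H s t = a t₂ • g (s * a t₂) - a t₁ • g (s * a t₁) := by
    intro s hs'
    have hcs : ContinuousOn (H s) (Icc t₁ t₂) :=
      hHc.comp (f := fun t : ℝ => (s, t)) (by fun_prop) fun t ht' => ⟨hs', ht'⟩
    refine intervalIntegral.integral_eq_sub_of_hasDerivAt (f := fun t => a t • g (s * a t)) ?_
      (hcs.intervalIntegrable_of_Icc ht)
    intro t ht'
    rw [uIcc_of_le ht] at ht'
    have e := (ha t ht')
    have e2 := (hgd _ (hmem s hs' t ht')).scomp t (e.const_mul (s : ℂ))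
    convert! e.smul e2 using 1
    simp only [H, Function.comp, smul_add, smul_smul]
    rw [add_comm]
    congr 2
    ring
  have h2 : ∀ t ∈ Icc t₁ t₂, ∫ s in s₀..s₁, H s t =
      a' t • ((s₁ : ℂ) • g (s₁ * a t)) - a' t • ((s₀ : ℂ) • g (s₀ * a t)) := by
    intro t ht'
    have hcs : ContinuousOn (fun s => H s t) (Icc s₀ s₁) :=
      hHc.comp (f := fun s : ℝ => (s, t)) (by fun_prop) fun s hs' => ⟨hs', ht'⟩
    refine intervalIntegral.integral_eq_sub_of_hasDerivAt
      (f := fun s : ℝ => a' t • ((s : ℂ) • g (s * a t))) ?_ (hcs.intervalIntegrable_of_Icc hs)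
    intro s hs'
    rw [uIcc_of_le hs] at hs'
    have e : HasDerivAt (fun s : ℝ => (s : ℂ)) 1 s := Complex.ofRealCLM.hasDerivAt
    have e2 := (hgd _ (hmem s hs' t ht')).scomp s (e.mul_const (a t))
    convert! (e.smul e2).const_smul (a' t) using 1
    simp only [H, Function.comp, smul_add, smul_smul, one_smul, one_mul]
    rw [add_comm]
  have hi : ∀ s ∈ Icc s₀ s₁,
      IntervalIntegrable (fun t => a' t • ((s : ℂ) • g (s * a t))) volume t₁ t₂ := by
    intro s hs'
    refine ContinuousOn.intervalIntegrable_of_Icc ht (ha'.smul (ContinuousOn.const_smul ?_ _))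
    exact hgc.comp (by fun_prop) fun t ht' => hmem s hs' t ht'
  rw [← intervalIntegral.integral_sub (hi _ ⟨hs, le_rfl⟩) (hi _ ⟨le_rfl, hs⟩)]
  rw [← intervalIntegral.integral_congr (fun t ht' => h2 t (by rwa [uIcc_of_le ht] at ht')),
    ← hswap]
  exact intervalIntegral.integral_congr (fun s hs' => h1 s (by rwa [uIcc_of_le hs] at hs'))

/-- The factor `s` from the dilated line element cancels the `1 / s` in the bound on `g`, leaving
`wt ε s`. This serves both for shrinking the curve to `0` and for expanding it to infinity. -/
lemma tendsto_integral_dilation {K ε : ℝ} {l : Filter ℝ} (ht : t₁ ≤ t₂)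
    (ha' : ContinuousOn a' (Icc t₁ t₂)) (hl : Tendsto (wt ε) l (𝓝 0))
    (hb : ∀ᶠ s : ℝ in l, 0 < s ∧ ∀ t ∈ Icc t₁ t₂, ‖g (s * a t)‖ ≤ K * (wt ε s / s)) :
    Tendsto (fun s : ℝ => ∫ t in t₁..t₂, a' t • ((s : ℂ) • g (s * a t))) l (𝓝 0) := by
  obtain ⟨M, hM⟩ := isCompact_Icc.exists_bound_of_continuousOn ha'
  have hlim : Tendsto (fun s => M * (K * wt ε s) * |t₂ - t₁|) l (𝓝 0) := by
    simpa using ((hl.const_mul K).const_mul M).mul_const |t₂ - t₁|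
  refine squeeze_zero_norm' ?_ hlim
  filter_upwards [hb] with s ⟨hs, hb⟩
  refine intervalIntegral.norm_integral_le_of_norm_le_const fun t ht' => ?_
  rw [uIoc_of_le ht] at ht'
  have ht'' := Ioc_subset_Icc_self ht'
  have hM0 : 0 ≤ M := (norm_nonneg _).trans (hM t ht'')
  rw [norm_smul, norm_smul, Complex.norm_real, Real.norm_of_nonneg hs.le]
  have : s * ‖g (s * a t)‖ ≤ K * wt ε s := by
    calc s * ‖g (s * a t)‖ ≤ s * (K * (wt ε s / s)) := by gcongr; exact hb t ht''
      _ = K * wt ε s := by field_simp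
  exact mul_le_mul (hM t ht'') this (by positivity) hM0

lemma integrableOn_ray {S : Set ℝ} (hSm : MeasurableSet S) (hS : S ⊆ Ioi 0) {K ε : ℝ} (hε : 0 < ε)
    (hg : DifferentiableOn ℂ g U) {p : ℂ} (hmem : ∀ s ∈ S, (s : ℂ) * p ∈ U)
    (hb : ∀ s ∈ S, ‖g (s * p)‖ ≤ K * (wt ε s / s)) :
    IntegrableOn (fun s : ℝ => p • g (s * p)) S := by
  refine Integrable.smul p ?_
  refine Integrable.mono' (((integrableOn_wt_div hε).mono_set hS).const_mul K) ?_ ?_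
  · refine ContinuousOn.aestronglyMeasurable ?_ hSm
    exact hg.continuousOn.comp (by fun_prop) hmem
  · exact (ae_restrict_iff' hSm).2 (.of_forall hb)

/-- The curve is contracted to the origin: in `integral_dilation_sub` the dilated integral tends to
zero, and only the two segments from `0` to the endpoints remain. -/
theorem integral_eq_ray_zero_one [CompleteSpace E] {K ε : ℝ} (hε : 0 < ε) (hU : IsOpen U)
    (hg : DifferentiableOn ℂ g U) (ht : t₁ ≤ t₂)
    (ha : ∀ t ∈ Icc t₁ t₂, HasDerivAt a (a' t) t) (ha' : ContinuousOn a' (Icc t₁ t₂))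
    (hmem : ∀ s ∈ Ioc (0 : ℝ) 1, ∀ t ∈ Icc t₁ t₂, (s : ℂ) * a t ∈ U)
    (hb : ∀ s ∈ Ioc (0 : ℝ) 1, ∀ t ∈ Icc t₁ t₂, ‖g (s * a t)‖ ≤ K * (wt ε s / s)) :
    ∫ t in t₁..t₂, a' t • g (a t) =
      ∫ s in Ioc (0 : ℝ) 1, (a t₂ • g (s * a t₂) - a t₁ • g (s * a t₁)) := by
  have hlim := tendsto_integral_dilation (l := 𝓝[>] 0) ht ha' (tendsto_wt_zero hε) (K := K)
    (g := g) (a := a) (by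
      filter_upwards [Ioc_mem_nhdsGT (zero_lt_one' ℝ)] with s hs using ⟨hs.1, hb s hs⟩)
  have hint : IntegrableOn
      (fun s : ℝ => a t₂ • g (s * a t₂) - a t₁ • g (s * a t₁)) (Ioc 0 1) :=
    (integrableOn_ray measurableSet_Ioc (fun s hs => hs.1) hε hg
      (fun s hs => hmem s hs t₂ ⟨ht, le_rfl⟩) (fun s hs => hb s hs t₂ ⟨ht, le_rfl⟩)).sub
    (integrableOn_ray measurableSet_Ioc (fun s hs => hs.1) hε hg
      (fun s hs => hmem s hs t₁ ⟨le_rfl, ht⟩) (fun s hs => hb s hs t₁ ⟨le_rfl, ht⟩))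
  have hlim2 : Tendsto (fun s₀ : ℝ => ∫ s in s₀..1, (a t₂ • g (s * a t₂) - a t₁ • g (s * a t₁)))
      (𝓝[>] 0) (𝓝 (∫ s in (0 : ℝ)..1, (a t₂ • g (s * a t₂) - a t₁ • g (s * a t₁)))) := by
    have h0 : IntervalIntegrable (fun s : ℝ => a t₂ • g (s * a t₂) - a t₁ • g (s * a t₁))
        volume 0 1 := (intervalIntegrable_iff_integrableOn_Ioc_of_le zero_le_one).2 hint
    have := (intervalIntegral.continuousOn_primitive_interval_left (μ := volume) (a := 0) (b := 1)
      (f := fun s : ℝ => a t₂ • g (s * a t₂) - a t₁ • g (s * a t₁)) (by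
        rw [uIcc_of_le zero_le_one]; exact (integrableOn_Icc_iff_integrableOn_Ioc).2 hint))
    have := (this 0 (by simp)).tendsto
    rw [uIcc_of_le zero_le_one] at this
    refine this.mono_left ?_
    rw [← nhdsWithin_Ioc_eq_nhdsGT (zero_lt_one' ℝ)]
    exact nhdsWithin_mono _ Ioc_subset_Icc_self
  rw [intervalIntegral.integral_of_le zero_le_one] at hlim2
  have hc : Tendsto (fun s : ℝ => ∫ t in t₁..t₂, a' t • ((s : ℂ) • g (s * a t))) (𝓝[>] 0)
      (𝓝 ((∫ t in t₁..t₂, a' t • g (a t)) -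
        ∫ s in Ioc (0 : ℝ) 1, (a t₂ • g (s * a t₂) - a t₁ • g (s * a t₁)))) := by
    refine (hlim2.const_sub _).congr' ?_
    filter_upwards [Ioc_mem_nhdsGT (zero_lt_one' ℝ)] with s₀ hs₀
    have := integral_dilation_sub hU hg ht ha ha' hs₀.2 (fun s hs => hmem s ⟨hs₀.1.trans_le hs.1, hs.2⟩)
    simp only [Complex.ofReal_one, one_smul, one_mul] at this
    rw [← this]; abel
  exact sub_eq_zero.1 (tendsto_nhds_unique hc hlim)

/-- The curve is expanded to infinity; what remains are the half-lines beyond its endpoints. -/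
theorem integral_eq_neg_ray_one_top [CompleteSpace E] {K ε : ℝ} (hε : 0 < ε) (hU : IsOpen U)
    (hg : DifferentiableOn ℂ g U) (ht : t₁ ≤ t₂)
    (ha : ∀ t ∈ Icc t₁ t₂, HasDerivAt a (a' t) t) (ha' : ContinuousOn a' (Icc t₁ t₂))
    (hmem : ∀ s : ℝ, 1 ≤ s → ∀ t ∈ Icc t₁ t₂, (s : ℂ) * a t ∈ U)
    (hb : ∀ s : ℝ, 1 ≤ s → ∀ t ∈ Icc t₁ t₂, ‖g (s * a t)‖ ≤ K * (wt ε s / s)) :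
    ∫ t in t₁..t₂, a' t • g (a t) =
      -∫ s in Ioi (1 : ℝ), (a t₂ • g (s * a t₂) - a t₁ • g (s * a t₁)) := by
  have hlim := tendsto_integral_dilation (l := atTop) ht ha' (tendsto_wt_atTop hε) (K := K)
    (g := g) (a := a) (by
      filter_upwards [eventually_ge_atTop 1] with s hs using ⟨by linarith, hb s hs⟩)
  have hsub : Ioi (1 : ℝ) ⊆ Ioi 0 := Ioi_subset_Ioi zero_le_one
  have hint : IntegrableOn
      (fun s : ℝ => a t₂ • g (s * a t₂) - a t₁ • g (s * a t₁)) (Ioi 1) :=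
    (integrableOn_ray measurableSet_Ioi hsub hε hg
      (fun s hs => hmem s (le_of_lt hs) t₂ ⟨ht, le_rfl⟩)
      (fun s hs => hb s (le_of_lt hs) t₂ ⟨ht, le_rfl⟩)).sub
    (integrableOn_ray measurableSet_Ioi hsub hε hg
      (fun s hs => hmem s (le_of_lt hs) t₁ ⟨le_rfl, ht⟩)
      (fun s hs => hb s (le_of_lt hs) t₁ ⟨le_rfl, ht⟩))
  have hlim2 := intervalIntegral_tendsto_integral_Ioi 1 hint tendsto_id
  have hc : Tendsto (fun s : ℝ => ∫ t in t₁..t₂, a' t • ((s : ℂ) • g (s * a t))) atTop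
      (𝓝 ((∫ t in t₁..t₂, a' t • g (a t)) +
        ∫ s in Ioi (1 : ℝ), (a t₂ • g (s * a t₂) - a t₁ • g (s * a t₁)))) := by
    refine (hlim2.const_add _).congr' ?_
    filter_upwards [eventually_ge_atTop 1] with s₁ hs₁
    have := integral_dilation_sub hU hg ht ha ha' hs₁ (fun s hs => hmem s hs.1)
    simp only [Complex.ofReal_one, one_smul, one_mul] at this
    rw [id, ← this]; abel
  exact eq_neg_of_add_eq_zero_left (tendsto_nhds_unique hc hlim)

/-- Contracting and expanding the same curve evaluate its integral twice. Comparing them shows that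
the full rays through its two endpoints carry equal integrals, which is the rotation of rays. -/
theorem ray_integral_eq [CompleteSpace E] {K ε : ℝ} (hε : 0 < ε) (hU : IsOpen U)
    (hg : DifferentiableOn ℂ g U) (ht : t₁ ≤ t₂)
    (ha : ∀ t ∈ Icc t₁ t₂, HasDerivAt a (a' t) t) (ha' : ContinuousOn a' (Icc t₁ t₂))
    (hmem : ∀ s : ℝ, 0 < s → ∀ t ∈ Icc t₁ t₂, (s : ℂ) * a t ∈ U)
    (hb : ∀ s : ℝ, 0 < s → ∀ t ∈ Icc t₁ t₂, ‖g (s * a t)‖ ≤ K * (wt ε s / s)) :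
    ∫ s in Ioi (0 : ℝ), (a t₂ • g (s * a t₂) - a t₁ • g (s * a t₁)) = 0 := by
  have h1 := integral_eq_ray_zero_one hε hU hg ht ha ha' (fun s hs => hmem s hs.1)
    (fun s hs => hb s hs.1)
  have h2 := integral_eq_neg_ray_one_top hε hU hg ht ha ha'
    (fun s hs => hmem s (by linarith)) (fun s hs => hb s (by linarith))
  have hint : IntegrableOn
      (fun s : ℝ => a t₂ • g (s * a t₂) - a t₁ • g (s * a t₁)) (Ioi 0) :=
    (integrableOn_ray measurableSet_Ioi subset_rfl hε hg
      (fun s hs => hmem s hs t₂ ⟨ht, le_rfl⟩) (fun s hs => hb s hs t₂ ⟨ht, le_rfl⟩)).sub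
    (integrableOn_ray measurableSet_Ioi subset_rfl hε hg
      (fun s hs => hmem s hs t₁ ⟨le_rfl, ht⟩) (fun s hs => hb s hs t₁ ⟨le_rfl, ht⟩))
  rw [← Ioc_union_Ioi_eq_Ioi (zero_le_one' ℝ)] at hint ⊢
  rw [setIntegral_union (Ioc_disjoint_Ioi le_rfl) measurableSet_Ioi hint.left_of_union
    hint.right_of_union, ← h1, h2, neg_add_cancel]

end Dilation

/-! ### Holomorphic dependence of integrals on several complex parameters -/

section Parameter

variable {H : Type*} [NormedAddCommGroup H] [NormedSpace ℂ H]

/-- Restrict `F` to the complex line through `x` in the direction `v` and apply the Cauchy estimate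
in one variable on the disc of radius `r / (2‖v‖)`. -/
lemma norm_fderiv_le_of_bounded_on_ball {F : H → ℂ} {x : H} {r M : ℝ} (hr : 0 < r)
    (hF : DifferentiableOn ℂ F (Metric.ball x r)) (hM : ∀ y ∈ Metric.ball x r, ‖F y‖ ≤ M) :
    ‖fderiv ℂ F x‖ ≤ 2 * M / r := by
  have hM0 : 0 ≤ M := (norm_nonneg _).trans (hM x (Metric.mem_ball_self hr))
  refine ContinuousLinearMap.opNorm_le_bound _ (by positivity) fun v => ?_
  rcases eq_or_ne v 0 with rfl | hv
  · simp
  have hv0 : 0 < ‖v‖ := norm_pos_iff.2 hv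
  have hρ : 0 < r / 2 / ‖v‖ := by positivity
  have hmem : ∀ ζ ∈ Metric.closedBall (0 : ℂ) (r / 2 / ‖v‖), x + ζ • v ∈ Metric.ball x r := by
    intro ζ hζ
    rw [mem_closedBall_zero_iff, le_div_iff₀ hv0] at hζ
    rw [mem_ball_iff_norm, add_sub_cancel_left, norm_smul]
    linarith
  have hd : DifferentiableOn ℂ (fun ζ : ℂ => F (x + ζ • v))
      (Metric.closedBall (0 : ℂ) (r / 2 / ‖v‖)) :=
    hF.comp (by fun_prop) hmem
  have hder : HasDerivAt (fun ζ : ℂ => F (x + ζ • v)) (fderiv ℂ F x v) 0 := by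
    have h1 : HasFDerivAt F (fderiv ℂ F x) (x + (0 : ℂ) • v) := by
      rw [zero_smul, add_zero]
      exact (hF.differentiableAt (Metric.ball_mem_nhds x hr)).hasFDerivAt
    have h2 : HasDerivAt (fun ζ : ℂ => x + ζ • v) v 0 := by
      simpa using ((hasDerivAt_id (0 : ℂ)).smul_const v).const_add x
    exact h1.comp_hasDerivAt (0 : ℂ) h2
  have := Complex.norm_deriv_le_of_forall_mem_sphere_norm_le hρ
    (hd.diffContOnCl_ball subset_rfl)
    (fun ζ hζ => hM _ (hmem ζ (Metric.sphere_subset_closedBall hζ)))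
  rw [hder.deriv] at this
  refine this.trans_eq ?_
  field_simp

/-- Directional derivatives are limits of sequences of difference quotients, and in finite dimension
the derivative is a finite combination of partial derivatives. Only measurability of each `F y` for
`y` near `x` is needed. -/
lemma aestronglyMeasurable_fderiv_of_pi {n : ℕ} {α : Type*} [MeasurableSpace α] {μ : Measure α}
    {F : (Fin n → ℂ) → α → ℂ} {x : Fin n → ℂ}
    (hF : ∀ᵐ a ∂μ, DifferentiableAt ℂ (fun y => F y a) x)
    (hmeas : ∀ᶠ y in 𝓝 x, AEStronglyMeasurable (F y) μ) :
    AEStronglyMeasurable (fun a => fderiv ℂ (fun y => F y a) x) μ := by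
  have hdir : ∀ v : Fin n → ℂ,
      AEStronglyMeasurable (fun a => fderiv ℂ (fun y => F y a) x v) μ := by
    intro v
    have hlim : Tendsto (fun k : ℕ => x + ((k : ℂ) + 1)⁻¹ • v) atTop (𝓝 x) := by
      have : Tendsto (fun k : ℕ => ((k : ℂ) + 1)⁻¹) atTop (𝓝 0) := by
        simpa using tendsto_one_div_add_atTop_nhds_zero_nat (𝕜 := ℂ)
      simpa using (this.smul_const v).const_add x
    obtain ⟨N, hN⟩ := eventually_atTop.1 (hlim.eventually hmeas)
    refine aestronglyMeasurable_of_tendsto_ae (u := (atTop : Filter ℕ))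
      (f := fun k a => ((k + N : ℕ) + 1 : ℂ) * (F (x + (((k + N : ℕ) : ℂ) + 1)⁻¹ • v) a - F x a))
      ?_ ?_
    · intro k
      exact (((hN _ (Nat.le_add_left N k)).sub hmeas.self_of_nhds).const_mul _)
    · filter_upwards [hF] with a ha
      have hder := ha.hasFDerivAt
      have hc : Tendsto (fun k : ℕ => ‖((k + N : ℕ) : ℂ) + 1‖) atTop atTop := by
        have : ∀ k : ℕ, ‖((k + N : ℕ) : ℂ) + 1‖ = (k : ℝ) + (N + 1) := by
          intro k
          have : ((k + N : ℕ) : ℂ) + 1 = ((k + (N + 1) : ℝ) : ℂ) := by push_cast; ring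
          rw [this, Complex.norm_real, Real.norm_of_nonneg (by positivity)]
        simp_rw [this]
        exact tendsto_atTop_add_const_right _ _ tendsto_natCast_atTop_atTop
      have := hder.lim v (l := atTop) (c := fun k : ℕ => ((k + N : ℕ) : ℂ) + 1) hc
      simpa only [smul_eq_mul] using this
  have hsum : (fun a => fderiv ℂ (fun y => F y a) x) = fun a =>
      ∑ i, (fderiv ℂ (fun y => F y a) x (Pi.single i 1)) •
        (ContinuousLinearMap.proj i : (Fin n → ℂ) →L[ℂ] ℂ) := by
    funext a
    ext v
    conv_lhs => rw [pi_eq_sum_univ' v]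
    simp [map_sum, mul_comm]
  rw [hsum]
  exact Finset.aestronglyMeasurable_fun_sum _ fun i _ => (hdir _).smul_const _

/-- An integral of holomorphic functions of several variables, locally uniformly dominated, is
holomorphic. -/
theorem differentiableOn_integral {n : ℕ} {α : Type*} [MeasurableSpace α] {μ : Measure α}
    {F : (Fin n → ℂ) → α → ℂ} {U : Set (Fin n → ℂ)} (hU : IsOpen U)
    (hF : ∀ᵐ a ∂μ, DifferentiableOn ℂ (fun y => F y a) U)
    (hmeas : ∀ y ∈ U, AEStronglyMeasurable (F y) μ)
    (hbd : ∀ x ∈ U, ∃ r > 0, ∃ b : α → ℝ, Integrable b μ ∧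
      ∀ᵐ a ∂μ, ∀ y ∈ Metric.ball x r, ‖F y a‖ ≤ b a) :
    DifferentiableOn ℂ (fun y => ∫ a, F y a ∂μ) U := by
  intro x hx
  obtain ⟨r₁, hr₁, b, hb, hFb⟩ := hbd x hx
  obtain ⟨r₂, hr₂, hball⟩ := Metric.isOpen_iff.1 hU x hx
  set r := min r₁ r₂ with hr
  have hr0 : 0 < r := lt_min hr₁ hr₂
  -- The Cauchy estimate at points of the ball of radius `r / 2`, each with a ball of radius `r / 2`
  -- around it, turns the dominating function into an integrable Lipschitz constant.
  have hlip : ∀ᵐ a ∂μ, LipschitzOnWith (Real.nnabs (4 * b a / r)) (fun y => F y a)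
      (Metric.ball x (r / 2)) := by
    filter_upwards [hF, hFb] with a hda hba
    have hba0 : 0 ≤ b a := (norm_nonneg _).trans (hba x (Metric.mem_ball_self hr₁))
    have hsub : ∀ y ∈ Metric.ball x (r / 2), Metric.ball y (r / 2) ⊆ Metric.ball x r := by
      intro y hy
      refine Metric.ball_subset_ball' ?_
      have := Metric.mem_ball.1 hy
      linarith
    refine Convex.lipschitzOnWith_of_nnnorm_fderiv_le (𝕜 := ℂ) (fun y hy => ?_) (fun y hy => ?_)
      (convex_ball x (r / 2))
    · refine (hda.mono hball).differentiableAt (Metric.isOpen_ball.mem_nhds ?_)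
      exact Metric.ball_subset_ball (by linarith [min_le_right r₁ r₂]) hy
    · rw [← NNReal.coe_le_coe, coe_nnnorm, Real.coe_nnabs, abs_of_nonneg (by positivity)]
      have := norm_fderiv_le_of_bounded_on_ball (half_pos hr0)
        ((hda.mono hball).mono ((hsub y hy).trans (Metric.ball_subset_ball (min_le_right _ _))))
        (fun z hz => hba z (Metric.ball_subset_ball (min_le_left _ _) (hsub y hy hz)))
      refine this.trans_eq ?_
      field_simp
      ring
  have hdiff : ∀ᵐ a ∂μ, DifferentiableAt ℂ (fun y => F y a) x := by
    filter_upwards [hF] with a ha using ha.differentiableAt (hU.mem_nhds hx)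
  have hmeas' : ∀ᶠ y in 𝓝 x, AEStronglyMeasurable (F y) μ := by
    filter_upwards [hU.mem_nhds hx] with y hy using hmeas y hy
  have := hasFDerivAt_integral_of_dominated_loc_of_lip (𝕜 := ℂ) (μ := μ) (F := F) (x₀ := x)
    (F' := fun a => fderiv ℂ (fun y => F y a) x) (bound := fun a => 4 * b a / r)
    (Metric.ball_mem_nhds x (half_pos hr0)) hmeas'
    (hb.mono' (hmeas x hx) (hFb.mono fun a ha => ha x (Metric.mem_ball_self hr₁)))
    (aestronglyMeasurable_fderiv_of_pi hdiff hmeas') hlip ((hb.const_mul 4).div_const r)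
    (hdiff.mono fun a ha => ha.hasFDerivAt)
  exact this.2.differentiableAt.differentiableWithinAt

end Parameter

/-! ### Sectors and Stolz domains -/

lemma mem_sector_iff {ν : ℝ} (h0 : 0 ≤ ν) (h1 : ν ≤ Real.pi) {z : ℂ} :
    z ∈ sector ν ↔ ‖z‖ * Real.cos ν < z.re := by
  rcases eq_or_ne z 0 with rfl | hz
  · simp [sector]
  have hz' : 0 < ‖z‖ := norm_pos_iff.2 hz
  have hre : z.re = ‖z‖ * Real.cos |Complex.arg z| := by
    rw [Real.cos_abs, Complex.cos_arg hz]; field_simp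
  rw [hre, mul_lt_mul_iff_right₀ hz', Real.strictAntiOn_cos.lt_iff_gt ⟨h0, h1⟩
    ⟨abs_nonneg _, Complex.abs_arg_le_pi z⟩]
  simp [sector, hz]

lemma isOpen_sector {ν : ℝ} (h0 : 0 ≤ ν) (h1 : ν ≤ Real.pi) : IsOpen (sector ν) := by
  have : sector ν = {z | ‖z‖ * Real.cos ν < z.re} := Set.ext fun z => mem_sector_iff h0 h1
  rw [this]
  exact isOpen_lt (by fun_prop) Complex.continuous_re

lemma closure_sector_subset {ν : ℝ} (h0 : 0 ≤ ν) (h1 : ν ≤ Real.pi) :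
    closure (sector ν) ⊆ {z | ‖z‖ * Real.cos ν ≤ z.re} :=
  closure_minimal (fun _ hz => ((mem_sector_iff h0 h1).1 hz).le)
    (isClosed_le (by fun_prop) Complex.continuous_re)

lemma sector_mono {ν ν' : ℝ} (h : ν ≤ ν') : sector ν ⊆ sector ν' :=
  fun _ hz => ⟨hz.1, hz.2.trans_le h⟩

lemma smul_mem_sector {ν : ℝ} {z : ℂ} (hz : z ∈ sector ν) {s : ℝ} (hs : 0 < s) :
    (s : ℂ) * z ∈ sector ν := by
  refine ⟨mul_ne_zero (by exact_mod_cast hs.ne') hz.1, ?_⟩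
  rw [Complex.arg_real_mul _ hs]
  exact hz.2

/-- The reflected Stolz domain `1 - B_γ`. -/
def dstolz (γ : ℝ) : Set ℂ := {w | ∃ r ∈ Ioc (0 : ℝ) 1, ‖w - r‖ < r * Real.sin γ}

/-- A closed set containing the reflection of the closure of `B_γ`. -/
def cdstolz (γ : ℝ) : Set ℂ := {w | ∃ r ∈ Icc (0 : ℝ) 1, ‖w - r‖ ≤ r * Real.sin γ}

lemma isOpen_dstolz (γ : ℝ) : IsOpen (dstolz γ) := by
  have : dstolz γ = ⋃ r ∈ Ioc (0 : ℝ) 1, Metric.ball (r : ℂ) (r * Real.sin γ) := by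
    ext w; simp [dstolz, dist_eq_norm]
  rw [this]
  exact isOpen_biUnion fun _ _ => Metric.isOpen_ball

lemma isClosed_cdstolz {γ : ℝ} (hγ : 0 ≤ Real.sin γ) : IsClosed (cdstolz γ) := by
  have : cdstolz γ = (fun p : ℝ × ℂ => (p.1 : ℂ) + p.1 * p.2) ''
      (Icc (0 : ℝ) 1 ×ˢ Metric.closedBall (0 : ℂ) (Real.sin γ)) := by
    ext w
    constructor
    · rintro ⟨r, hr, h⟩
      rcases hr.1.eq_or_lt with rfl | hr0
      · refine ⟨(0, 0), ⟨hr, by simpa using hγ⟩, ?_⟩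
        simp at h
        simp [h]
      · refine ⟨(r, (w - r) / r), ⟨hr, ?_⟩, ?_⟩
        · simp only [mem_closedBall_zero_iff, norm_div, Complex.norm_real,
            Real.norm_of_nonneg hr.1]
          rwa [div_le_iff₀ hr0, mul_comm]
        · have : (r : ℂ) ≠ 0 := by exact_mod_cast hr0.ne'
          field_simp
          ring
    · rintro ⟨⟨r, b⟩, ⟨hr, hb⟩, rfl⟩
      refine ⟨r, hr, ?_⟩
      rw [mem_closedBall_zero_iff] at hb
      simp only [add_sub_cancel_left, norm_mul, Complex.norm_real, Real.norm_of_nonneg hr.1]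
      exact mul_le_mul_of_nonneg_left hb hr.1
  rw [this]
  refine ((isCompact_Icc.prod (isCompact_closedBall _ _)).image ?_).isClosed
  exact (Complex.continuous_ofReal.comp continuous_fst).add
    ((Complex.continuous_ofReal.comp continuous_fst).mul continuous_snd)

/-- The hull of `1` and the disc is the union of the segments from `1` to the disc. After
reflection, the points at fraction `r` along these segments fill the disc of radius `r sin γ` about
`r`. Passing to the interior removes exactly the vertex. -/
lemma mem_stolz_iff {γ : ℝ} (h0 : 0 < Real.sin γ) {z : ℂ} :
    z ∈ stolz γ ↔ 1 - z ∈ dstolz γ := by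
  have hconv : ∀ z : ℂ, z ∈ convexHull ℝ ({1} ∪ Metric.ball (0 : ℂ) (Real.sin γ)) ↔
      z = 1 ∨ 1 - z ∈ dstolz γ := by
    intro z
    rw [singleton_union, convexHull_insert ⟨0, Metric.mem_ball_self h0⟩,
      (convex_ball (0 : ℂ) _).convexHull_eq, mem_convexJoin]
    constructor
    · rintro ⟨_, rfl, b, hb, u, v, hu, hv, huv, rfl⟩
      rw [mem_ball_zero_iff] at hb
      rcases hv.eq_or_lt with rfl | hv0
      · left
        have : u = 1 := by linarith
        simp [this]
      · right
        refine ⟨v, ⟨hv0, by linarith⟩, ?_⟩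
        have : 1 - (u • (1 : ℂ) + v • b) - (v : ℂ) = -((v : ℂ) * b) := by
          have : (u : ℂ) = 1 - v := by
            rw [eq_sub_iff_add_eq]; exact_mod_cast huv
          simp only [Complex.real_smul, this]; ring
        rw [this, norm_neg, norm_mul, Complex.norm_real, Real.norm_of_nonneg hv]
        exact mul_lt_mul_of_pos_left hb hv0
    · rintro (rfl | ⟨r, hr, h⟩)
      · exact ⟨1, rfl, 0, Metric.mem_ball_self h0, left_mem_segment _ _ _⟩
      · have hr0 : (r : ℂ) ≠ 0 := by exact_mod_cast hr.1.ne'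
        refine ⟨1, rfl, (z - (1 - r)) / r, ?_, 1 - r, r, by linarith [hr.2], hr.1.le, by ring, ?_⟩
        · rw [mem_ball_zero_iff, norm_div, Complex.norm_real, Real.norm_of_nonneg hr.1.le,
            div_lt_iff₀ hr.1, mul_comm, ← norm_neg]
          convert! h using 2
          ring
        · simp only [Complex.real_smul]
          push_cast
          field_simp
          ring
  constructor
  · intro hz
    rcases (hconv z).1 (interior_subset hz) with rfl | h
    -- The vertex is not interior: points slightly to the right of `1` reflect to negative reals,
    -- which lie in none of the discs since `sin γ ≤ 1`.
    · exfalso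
      obtain ⟨ε, hε, hball⟩ := Metric.mem_nhds_iff.1 (mem_interior_iff_mem_nhds.1 hz)
      have hmem : (1 : ℂ) + (ε / 2 : ℝ) ∈ Metric.ball (1 : ℂ) ε := by
        rw [mem_ball_iff_norm, add_sub_cancel_left, Complex.norm_real,
          Real.norm_of_nonneg (by positivity)]
        linarith
      rcases (hconv _).1 (hball hmem) with h | ⟨r, hr, h⟩
      · have : ((ε / 2 : ℝ) : ℂ) = 0 := by simpa using h
        rw [Complex.ofReal_eq_zero] at this
        linarith
      · have e : (1 : ℂ) - (1 + (ε / 2 : ℝ)) - r = ((-(ε / 2 + r) : ℝ) : ℂ) := by push_cast; ring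
        rw [e, Complex.norm_real, norm_neg, Real.norm_of_nonneg (by linarith [hr.1])] at h
        nlinarith [hr.1, Real.sin_le_one γ]
    · exact h
  · intro hz
    have hop : IsOpen {z : ℂ | 1 - z ∈ dstolz γ} :=
      (isOpen_dstolz γ).preimage (continuous_const.sub continuous_id)
    exact interior_maximal (fun y hy => (hconv y).2 (Or.inr hy)) hop hz

lemma dstolz_subset_cdstolz {γ : ℝ} : dstolz γ ⊆ cdstolz γ :=
  fun _ ⟨r, hr, h⟩ => ⟨r, Ioc_subset_Icc_self hr, h.le⟩

lemma closure_stolz_subset {γ : ℝ} (h0 : 0 < Real.sin γ) {z : ℂ} (hz : z ∈ closure (stolz γ)) :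
    1 - z ∈ cdstolz γ := by
  have hcl : IsClosed {z : ℂ | 1 - z ∈ cdstolz γ} :=
    (isClosed_cdstolz h0.le).preimage (continuous_const.sub continuous_id)
  have hsub : stolz γ ⊆ {z : ℂ | 1 - z ∈ cdstolz γ} := fun y hy =>
    dstolz_subset_cdstolz ((mem_stolz_iff h0).1 hy)
  exact closure_minimal hsub hcl hz

/-- The circle of radius `r sin γ` about `r` is tangent to the rays of angle `±γ` at distance `r cos
γ`. Algebraically this is the square `(‖w‖ - r cos γ)²`. -/
lemma dstolz_subset_sector {γ : ℝ} (h0 : 0 < γ) (h1 : γ < Real.pi / 2) :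
    dstolz γ ⊆ sector γ := by
  rintro w ⟨r, hr, h⟩
  rw [mem_sector_iff h0.le (by linarith)]
  have hs : 0 < Real.sin γ := Real.sin_pos_of_pos_of_lt_pi h0 (by linarith)
  have hc : 0 < Real.cos γ := Real.cos_pos_of_mem_Ioo ⟨by linarith, h1⟩
  have h2 : ‖w - r‖ ^ 2 < (r * Real.sin γ) ^ 2 := by
    exact pow_lt_pow_left₀ h (norm_nonneg _) two_ne_zero
  have h3 : ‖w - r‖ ^ 2 = ‖w‖ ^ 2 - 2 * r * w.re + r ^ 2 := by
    rw [Complex.sq_norm, Complex.sq_norm, Complex.normSq_apply, Complex.normSq_apply]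
    simp; ring
  have h4 := Real.sin_sq_add_cos_sq γ
  have h5 : (r * Real.sin γ) ^ 2 = r ^ 2 - (r * Real.cos γ) ^ 2 := by
    linear_combination r ^ 2 * h4
  have := hr.1
  have h6 : 2 * r * (‖w‖ * Real.cos γ) < 2 * r * w.re := by
    nlinarith [sq_nonneg (‖w‖ - r * Real.cos γ)]
  exact lt_of_mul_lt_mul_left h6 (by positivity)

lemma norm_le_two_of_mem_dstolz {γ : ℝ} {w : ℂ} (hw : w ∈ dstolz γ) : ‖w‖ ≤ 2 := by
  obtain ⟨r, hr, h⟩ := hw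
  have := norm_add_le (w - r) r
  rw [sub_add_cancel, Complex.norm_real, Real.norm_of_nonneg hr.1.le] at this
  nlinarith [Real.sin_le_one γ, hr.1, hr.2]

lemma smul_mem_dstolz {γ : ℝ} {w : ℂ} (hw : w ∈ dstolz γ) {s : ℝ} (hs : s ∈ Ioc (0 : ℝ) 1) :
    (s : ℂ) * w ∈ dstolz γ := by
  obtain ⟨r, hr, h⟩ := hw
  refine ⟨s * r, ⟨mul_pos hs.1 hr.1, mul_le_one₀ hs.2 hr.1.le hr.2⟩, ?_⟩
  push_cast
  rw [← mul_sub, norm_mul, Complex.norm_real, Real.norm_of_nonneg hs.1.le, mul_assoc]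
  exact mul_lt_mul_of_pos_left h hs.1

lemma smul_notMem_cdstolz {γ : ℝ} {w : ℂ} (hw : w ∉ cdstolz γ) {s : ℝ} (hs : 1 ≤ s) :
    (s : ℂ) * w ∉ cdstolz γ := by
  have hs0 : 0 < s := by linarith
  have hsc : (s : ℂ) ≠ 0 := by exact_mod_cast hs0.ne'
  rintro ⟨r, hr, h⟩
  refine hw ⟨r / s, ⟨by have := hr.1; positivity, (div_le_self hr.1 hs).trans hr.2⟩, ?_⟩
  have : w - ((r / s : ℝ) : ℂ) = (s * w - r) / s := by push_cast; field_simp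
  rw [this, norm_div, Complex.norm_real, Real.norm_of_nonneg hs0.le, div_le_iff₀ hs0]
  refine h.trans_eq ?_
  field_simp

lemma normSq_sub_real (z : ℂ) (r : ℝ) : ‖z - r‖ ^ 2 = ‖z‖ ^ 2 - 2 * r * z.re + r ^ 2 := by
  rw [Complex.sq_norm, Complex.sq_norm, Complex.normSq_apply, Complex.normSq_apply]
  simp; ring

/-- The distance from `r` to the ray of angle `β` is `r sin β`, which exceeds `r sin α`. -/
lemma ray_notMem_cdstolz {α β : ℝ} (hα : 0 < α) (hαβ : α < β) (hβ : β < Real.pi / 2) {z : ℂ}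
    (hz : z ≠ 0) (hre : z.re = ‖z‖ * Real.cos β) : z ∉ cdstolz α := by
  rintro ⟨r, hr, h⟩
  have hs : 0 < Real.sin α := Real.sin_pos_of_pos_of_lt_pi hα (by linarith)
  have hss : Real.sin α < Real.sin β :=
    Real.sin_lt_sin_of_lt_of_le_pi_div_two (by linarith) hβ.le hαβ
  rcases hr.1.eq_or_lt with rfl | hr0
  · simp at h; exact hz h
  have h2 : ‖z - r‖ ^ 2 ≤ (r * Real.sin α) ^ 2 := pow_le_pow_left₀ (norm_nonneg _) h 2
  rw [normSq_sub_real, hre] at h2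
  have h3 : (r * Real.sin α) ^ 2 < (r * Real.sin β) ^ 2 :=
    pow_lt_pow_left₀ (mul_lt_mul_of_pos_left hss hr0) (by positivity) two_ne_zero
  have h5 : (r * Real.sin β) ^ 2 = r ^ 2 - (r * Real.cos β) ^ 2 := by
    linear_combination r ^ 2 * Real.sin_sq_add_cos_sq β
  nlinarith [sq_nonneg (‖z‖ - r * Real.cos β)]

/-- With `r = ‖z‖ / cos β` the point `z` is the tangent point of the circle of radius `r sin β`
about `r`; the length condition says `r ≤ 1`. -/
lemma ray_mem_dstolz {β γ : ℝ} (hβ : 0 < β) (hβγ : β < γ) (hγ : γ < Real.pi / 2) {z : ℂ}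
    (hz : z ≠ 0) (hre : z.re = ‖z‖ * Real.cos β) (hle : ‖z‖ ≤ Real.cos β) : z ∈ dstolz γ := by
  have hc : 0 < Real.cos β := Real.cos_pos_of_mem_Ioo ⟨by linarith, by linarith⟩
  have hs : 0 < Real.sin β := Real.sin_pos_of_pos_of_lt_pi hβ (by linarith)
  have hss : Real.sin β < Real.sin γ :=
    Real.sin_lt_sin_of_lt_of_le_pi_div_two (by linarith) hγ.le hβγ
  have hz0 : 0 < ‖z‖ := norm_pos_iff.2 hz
  have hr0 : 0 < ‖z‖ / Real.cos β := by positivity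
  refine ⟨‖z‖ / Real.cos β, ⟨hr0, (div_le_one hc).2 hle⟩, ?_⟩
  have h2 : ‖z - (‖z‖ / Real.cos β : ℝ)‖ ^ 2 = (‖z‖ / Real.cos β * Real.sin β) ^ 2 := by
    rw [normSq_sub_real, hre]
    have := Real.sin_sq_add_cos_sq β
    field_simp
    linear_combination -this
  have h3 : ‖z - (‖z‖ / Real.cos β : ℝ)‖ = ‖z‖ / Real.cos β * Real.sin β :=
    (pow_left_inj₀ (norm_nonneg _) (by positivity) two_ne_zero).1 h2
  rw [h3]
  exact mul_lt_mul_of_pos_left hss hr0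

/-! ### The boundary curves -/

/-- The tangent point `cos β · exp (-iβ)` of the boundary of `1 - B_β`. -/
def corner (β : ℝ) : ℂ := (Real.cos β : ℂ) * Complex.exp (-((β : ℂ) * Complex.I))

/-- The tangent point `cos β · exp (iβ)` of the boundary of `1 - B_β`. -/
def corner' (β : ℝ) : ℂ := (Real.cos β : ℂ) * Complex.exp ((β : ℂ) * Complex.I)

/-- The circle arc on the boundary of `1 - B_β`, parametrized by `[1, 2]`. -/
def arc (β t : ℝ) : ℂ := 1 - (Real.sin β : ℂ) *
  Complex.exp (((Real.pi / 2 - β + (t - 1) * (Real.pi + 2 * β) : ℝ) : ℂ) * Complex.I)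

/-- The derivative of `arc β`. -/
def arc' (β t : ℝ) : ℂ := -((Real.sin β : ℂ) *
  (Complex.exp (((Real.pi / 2 - β + (t - 1) * (Real.pi + 2 * β) : ℝ) : ℂ) * Complex.I) *
    (((Real.pi + 2 * β : ℝ) : ℂ) * Complex.I)))

/-- The boundary of `1 - B_β`, parametrized by `[0, 3]`. -/
def bcurve (β t : ℝ) : ℂ := 1 - stolzBoundary β t

lemma one_sub_stolzTangent (β : ℝ) : 1 - stolzTangent β = corner β := by
  have h := Real.sin_sq_add_cos_sq β
  apply Complex.ext
  · simp [-Complex.ofReal_sin, -Complex.ofReal_cos, stolzTangent, corner, Complex.exp_re, Complex.exp_im, Real.cos_pi_div_two_sub]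
    linear_combination -h
  · simp [-Complex.ofReal_sin, -Complex.ofReal_cos, stolzTangent, corner, Complex.exp_re, Complex.exp_im, Real.sin_pi_div_two_sub]
    ring

lemma conj_corner (β : ℝ) : (starRingEnd ℂ) (corner β) = corner' β := by
  simp [-Complex.ofReal_sin, -Complex.ofReal_cos, corner, corner', ← Complex.exp_conj]

lemma bcurve_of_le_one {β t : ℝ} (ht : t ≤ 1) : bcurve β t = t * corner β := by
  rw [bcurve, stolzBoundary, if_pos ht, ← one_sub_stolzTangent]
  push_cast; ring

lemma bcurve_of_mem_Ioc {β t : ℝ} (ht : t ∈ Ioc (1 : ℝ) 2) : bcurve β t = arc β t := by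
  rw [bcurve, stolzBoundary, if_neg (not_le.2 ht.1), if_pos ht.2, arc]

lemma bcurve_of_two_lt {β t : ℝ} (ht : 2 < t) : bcurve β t = ((3 - t : ℝ) : ℂ) * corner' β := by
  rw [bcurve, stolzBoundary, if_neg (by linarith), if_neg (by linarith), ← conj_corner,
    ← one_sub_stolzTangent, map_sub, map_one]
  push_cast; ring

lemma arc_one (β : ℝ) : arc β 1 = corner β := by
  rw [← one_sub_stolzTangent, arc, stolzTangent]; simp

lemma arc_two (β : ℝ) : arc β 2 = corner' β := by
  rw [← conj_corner, ← one_sub_stolzTangent, arc, stolzTangent]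
  have : ((Real.pi / 2 - β + (2 - 1) * (Real.pi + 2 * β) : ℝ) : ℂ) * Complex.I =
      -(((Real.pi / 2 - β : ℝ) : ℂ) * Complex.I) + 2 * Real.pi * Complex.I := by
    push_cast; ring
  rw [this, Complex.exp_add, Complex.exp_two_pi_mul_I, mul_one]
  simp [-Complex.ofReal_sin, -Complex.ofReal_cos, ← Complex.exp_conj, Complex.conj_ofNat]

lemma hasDerivAt_arc (β t : ℝ) : HasDerivAt (arc β) (arc' β t) t := by
  have h1 : HasDerivAt (fun t : ℝ => Real.pi / 2 - β + (t - 1) * (Real.pi + 2 * β))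
      (Real.pi + 2 * β) t := by
    simpa using (((hasDerivAt_id t).sub_const 1).mul_const (Real.pi + 2 * β)).const_add
      (Real.pi / 2 - β)
  exact (((h1.ofReal_comp.mul_const Complex.I).cexp).const_mul (Real.sin β : ℂ)).const_sub 1

lemma continuous_arc' (β : ℝ) : Continuous (arc' β) := by
  unfold arc'
  fun_prop

lemma norm_corner {β : ℝ} (hβ : 0 ≤ Real.cos β) : ‖corner β‖ = Real.cos β := by
  rw [corner, norm_mul, Complex.norm_real, Real.norm_of_nonneg hβ, ← neg_mul,
    ← Complex.ofReal_neg, Complex.norm_exp_ofReal_mul_I, mul_one]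

lemma norm_corner' {β : ℝ} (hβ : 0 ≤ Real.cos β) : ‖corner' β‖ = Real.cos β := by
  rw [← conj_corner, Complex.norm_conj, norm_corner hβ]

lemma corner_re (β : ℝ) : (corner β).re = Real.cos β * Real.cos β := by
  simp [-Complex.ofReal_sin, -Complex.ofReal_cos, corner, Complex.exp_re]

lemma corner'_re (β : ℝ) : (corner' β).re = Real.cos β * Real.cos β := by
  rw [← conj_corner, Complex.conj_re, corner_re]

lemma arc_norm_sub_one {β : ℝ} (hβ : 0 ≤ Real.sin β) (t : ℝ) : ‖arc β t - 1‖ = Real.sin β := by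
  rw [arc, sub_sub_cancel_left, norm_neg, norm_mul, Complex.norm_exp_ofReal_mul_I, mul_one,
    Complex.norm_real, Real.norm_of_nonneg hβ]

lemma norm_arc' {β : ℝ} (h0 : 0 ≤ β) (hβ : 0 ≤ Real.sin β) (t : ℝ) :
    ‖arc' β t‖ = Real.sin β * (Real.pi + 2 * β) := by
  rw [arc', norm_neg, norm_mul, norm_mul, norm_mul, Complex.norm_exp_ofReal_mul_I, one_mul,
    Complex.norm_I, mul_one, Complex.norm_real, Complex.norm_real, Real.norm_of_nonneg hβ,
    Real.norm_of_nonneg (by have := Real.pi_pos; positivity)]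

/-- The real part along the arc is smallest at its endpoints, the two tangent points. This keeps the
arc away from `0`. -/
lemma cos_sq_le_arc_re {β t : ℝ} (h0 : 0 < β) (h1 : β < Real.pi / 2) (ht : t ∈ Icc (1 : ℝ) 2) :
    Real.cos β ^ 2 ≤ (arc β t).re := by
  have hs : 0 < Real.sin β := Real.sin_pos_of_pos_of_lt_pi h0 (by linarith)
  set τ := Real.pi / 2 - β + (t - 1) * (Real.pi + 2 * β) with hτ
  have hre : (arc β t).re = 1 - Real.sin β * Real.cos τ := by
    rw [arc, ← hτ, Complex.sub_re, Complex.re_ofReal_mul, Complex.exp_ofReal_mul_I_re,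
      Complex.one_re]
  have hcos : Real.cos τ ≤ Real.sin β := by
    have h3 : τ - Real.pi ∈ Icc (-(Real.pi / 2 + β)) (Real.pi / 2 + β) := by
      have h4 : 0 ≤ (t - 1) * (Real.pi + 2 * β) :=
        mul_nonneg (by linarith [ht.1]) (by linarith)
      have h5 : (t - 1) * (Real.pi + 2 * β) ≤ 1 * (Real.pi + 2 * β) := by
        apply mul_le_mul_of_nonneg_right <;> linarith [ht.2]
      constructor <;> linarith
    have h6 : Real.cos (Real.pi / 2 + β) ≤ Real.cos |τ - Real.pi| :=
      Real.cos_le_cos_of_nonneg_of_le_pi (abs_nonneg _) (by linarith) (abs_le.2 h3)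
    rw [Real.cos_abs, Real.cos_sub_pi, add_comm, Real.cos_add_pi_div_two] at h6
    linarith
  rw [hre]
  nlinarith [Real.sin_sq_add_cos_sq β, mul_le_mul_of_nonneg_left hcos hs.le]

lemma cos_sq_le_norm_arc {β t : ℝ} (h0 : 0 < β) (h1 : β < Real.pi / 2)
    (ht : t ∈ Icc (1 : ℝ) 2) : Real.cos β ^ 2 ≤ ‖arc β t‖ :=
  (cos_sq_le_arc_re h0 h1 ht).trans (Complex.re_le_norm _)

lemma arc_mem_dstolz {β γ : ℝ} (h0 : 0 < β) (hβγ : β < γ) (h1 : γ < Real.pi / 2) (t : ℝ) :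
    arc β t ∈ dstolz γ := by
  have hss : Real.sin β < Real.sin γ :=
    Real.sin_lt_sin_of_lt_of_le_pi_div_two (by linarith) h1.le hβγ
  have hs : 0 < Real.sin β := Real.sin_pos_of_pos_of_lt_pi h0 (by linarith)
  refine ⟨1, ⟨one_pos, le_rfl⟩, ?_⟩
  rw [Complex.ofReal_one, arc_norm_sub_one hs.le, one_mul]
  exact hss

/-- For a point `a` of the arc, `|a - 1| = sin β` and `Re a ≥ cos² β` give `|a - r|² - (r sin β)² ≥
cos² β (1 - r)²`, so `a` is outside every disc of radius `r sin α` about `r`. -/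
lemma arc_notMem_cdstolz {α β t : ℝ} (hα : 0 < α) (hαβ : α < β) (hβ : β < Real.pi / 2)
    (ht : t ∈ Icc (1 : ℝ) 2) : arc β t ∉ cdstolz α := by
  rintro ⟨r, hr, h⟩
  have hs : 0 < Real.sin α := Real.sin_pos_of_pos_of_lt_pi hα (by linarith)
  have hss : Real.sin α < Real.sin β :=
    Real.sin_lt_sin_of_lt_of_le_pi_div_two (by linarith) hβ.le hαβ
  have hre := cos_sq_le_arc_re (hα.trans hαβ) hβ ht
  have h1 := normSq_sub_real (arc β t) 1
  rw [Complex.ofReal_one, arc_norm_sub_one (hs.trans hss).le] at h1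
  have h2 : ‖arc β t - r‖ ^ 2 ≤ (r * Real.sin α) ^ 2 := pow_le_pow_left₀ (norm_nonneg _) h 2
  rw [normSq_sub_real] at h2
  have h4 := Real.sin_sq_add_cos_sq β
  have hN : 0 < ‖arc β t‖ := lt_of_lt_of_le
    (by have := Real.cos_pos_of_mem_Ioo (x := β) ⟨by linarith, hβ⟩; positivity)
    (cos_sq_le_norm_arc (hα.trans hαβ) hβ ht)
  rcases hr.1.eq_or_lt with rfl | hr0
  · nlinarith
  have h3 : (r * Real.sin α) ^ 2 < (r * Real.sin β) ^ 2 :=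
    pow_lt_pow_left₀ (mul_lt_mul_of_pos_left hss hr0) (by positivity) two_ne_zero
  have h5 : (r * Real.sin β) ^ 2 = r ^ 2 - r ^ 2 * Real.cos β ^ 2 := by
    linear_combination r ^ 2 * h4
  linarith [mul_nonneg (sub_nonneg.2 hr.2) (sub_nonneg.2 hre),
    mul_nonneg (sq_nonneg (Real.cos β)) (sq_nonneg (1 - r))]

/-! ### Contours along which the decay weight is integrable -/

/-- A measurable curve in `D`, defined on `S`, along which `wt ε |z| / |z|` is integrable. -/
structure IsDecayContour (D : Set ℂ) (S : Set ℝ) (c : ℝ → ℂ) : Prop where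
  measurableSet : MeasurableSet S
  measurable : Measurable c
  mem : ∀ᵐ t ∂volume.restrict S, c t ∈ D
  integrable : ∀ ε : ℝ, 0 < ε →
    IntegrableOn (fun t => ‖deriv c t‖ * (wt ε ‖c t‖ / ‖c t‖)) S

lemma IsDecayContour.mono {D D' : Set ℂ} {S : Set ℝ} {c : ℝ → ℂ} (h : IsDecayContour D S c)
    (hD : D ⊆ D') : IsDecayContour D' S c :=
  ⟨h.1, h.2, h.3.mono fun _ ht => hD ht, h.4⟩

/-- Resolvents and `f` are controlled only on open sets, which the curves may leave on a null set
(the vertex). Extending by zero off `D` gives a globally strongly measurable function to compose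
with. -/
lemma aestronglyMeasurable_comp_of_continuousOn {α Z E : Type*} [MeasurableSpace α]
    [TopologicalSpace Z] [SecondCountableTopology Z] [MeasurableSpace Z] [BorelSpace Z]
    [NormedAddCommGroup E] {μ : Measure α} {D : Set Z} (hD : IsOpen D) {g : Z → E}
    (hg : ContinuousOn g D) {c : α → Z} (hc : Measurable c) (hmem : ∀ᵐ t ∂μ, c t ∈ D) :
    AEStronglyMeasurable (fun t => g (c t)) μ := by
  have h1 : StronglyMeasurable (Function.extend (Subtype.val : D → Z) (D.domRestrict g) 0) :=
    (MeasurableEmbedding.subtype_coe hD.measurableSet).stronglyMeasurable_extend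
      (continuousOn_iff_continuous_domRestrict.1 hg).stronglyMeasurable stronglyMeasurable_const
  refine (h1.comp_measurable hc).aestronglyMeasurable.congr ?_
  filter_upwards [hmem] with t ht
  exact Subtype.val_injective.extend_apply (D.domRestrict g) 0 ⟨c t, ht⟩

lemma IsDecayContour.integrable_smul {E : Type*} [NormedAddCommGroup E] [NormedSpace ℂ E]
    {D : Set ℂ} {S : Set ℝ} {c : ℝ → ℂ} (h : IsDecayContour D S c) (hD : IsOpen D) {g : ℂ → E}
    (hg : ContinuousOn g D) {K ε : ℝ} (hε : 0 < ε)
    (hb : ∀ z ∈ D, ‖g z‖ ≤ K * (wt ε ‖z‖ / ‖z‖)) :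
    IntegrableOn (fun t => deriv c t • g (c t)) S := by
  refine Integrable.mono' ((h.integrable ε hε).const_mul K) ?_ ?_
  · exact (measurable_deriv c).aestronglyMeasurable.smul
      (aestronglyMeasurable_comp_of_continuousOn hD hg h.measurable h.mem)
  · filter_upwards [h.mem] with t ht
    rw [norm_smul, mul_left_comm]
    exact mul_le_mul_of_nonneg_left (hb _ ht) (norm_nonneg _)

/-! #### The sector boundary -/

lemma sectorBoundary_of_nonpos {ν t : ℝ} (ht : t ≤ 0) :
    sectorBoundary ν t = ((-t : ℝ) : ℂ) * Complex.exp ((ν : ℂ) * Complex.I) := if_pos ht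

lemma sectorBoundary_of_pos {ν t : ℝ} (ht : 0 < t) :
    sectorBoundary ν t = (t : ℂ) * Complex.exp (-((ν : ℂ) * Complex.I)) := if_neg (not_le.2 ht)

lemma norm_exp_neg_mul_I (ν : ℝ) : ‖Complex.exp (-((ν : ℂ) * Complex.I))‖ = 1 := by
  rw [← neg_mul, ← Complex.ofReal_neg, Complex.norm_exp_ofReal_mul_I]

lemma norm_sectorBoundary (ν t : ℝ) : ‖sectorBoundary ν t‖ = |t| := by
  rcases le_or_gt t 0 with h | h
  · rw [sectorBoundary_of_nonpos h, norm_mul, Complex.norm_exp_ofReal_mul_I, mul_one,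
      Complex.norm_real, norm_neg, Real.norm_eq_abs]
  · rw [sectorBoundary_of_pos h, norm_mul, norm_exp_neg_mul_I, mul_one, Complex.norm_real,
      Real.norm_eq_abs]

lemma exp_neg_mul_I_re (ν : ℝ) : (Complex.exp (-((ν : ℂ) * Complex.I))).re = Real.cos ν := by
  rw [← neg_mul, ← Complex.ofReal_neg, Complex.exp_ofReal_mul_I_re, Real.cos_neg]

lemma sectorBoundary_re (ν t : ℝ) :
    (sectorBoundary ν t).re = ‖sectorBoundary ν t‖ * Real.cos ν := by
  rw [norm_sectorBoundary]
  rcases le_or_gt t 0 with h | h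
  · rw [sectorBoundary_of_nonpos h, Complex.re_ofReal_mul, Complex.exp_ofReal_mul_I_re,
      abs_of_nonpos h]
  · rw [sectorBoundary_of_pos h, Complex.re_ofReal_mul, exp_neg_mul_I_re, abs_of_pos h]

lemma deriv_sectorBoundary_of_neg {ν t : ℝ} (ht : t < 0) :
    deriv (sectorBoundary ν) t = -Complex.exp ((ν : ℂ) * Complex.I) := by
  have h1 : HasDerivAt (fun t : ℝ => ((-t : ℝ) : ℂ) * Complex.exp ((ν : ℂ) * Complex.I))
      (-Complex.exp ((ν : ℂ) * Complex.I)) t := by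
    simpa using ((hasDerivAt_id t).neg.ofReal_comp).mul_const (Complex.exp ((ν : ℂ) * Complex.I))
  refine (h1.congr_of_eventuallyEq ?_).deriv
  filter_upwards [Iio_mem_nhds ht] with u hu using sectorBoundary_of_nonpos (le_of_lt hu)

lemma deriv_sectorBoundary_of_pos {ν t : ℝ} (ht : 0 < t) :
    deriv (sectorBoundary ν) t = Complex.exp (-((ν : ℂ) * Complex.I)) := by
  have h1 : HasDerivAt (fun t : ℝ => (t : ℂ) * Complex.exp (-((ν : ℂ) * Complex.I)))
      (Complex.exp (-((ν : ℂ) * Complex.I))) t := by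
    simpa using ((hasDerivAt_id t).ofReal_comp).mul_const (Complex.exp (-((ν : ℂ) * Complex.I)))
  refine (h1.congr_of_eventuallyEq ?_).deriv
  filter_upwards [Ioi_mem_nhds ht] with u hu using sectorBoundary_of_pos hu

lemma measurable_sectorBoundary (ν : ℝ) : Measurable (sectorBoundary ν) := by
  unfold sectorBoundary
  refine Measurable.ite measurableSet_Iic ?_ ?_ <;> fun_prop

lemma integrable_comp_abs {f : ℝ → ℝ} (hf : IntegrableOn f (Ioi 0)) :
    Integrable fun t => f |t| := by
  have h1 : IntegrableOn (fun t => f |t|) (Ioi 0) :=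
    hf.congr_fun (fun t ht => by rw [abs_of_pos ht]) measurableSet_Ioi
  have h2 : IntegrableOn (fun t => f |t|) (Iic 0) := by
    rw [← Measure.map_neg_eq_self (volume : Measure ℝ)]
    let m : MeasurableEmbedding fun x : ℝ => -x := (Homeomorph.neg ℝ).measurableEmbedding
    rw [m.integrableOn_map_iff]
    simp_rw [Function.comp_def, abs_neg, neg_preimage, neg_Iic, neg_zero]
    exact Iff.mpr integrableOn_Ici_iff_integrableOn_Ioi h1
  rw [← integrableOn_univ, ← Iic_union_Ioi (a := (0 : ℝ))]
  exact h2.union h1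

lemma isDecayContour_sectorBoundary {ν : ℝ} {D : Set ℂ}
    (hD : ∀ z : ℂ, z ≠ 0 → z.re = ‖z‖ * Real.cos ν → z ∈ D) :
    IsDecayContour D univ (sectorBoundary ν) := by
  have hne : ∀ᵐ t : ℝ, t ≠ 0 := by simp [ae_iff]
  refine ⟨.univ, measurable_sectorBoundary ν, ?_, fun ε hε => ?_⟩
  · rw [Measure.restrict_univ]
    filter_upwards [hne] with t ht
    refine hD _ ?_ (sectorBoundary_re ν t)
    rw [← norm_pos_iff, norm_sectorBoundary]
    exact abs_pos.2 ht
  · have h : Integrable (fun t : ℝ => wt ε |t| / |t|) :=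
      integrable_comp_abs (f := fun t => wt ε t / t) (integrableOn_wt_div hε)
    rw [integrableOn_univ]
    refine h.congr ?_
    filter_upwards [hne] with t ht
    rcases lt_or_gt_of_ne ht with h | h
    · rw [deriv_sectorBoundary_of_neg h, norm_neg, Complex.norm_exp_ofReal_mul_I, one_mul,
        norm_sectorBoundary]
    · rw [deriv_sectorBoundary_of_pos h, norm_exp_neg_mul_I, one_mul, norm_sectorBoundary]

lemma integral_sectorBoundary {E : Type*} [NormedAddCommGroup E] [NormedSpace ℂ E] {ν : ℝ}
    {g : ℂ → E} (hg : Integrable fun t => deriv (sectorBoundary ν) t • g (sectorBoundary ν t)) :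
    ∫ t, deriv (sectorBoundary ν) t • g (sectorBoundary ν t) =
      (∫ s in Ioi (0 : ℝ), Complex.exp (-((ν : ℂ) * Complex.I)) •
        g (s * Complex.exp (-((ν : ℂ) * Complex.I)))) -
      ∫ s in Ioi (0 : ℝ), Complex.exp ((ν : ℂ) * Complex.I) •
        g (s * Complex.exp ((ν : ℂ) * Complex.I)) := by
  rw [← integral_add_compl measurableSet_Ioi hg, compl_Ioi, sub_eq_add_neg (G := E),
    ← integral_neg]
  congr 1
  · refine setIntegral_congr_fun measurableSet_Ioi fun t ht => ?_
    rw [deriv_sectorBoundary_of_pos ht, sectorBoundary_of_pos ht]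
  · rw [← neg_zero, ← integral_comp_neg_Iic, neg_zero, integral_Iic_eq_integral_Iio,
      integral_Iic_eq_integral_Iio]
    refine setIntegral_congr_fun measurableSet_Iio fun t ht => ?_
    rw [deriv_sectorBoundary_of_neg ht, sectorBoundary_of_nonpos (le_of_lt ht), neg_smul]

/-! #### The boundary of the reflected Stolz domain -/

lemma deriv_bcurve_of_lt_one {β t : ℝ} (ht : t < 1) : deriv (bcurve β) t = corner β := by
  have h1 : HasDerivAt (fun t : ℝ => (t : ℂ) * corner β) (corner β) t := by
    simpa using ((hasDerivAt_id t).ofReal_comp).mul_const (corner β)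
  refine (h1.congr_of_eventuallyEq ?_).deriv
  filter_upwards [Iio_mem_nhds ht] with u hu using bcurve_of_le_one (le_of_lt hu)

lemma deriv_bcurve_of_mem_Ioo {β t : ℝ} (ht : t ∈ Ioo (1 : ℝ) 2) :
    deriv (bcurve β) t = arc' β t := by
  refine ((hasDerivAt_arc β t).congr_of_eventuallyEq ?_).deriv
  filter_upwards [Ioo_mem_nhds ht.1 ht.2] with u hu using bcurve_of_mem_Ioc (Ioo_subset_Ioc_self hu)

lemma deriv_bcurve_of_two_lt {β t : ℝ} (ht : 2 < t) : deriv (bcurve β) t = -corner' β := by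
  have h1 : HasDerivAt (fun t : ℝ => ((3 - t : ℝ) : ℂ) * corner' β) (-corner' β) t := by
    simpa using (((hasDerivAt_id t).const_sub 3).ofReal_comp).mul_const (corner' β)
  refine (h1.congr_of_eventuallyEq ?_).deriv
  filter_upwards [Ioi_mem_nhds ht] with u hu using bcurve_of_two_lt hu

lemma measurable_bcurve (β : ℝ) : Measurable (bcurve β) := by
  unfold bcurve stolzBoundary
  refine measurable_const.sub (Measurable.ite measurableSet_Iic ?_
    (Measurable.ite measurableSet_Iic ?_ ?_)) <;> fun_prop

/-- The part of the parameter interval over which `bcurve` is straight. -/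
def raySet : Set ℝ := Ioc 0 1 ∪ Ioc 2 3

lemma measurableSet_raySet : MeasurableSet raySet := measurableSet_Ioc.union measurableSet_Ioc

lemma raySet_subset : raySet ⊆ Icc 0 3 := by
  rintro t (h | h) <;> constructor <;> linarith [h.1, h.2]

lemma Ioc_zero_three : Ioc (0 : ℝ) 3 = raySet ∪ Ioc 1 2 := by
  rw [raySet, union_right_comm, Ioc_union_Ioc_eq_Ioc (by norm_num) (by norm_num),
    Ioc_union_Ioc_eq_Ioc (by norm_num) (by norm_num)]

lemma disjoint_raySet : Disjoint raySet (Ioc 1 2) := by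
  rw [disjoint_left]
  rintro t (h | h) h' <;> linarith [h.1, h.2, h'.1, h'.2]

lemma ray_re {β : ℝ} (hβ : 0 ≤ Real.cos β) {s : ℝ} (hs : 0 ≤ s) :
    (s * corner β : ℂ).re = ‖(s * corner β : ℂ)‖ * Real.cos β ∧
    (s * corner' β : ℂ).re = ‖(s * corner' β : ℂ)‖ * Real.cos β := by
  rw [Complex.re_ofReal_mul, Complex.re_ofReal_mul, norm_mul, norm_mul, norm_corner hβ,
    norm_corner' hβ, corner_re, corner'_re, Complex.norm_real, Real.norm_of_nonneg hs, mul_assoc]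
  exact ⟨rfl, rfl⟩

/-- On `raySet` the boundary curve runs on the rays of angle `±β`. -/
lemma bcurve_on_raySet {β : ℝ} (h0 : 0 < β) (h1 : β < Real.pi / 2) {t : ℝ} (ht : t ∈ raySet)
    (h3 : t ≠ 3) : bcurve β t ≠ 0 ∧ (bcurve β t).re = ‖bcurve β t‖ * Real.cos β ∧
      ‖bcurve β t‖ ≤ Real.cos β := by
  have hc : 0 < Real.cos β := Real.cos_pos_of_mem_Ioo ⟨by linarith, h1⟩
  rcases ht with h | h
  · rw [bcurve_of_le_one h.2]
    refine ⟨?_, (ray_re hc.le h.1.le).1, ?_⟩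
    · rw [← norm_pos_iff, norm_mul, norm_corner hc.le, Complex.norm_real,
        Real.norm_of_nonneg h.1.le]
      exact mul_pos h.1 hc
    · rw [norm_mul, norm_corner hc.le, Complex.norm_real, Real.norm_of_nonneg h.1.le]
      exact mul_le_of_le_one_left hc.le h.2
  · have h' : 0 < 3 - t := by linarith [lt_of_le_of_ne h.2 h3]
    rw [bcurve_of_two_lt h.1]
    refine ⟨?_, (ray_re hc.le h'.le).2, ?_⟩
    · rw [← norm_pos_iff, norm_mul, norm_corner' hc.le, Complex.norm_real,
        Real.norm_of_nonneg h'.le]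
      exact mul_pos h' hc
    · rw [norm_mul, norm_corner' hc.le, Complex.norm_real, Real.norm_of_nonneg h'.le]
      exact mul_le_of_le_one_left hc.le (by linarith [h.1])

lemma bcurve_mem {α β γ : ℝ} (hα : 0 < α) (hαβ : α < β) (hβγ : β < γ) (hγ : γ < Real.pi / 2)
    {t : ℝ} (ht : t ∈ Ioc (0 : ℝ) 3) (h3 : t ≠ 3) : bcurve β t ∈ dstolz γ \ cdstolz α := by
  rw [Ioc_zero_three] at ht
  rcases ht with ht | ht
  · obtain ⟨hz, hre, hle⟩ := bcurve_on_raySet (hα.trans hαβ) (hβγ.trans hγ) ht h3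
    exact ⟨ray_mem_dstolz (hα.trans hαβ) hβγ hγ hz hre hle,
      ray_notMem_cdstolz hα hαβ (hβγ.trans hγ) hz hre⟩
  · rw [bcurve_of_mem_Ioc ht]
    exact ⟨arc_mem_dstolz (hα.trans hαβ) hβγ hγ t,
      arc_notMem_cdstolz hα hαβ (hβγ.trans hγ) (Ioc_subset_Icc_self ht)⟩

/-- A function of `‖bcurve β ·‖` on `raySet` is integrable as soon as it is so on `(0, 1]`. -/
lemma integrableOn_raySet {E : Type*} [NormedAddCommGroup E] {F G H : ℝ → E}
    (hG : IntegrableOn G (Ioc 0 1)) (hH : IntegrableOn H (Ioc 0 1))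
    (hFG : ∀ t ∈ Ioo (0 : ℝ) 1, F t = G t) (hFH : ∀ t ∈ Ioo (2 : ℝ) 3, F t = H (3 - t)) :
    IntegrableOn F raySet := by
  refine IntegrableOn.union ?_ ?_
  · rw [integrableOn_Ioc_iff_integrableOn_Ioo] at hG ⊢
    exact hG.congr_fun (fun t ht => (hFG t ht).symm) measurableSet_Ioo
  · have h := ((intervalIntegrable_iff_integrableOn_Ioc_of_le zero_le_one).2 hH).comp_sub_left 3
    have h2 : IntegrableOn (fun t => H (3 - t)) (Ioc 2 3) := by
      rw [show (3 : ℝ) - 0 = 3 by norm_num, show (3 : ℝ) - 1 = 2 by norm_num] at h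
      exact (intervalIntegrable_iff_integrableOn_Ioc_of_le (by norm_num)).1 h.symm
    rw [integrableOn_Ioc_iff_integrableOn_Ioo] at h2 ⊢
    exact h2.congr_fun (fun t ht => (hFH t ht).symm) measurableSet_Ioo

lemma integral_raySet {E : Type*} [NormedAddCommGroup E] [NormedSpace ℝ E] {F G H : ℝ → E}
    (hG : IntegrableOn G (Ioc 0 1)) (hH : IntegrableOn H (Ioc 0 1))
    (hFG : ∀ t ∈ Ioo (0 : ℝ) 1, F t = G t) (hFH : ∀ t ∈ Ioo (2 : ℝ) 3, F t = H (3 - t)) :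
    ∫ t in raySet, F t = (∫ t in Ioc 0 1, G t) + ∫ t in Ioc 0 1, H t := by
  have hF := integrableOn_raySet hG hH hFG hFH
  have hd : Disjoint (Ioc (0 : ℝ) 1) (Ioc 2 3) := by
    rw [disjoint_left]
    rintro t h h'
    linarith [h.2, h'.1]
  rw [raySet] at hF ⊢
  rw [setIntegral_union hd measurableSet_Ioc hF.left_of_union hF.right_of_union]
  congr 1
  · rw [integral_Ioc_eq_integral_Ioo, integral_Ioc_eq_integral_Ioo]
    exact setIntegral_congr_fun measurableSet_Ioo hFG
  · have h2 : ∫ t in Ioc 0 1, H t = ∫ t in Ioc 2 3, H (3 - t) := by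
      rw [← intervalIntegral.integral_of_le zero_le_one,
        ← intervalIntegral.integral_of_le (by norm_num), intervalIntegral.integral_comp_sub_left]
      norm_num
    rw [h2, integral_Ioc_eq_integral_Ioo, integral_Ioc_eq_integral_Ioo]
    exact setIntegral_congr_fun measurableSet_Ioo hFH

lemma ae_ne_restrict (S : Set ℝ) (x : ℝ) : ∀ᵐ t ∂volume.restrict S, t ≠ x := by
  refine ae_restrict_of_ae ?_
  simp [ae_iff]

lemma isDecayContour_bcurve {α β γ : ℝ} (hα : 0 < α) (hαβ : α < β) (hβγ : β < γ)
    (hγ : γ < Real.pi / 2) : IsDecayContour (dstolz γ \ cdstolz α) (Icc 0 3) (bcurve β) := by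
  have h0 : 0 < β := hα.trans hαβ
  have h1 : β < Real.pi / 2 := hβγ.trans hγ
  have hc : 0 < Real.cos β := Real.cos_pos_of_mem_Ioo ⟨by linarith, h1⟩
  have hs : 0 < Real.sin β := Real.sin_pos_of_pos_of_lt_pi h0 (by linarith)
  refine ⟨measurableSet_Icc, measurable_bcurve β, ?_, fun ε hε => ?_⟩
  · rw [← Measure.restrict_congr_set Ioc_ae_eq_Icc]
    filter_upwards [ae_restrict_mem measurableSet_Ioc, ae_ne_restrict _ 3] with t ht ht3
    exact bcurve_mem hα hαβ hβγ hγ ht ht3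
  · rw [integrableOn_Icc_iff_integrableOn_Ioc, Ioc_zero_three]
    refine IntegrableOn.union ?_ ?_
    · have hG : IntegrableOn (fun t : ℝ => wt ε (t * Real.cos β) / t) (Ioc 0 1) := by
        refine Integrable.mono' (((integrableOn_wt_div hε).mono_set
          (fun t ht => ht.1 : Ioc (0 : ℝ) 1 ⊆ Ioi 0)).const_mul
            (Real.cos β ^ ε + Real.cos β ^ (-ε))) ?_ ?_
        · exact ((measurable_wt ε).comp (measurable_id.mul_const _)).div measurable_id
            |>.aestronglyMeasurable
        · filter_upwards [ae_restrict_mem measurableSet_Ioc] with t ht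
          rw [Real.norm_of_nonneg (div_nonneg (wt_nonneg (mul_pos ht.1 hc).le _) ht.1.le),
            mul_div_assoc']
          exact div_le_div_of_nonneg_right (wt_mul_le ht.1.le hc ε) ht.1.le
      refine integrableOn_raySet hG hG (fun t ht => ?_) (fun t ht => ?_)
      · rw [deriv_bcurve_of_lt_one ht.2, bcurve_of_le_one ht.2.le, norm_mul, norm_corner hc.le,
          Complex.norm_real, Real.norm_of_nonneg ht.1.le]
        have := ht.1
        field_simp
      · have h3 : 0 < 3 - t := by linarith [ht.2]
        rw [deriv_bcurve_of_two_lt ht.1, bcurve_of_two_lt ht.1, norm_mul, norm_neg,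
          norm_corner' hc.le, Complex.norm_real, Real.norm_of_nonneg h3.le]
        field_simp
    · have hm : Measurable fun t => ‖deriv (bcurve β) t‖ * (wt ε ‖bcurve β t‖ / ‖bcurve β t‖) :=
        (measurable_deriv _).norm.mul (((measurable_wt ε).comp (measurable_bcurve β).norm).div
          (measurable_bcurve β).norm)
      -- The speed on the arc is constant, the weight is at most `1`, and `‖z‖ ≥ cos² β` there.
      refine Measure.integrableOn_of_bounded (M := Real.sin β * (Real.pi + 2 * β) *
        (1 / Real.cos β ^ 2)) (by simp) hm.aestronglyMeasurable ?_
      filter_upwards [ae_restrict_mem measurableSet_Ioc, ae_ne_restrict _ 2] with t ht ht2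
      have hlt : t ∈ Ioo (1 : ℝ) 2 := ⟨ht.1, lt_of_le_of_ne ht.2 ht2⟩
      have hN := cos_sq_le_norm_arc h0 h1 (Ioc_subset_Icc_self ht)
      have hw := wt_nonneg (norm_nonneg (arc β t)) ε
      rw [deriv_bcurve_of_mem_Ioo hlt, bcurve_of_mem_Ioc ht, Real.norm_of_nonneg (by positivity),
        norm_arc' h0.le hs.le]
      have := Real.pi_pos
      gcongr
      exact wt_le_one (norm_nonneg _) ε

lemma integral_bcurve_arc {E : Type*} [NormedAddCommGroup E] [NormedSpace ℂ E] {β : ℝ}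
    (g : ℂ → E) : ∫ t in Ioc (1 : ℝ) 2, deriv (bcurve β) t • g (bcurve β t) =
      ∫ t in (1 : ℝ)..2, arc' β t • g (arc β t) := by
  rw [intervalIntegral.integral_of_le one_le_two, integral_Ioc_eq_integral_Ioo,
    integral_Ioc_eq_integral_Ioo]
  refine setIntegral_congr_fun measurableSet_Ioo fun t ht => ?_
  rw [deriv_bcurve_of_mem_Ioo ht, bcurve_of_mem_Ioc (Ioo_subset_Ioc_self ht)]

lemma integral_bcurve_split {E : Type*} [NormedAddCommGroup E] [NormedSpace ℝ E]
    {F : ℝ → E} (hF : IntegrableOn F (Icc 0 3)) :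
    ∫ t in Icc 0 3, F t = (∫ t in raySet, F t) + ∫ t in Ioc 1 2, F t := by
  rw [integrableOn_Icc_iff_integrableOn_Ioc, Ioc_zero_three] at hF
  rw [integral_Icc_eq_integral_Ioc, Ioc_zero_three,
    setIntegral_union disjoint_raySet measurableSet_Ioc hF.left_of_union hF.right_of_union]

/-! ### Cauchy's theorem for the boundary curves -/

/-- Along the dilates of the arc, `‖s a‖` is comparable with `s`. A decay bound in `‖z‖` thus
becomes the bound in `s`, uniform along the curve, that the dilation theorems require. -/
lemma wt_div_mul_le {m M r s ε : ℝ} (hm : 0 < m) (hmr : m ≤ r) (hrM : r ≤ M) (hs : 0 < s)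
    (hε : 0 < ε) :
    wt ε (s * r) / (s * r) ≤ (M ^ ε + m ^ (-ε)) / m * (wt ε s / s) := by
  have hr : 0 < r := hm.trans_le hmr
  have h1 := wt_mul_le hs.le hr ε
  have h2 : r ^ ε ≤ M ^ ε := Real.rpow_le_rpow hr.le hrM hε.le
  have h3 : r ^ (-ε) ≤ m ^ (-ε) := Real.rpow_le_rpow_of_nonpos hm hmr (by linarith)
  have hw := wt_nonneg hs.le ε
  have hM : 0 < M := hr.trans_le hrM
  calc wt ε (s * r) / (s * r) ≤ ((M ^ ε + m ^ (-ε)) * wt ε s) / (s * m) := by gcongr; exact h1.trans (by gcongr)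
    _ = _ := by field_simp

lemma exists_bound_dilation_arc {E : Type*} [NormedAddCommGroup E] {g : ℂ → E} {β K ε : ℝ}
    (hβ : 0 < β) (hβ' : β < Real.pi / 2) (hε : 0 < ε)
    {U : Set ℂ} (hK : 0 ≤ K) (hb : ∀ z ∈ U, ‖g z‖ ≤ K * (wt ε ‖z‖ / ‖z‖)) :
    ∃ K' : ℝ, ∀ s : ℝ, 0 < s → ∀ t ∈ Icc (1 : ℝ) 2, (s : ℂ) * arc β t ∈ U →
      ‖g (s * arc β t)‖ ≤ K' * (wt ε s / s) := by
  have hc : 0 < Real.cos β := Real.cos_pos_of_mem_Ioo ⟨by linarith, hβ'⟩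
  have hsin : 0 < Real.sin β := Real.sin_pos_of_pos_of_lt_pi hβ (by linarith)
  refine ⟨K * ((2 ^ ε + (Real.cos β ^ 2) ^ (-ε)) / Real.cos β ^ 2), fun s hs t ht hU => ?_⟩
  have h2 : ‖arc β t‖ ≤ 2 := by
    have := norm_add_le (arc β t - 1) 1
    rw [sub_add_cancel, arc_norm_sub_one hsin.le, norm_one] at this
    linarith [Real.sin_le_one β]
  refine (hb _ hU).trans ?_
  rw [mul_assoc, norm_mul, Complex.norm_real, Real.norm_of_nonneg hs.le]
  exact mul_le_mul_of_nonneg_left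
    (wt_div_mul_le (by positivity) (cos_sq_le_norm_arc hβ hβ' ht) h2 hs hε) hK

section

variable {E : Type*} [NormedAddCommGroup E] [NormedSpace ℂ E] {g : ℂ → E} {β γ K ε : ℝ}

lemma integral_raySet_bcurve (h1 : IntegrableOn (fun s : ℝ => corner β • g (s * corner β)) (Ioc 0 1))
    (h2 : IntegrableOn (fun s : ℝ => corner' β • g (s * corner' β)) (Ioc 0 1)) :
    ∫ t in raySet, deriv (bcurve β) t • g (bcurve β t) =
      (∫ s in Ioc (0 : ℝ) 1, corner β • g (s * corner β)) -
        ∫ s in Ioc (0 : ℝ) 1, corner' β • g (s * corner' β) := by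
  rw [sub_eq_add_neg, ← integral_neg]
  refine integral_raySet h1 h2.neg (fun t ht => ?_) (fun t ht => ?_)
  · rw [deriv_bcurve_of_lt_one ht.2, bcurve_of_le_one ht.2.le]
  · rw [deriv_bcurve_of_two_lt ht.1, bcurve_of_two_lt ht.1, neg_smul]

lemma smul_integral_Ioi_comp {r : ℝ} (hr : 0 < r) (q : ℂ) :
    ∫ s in Ioi (0 : ℝ), ((r : ℂ) * q) • g (s * (r * q)) = ∫ s in Ioi (0 : ℝ), q • g (s * q) := by
  have h := integral_comp_mul_left_Ioi (fun s : ℝ => q • g (s * q)) 0 hr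
  rw [mul_zero] at h
  have h2 : ∀ s : ℝ, ((r : ℂ) * q) • g (s * (r * q)) =
      r • (q • g (((r * s : ℝ) : ℂ) * q)) := by
    intro s
    rw [mul_smul, Complex.coe_smul]
    congr 3
    push_cast
    ring
  simp_rw [h2]
  rw [integral_smul, h, smul_smul, mul_inv_cancel₀ hr.ne', one_smul]

variable [CompleteSpace E]

/-- Cauchy's theorem for `1 - B_β`. -/
theorem integral_bcurve_eq_zero (hβ : 0 < β) (hβγ : β < γ) (hγ : γ < Real.pi / 2) (hε : 0 < ε)
    (hg : DifferentiableOn ℂ g (dstolz γ)) (hK : 0 ≤ K)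
    (hb : ∀ z ∈ dstolz γ, ‖g z‖ ≤ K * (wt ε ‖z‖ / ‖z‖)) :
    ∫ t in Icc 0 3, deriv (bcurve β) t • g (bcurve β t) = 0 := by
  obtain ⟨K', hK'⟩ := exists_bound_dilation_arc hβ (hβγ.trans hγ) hε hK hb
  have hmem : ∀ s ∈ Ioc (0 : ℝ) 1, ∀ t ∈ Icc (1 : ℝ) 2, (s : ℂ) * arc β t ∈ dstolz γ :=
    fun s hs t _ => smul_mem_dstolz (arc_mem_dstolz hβ hβγ hγ t) hs
  have hb' : ∀ s ∈ Ioc (0 : ℝ) 1, ∀ t ∈ Icc (1 : ℝ) 2,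
      ‖g (s * arc β t)‖ ≤ K' * (wt ε s / s) := fun s hs t ht => hK' s hs.1 t ht (hmem s hs t ht)
  -- Contracting the arc to the vertex expresses its integral through the segments to its endpoints,
  -- which are the straight parts of the boundary traversed the other way.
  have h := integral_eq_ray_zero_one hε (isOpen_dstolz γ) hg one_le_two
    (fun t _ => hasDerivAt_arc β t) (continuous_arc' β).continuousOn hmem hb'
  have hi1 : IntegrableOn (fun s : ℝ => arc β 1 • g (s * arc β 1)) (Ioc 0 1) :=
    integrableOn_ray measurableSet_Ioc (fun s hs => hs.1) hε hg
    (fun s hs => hmem s hs 1 (by simp)) (fun s hs => hb' s hs 1 (by simp))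
  have hi2 : IntegrableOn (fun s : ℝ => arc β 2 • g (s * arc β 2)) (Ioc 0 1) :=
    integrableOn_ray measurableSet_Ioc (fun s hs => hs.1) hε hg
    (fun s hs => hmem s hs 2 (by simp)) (fun s hs => hb' s hs 2 (by simp))
  rw [integral_sub hi2 hi1] at h
  rw [arc_one] at h hi1
  rw [arc_two] at h hi2
  have hα : 0 < β / 2 := by positivity
  rw [integral_bcurve_split ((isDecayContour_bcurve hα (by linarith) hβγ hγ).mono
      sdiff_subset |>.integrable_smul (isOpen_dstolz γ) hg.continuousOn hε hb),
    integral_bcurve_arc, h, integral_raySet_bcurve hi1 hi2]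
  abel

/-- The boundary of the sector can be replaced by the boundary of `1 - B_β`. -/
theorem integral_sectorBoundary_eq_integral_bcurve {α θ : ℝ} (hα : 0 < α) (hαβ : α < β)
    (hβθ : β < θ) (hθ : θ < Real.pi / 2) (hε : 0 < ε)
    (hg : DifferentiableOn ℂ g (sector θ \ cdstolz α)) (hK : 0 ≤ K)
    (hb : ∀ z ∈ sector θ \ cdstolz α, ‖g z‖ ≤ K * (wt ε ‖z‖ / ‖z‖)) :
    ∫ t, deriv (sectorBoundary β) t • g (sectorBoundary β t) =
      ∫ t in Icc 0 3, deriv (bcurve β) t • g (bcurve β t) := by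
  have hβ : 0 < β := hα.trans hαβ
  have hβ2 : β < Real.pi / 2 := hβθ.trans hθ
  have hc : 0 < Real.cos β := Real.cos_pos_of_mem_Ioo ⟨by linarith, hβ2⟩
  have hθ0 : 0 < θ := hβ.trans hβθ
  have hUo : IsOpen (sector θ \ cdstolz α) := by
    refine (isOpen_sector hθ0.le (by linarith)).sdiff (isClosed_cdstolz ?_)
    exact (Real.sin_pos_of_pos_of_lt_pi hα (by linarith)).le
  obtain ⟨K', hK'⟩ := exists_bound_dilation_arc hβ hβ2 hε hK hb
  have hsub : dstolz θ ⊆ sector θ := dstolz_subset_sector hθ0 hθ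
  have hmem : ∀ s : ℝ, 1 ≤ s → ∀ t ∈ Icc (1 : ℝ) 2, (s : ℂ) * arc β t ∈ sector θ \ cdstolz α :=
    fun s hs t ht => ⟨smul_mem_sector (hsub (arc_mem_dstolz hβ hβθ hθ t)) (by linarith),
      smul_notMem_cdstolz (arc_notMem_cdstolz hα hαβ hβ2 ht) hs⟩
  have hb' : ∀ s : ℝ, 1 ≤ s → ∀ t ∈ Icc (1 : ℝ) 2,
      ‖g (s * arc β t)‖ ≤ K' * (wt ε s / s) :=
    fun s hs t ht => hK' s (by linarith) t ht (hmem s hs t ht)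
  -- The two contours differ by the arc and by the half-lines beyond the corners. Expanding the arc
  -- to infinity identifies their integrals; its dilates by `s ≥ 1` never meet `cdstolz α`.
  have h := integral_eq_neg_ray_one_top hε hUo hg one_le_two
    (fun t _ => hasDerivAt_arc β t) (continuous_arc' β).continuousOn hmem hb'
  have hray : ∀ z : ℂ, z ≠ 0 → z.re = ‖z‖ * Real.cos β → z ∈ sector θ \ cdstolz α := by
    intro z hz hre
    refine ⟨(mem_sector_iff hθ0.le (by linarith)).2 ?_, ray_notMem_cdstolz hα hαβ hβ2 hz hre⟩
    rw [hre]
    exact mul_lt_mul_of_pos_left (Real.cos_lt_cos_of_nonneg_of_le_pi hβ.le (by linarith) hβθ)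
      (norm_pos_iff.2 hz)
  have hcn : ∀ s : ℝ, 0 < s → (s * corner β : ℂ) ≠ 0 ∧ (s * corner' β : ℂ) ≠ 0 := by
    intro s hs
    rw [← norm_pos_iff, ← norm_pos_iff, norm_mul, norm_mul, norm_corner hc.le,
      norm_corner' hc.le, Complex.norm_real, Real.norm_of_nonneg hs.le]
    exact ⟨by positivity, by positivity⟩
  have hmem0 : ∀ s ∈ Ioi (0 : ℝ), (s * corner β : ℂ) ∈ sector θ \ cdstolz α ∧
      (s * corner' β : ℂ) ∈ sector θ \ cdstolz α := fun s hs =>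
    ⟨hray _ (hcn s hs).1 (ray_re hc.le (le_of_lt hs)).1,
      hray _ (hcn s hs).2 (ray_re hc.le (le_of_lt hs)).2⟩
  have hi1 : IntegrableOn (fun s : ℝ => corner β • g (s * corner β)) (Ioi 0) := by
    rw [← arc_one]
    refine integrableOn_ray measurableSet_Ioi subset_rfl hε hg (K := K') ?_ ?_
    · rw [arc_one]; exact fun s hs => (hmem0 s hs).1
    · intro s hs
      refine hK' s hs 1 (by simp) ?_
      rw [arc_one]; exact (hmem0 s hs).1
  have hi2 : IntegrableOn (fun s : ℝ => corner' β • g (s * corner' β)) (Ioi 0) := by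
    rw [← arc_two]
    refine integrableOn_ray measurableSet_Ioi subset_rfl hε hg (K := K') ?_ ?_
    · rw [arc_two]; exact fun s hs => (hmem0 s hs).2
    · intro s hs
      refine hK' s hs 2 (by simp) ?_
      rw [arc_two]; exact (hmem0 s hs).2
  have h01 : Ioi (0 : ℝ) = Ioc 0 1 ∪ Ioi 1 := (Ioc_union_Ioi_eq_Ioi zero_le_one).symm
  rw [h01] at hi1 hi2
  rw [arc_one, arc_two, integral_sub hi2.right_of_union hi1.right_of_union] at h
  have hsec := integral_sectorBoundary (ν := β) (g := g) (by
    have := (isDecayContour_sectorBoundary hray).integrable_smul hUo hg.continuousOn hε hb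
    rwa [integrableOn_univ] at this)
  have hB : IsDecayContour (sector θ \ cdstolz α) (Icc 0 3) (bcurve β) :=
    (isDecayContour_bcurve hα hαβ hβθ hθ).mono (sdiff_subset_sdiff_left hsub)
  rw [integral_bcurve_split (hB.integrable_smul hUo hg.continuousOn hε hb),
    integral_bcurve_arc, h, integral_raySet_bcurve hi1.left_of_union hi2.left_of_union, hsec,
    ← smul_integral_Ioi_comp hc (Complex.exp (-((β : ℂ) * Complex.I))),
    ← smul_integral_Ioi_comp hc (Complex.exp ((β : ℂ) * Complex.I))]
  change (∫ s in Ioi (0 : ℝ), corner β • g (s * corner β)) -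
    (∫ s in Ioi (0 : ℝ), corner' β • g (s * corner' β)) = _
  rw [h01, setIntegral_union (Ioc_disjoint_Ioi le_rfl) measurableSet_Ioi hi1.left_of_union
    hi1.right_of_union, setIntegral_union (Ioc_disjoint_Ioi le_rfl) measurableSet_Ioi
    hi2.left_of_union hi2.right_of_union]
  abel

end

/-! ### Angles and distances -/

lemma re_mul_conj_eq (z w : ℂ) :
    (z * (starRingEnd ℂ) w).re = ‖z‖ * ‖w‖ * Real.cos (Complex.arg z - Complex.arg w) := by
  have hz1 := Complex.norm_mul_cos_arg z
  have hz2 := Complex.norm_mul_sin_arg z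
  have hw1 := Complex.norm_mul_cos_arg w
  have hw2 := Complex.norm_mul_sin_arg w
  rw [Complex.mul_re, Complex.conj_re, Complex.conj_im, Real.cos_sub, ← hz1, ← hz2, ← hw1, ← hw2]
  ring

/-- A constant `c < 1` with `|Re (z w̄)| ≤ c |z| |w|` whenever `|arg w| ≤ θ` and
`α ≤ |arg z| ≤ γ`. -/
def angleConst (θ α γ : ℝ) : ℝ := max (Real.cos (α - θ)) (-Real.cos (2 * γ))

lemma angleConst_lt_one {θ α γ : ℝ} (hθ : 0 ≤ θ) (h1 : θ < α) (h2 : α ≤ γ)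
    (h3 : γ < Real.pi / 2) : angleConst θ α γ < 1 := by
  refine max_lt ?_ ?_
  · rw [← Real.cos_zero]
    exact Real.cos_lt_cos_of_nonneg_of_le_pi le_rfl (by linarith) (by linarith)
  · have : Real.cos Real.pi < Real.cos (2 * γ) :=
      Real.cos_lt_cos_of_nonneg_of_le_pi (by linarith) le_rfl (by linarith)
    rw [Real.cos_pi] at this
    linarith

lemma angleConst_nonneg {θ α γ : ℝ} (hθ : 0 ≤ θ) (h1 : θ < α) (h2 : α ≤ γ)
    (h3 : γ < Real.pi / 2) : 0 ≤ angleConst θ α γ :=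
  le_max_of_le_left (Real.cos_nonneg_of_mem_Icc ⟨by linarith, by linarith⟩)

lemma abs_arg_eq_of_re {z : ℂ} (hz : z ≠ 0) {β : ℝ} (h0 : 0 ≤ β) (h1 : β ≤ Real.pi)
    (h : z.re = ‖z‖ * Real.cos β) : |Complex.arg z| = β := by
  have hz' : 0 < ‖z‖ := norm_pos_iff.2 hz
  refine Real.injOn_cos ⟨abs_nonneg _, Complex.abs_arg_le_pi z⟩ ⟨h0, h1⟩ ?_
  rw [Real.cos_abs, Complex.cos_arg hz, h]
  field_simp

lemma abs_arg_le_of_re {w : ℂ} {ν : ℝ} (h0 : 0 ≤ ν) (h1 : ν ≤ Real.pi)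
    (h : ‖w‖ * Real.cos ν ≤ w.re) : |Complex.arg w| ≤ ν := by
  rcases eq_or_ne w 0 with rfl | hw
  · simpa using h0
  have hw' : 0 < ‖w‖ := norm_pos_iff.2 hw
  rw [← Real.strictAntiOn_cos.le_iff_ge ⟨h0, h1⟩ ⟨abs_nonneg _, Complex.abs_arg_le_pi w⟩,
    Real.cos_abs, Complex.cos_arg hw, le_div_iff₀ hw', mul_comm]
  exact h

/-- The angle between `z` and `w` lies between `α - θ` and `2γ`. It is thus bounded away from `0`
and from `π`, uniformly in `β`, which keeps `w` away from both poles `±z` of the kernel. -/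
lemma abs_re_mul_conj_le {θ α β γ : ℝ} (hθ : 0 ≤ θ) (h1 : θ < α) (hαβ : α ≤ β) (hβγ : β ≤ γ)
    (h3 : γ < Real.pi / 2) {z w : ℂ} (hz : z ≠ 0) (hzβ : z.re = ‖z‖ * Real.cos β)
    (hw : ‖w‖ * Real.cos θ ≤ w.re) :
    |(z * (starRingEnd ℂ) w).re| ≤ angleConst θ α γ * (‖z‖ * ‖w‖) := by
  have ha := abs_arg_eq_of_re hz (by linarith) (by linarith) hzβ
  have hb := abs_arg_le_of_re hθ (by linarith) hw
  rw [re_mul_conj_eq, mul_comm (angleConst _ _ _), abs_mul, abs_of_nonneg (by positivity)]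
  refine mul_le_mul_of_nonneg_left ?_ (by positivity)
  have h4 : |Complex.arg z - Complex.arg w| ≤ 2 * γ := by
    have := abs_sub (Complex.arg z) (Complex.arg w)
    linarith
  have h5 : α - θ ≤ |Complex.arg z - Complex.arg w| := by
    have := abs_sub_abs_le_abs_sub (Complex.arg z) (Complex.arg w)
    linarith
  rw [← Real.cos_abs (_ - _), abs_le]
  constructor
  · have := Real.cos_le_cos_of_nonneg_of_le_pi (abs_nonneg (Complex.arg z - Complex.arg w))
      (by linarith) h4
    have h6 : -Real.cos (2 * γ) ≤ angleConst θ α γ := le_max_right _ _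
    linarith
  · have := Real.cos_le_cos_of_nonneg_of_le_pi (by linarith) (by linarith) h5
    exact this.trans (le_max_left _ _)

lemma sq_norm_sub_ge {c : ℝ} (hc : 0 ≤ c) {z w : ℂ}
    (h : (z * (starRingEnd ℂ) w).re ≤ c * (‖z‖ * ‖w‖)) :
    (1 - c) * (‖z‖ ^ 2 + ‖w‖ ^ 2) ≤ ‖z - w‖ ^ 2 := by
  have e : ‖z - w‖ ^ 2 = ‖z‖ ^ 2 + ‖w‖ ^ 2 - 2 * (z * (starRingEnd ℂ) w).re := by
    rw [Complex.sq_norm, Complex.sq_norm, Complex.sq_norm, Complex.normSq_sub]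
  rw [e]
  nlinarith [mul_nonneg hc (sq_nonneg (‖z‖ - ‖w‖))]

lemma sq_norm_add_ge {c : ℝ} (hc : 0 ≤ c) {z w : ℂ}
    (h : -(c * (‖z‖ * ‖w‖)) ≤ (z * (starRingEnd ℂ) w).re) :
    (1 - c) * (‖z‖ ^ 2 + ‖w‖ ^ 2) ≤ ‖z + w‖ ^ 2 := by
  have := sq_norm_sub_ge (z := z) (w := -w) hc (by simp at h ⊢; linarith)
  simpa using this

lemma le_mul_of_le_sq {x a b : ℝ} (hx : 0 ≤ x) (ha : 0 ≤ a) (hb : 0 ≤ b) (h1 : x ≤ a ^ 2)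
    (h2 : x ≤ b ^ 2) : x ≤ a * b := by
  refine le_of_sq_le_sq ?_ (mul_nonneg ha hb)
  rw [mul_pow, sq]
  exact mul_le_mul h1 h2 hx (sq_nonneg a)

/-- The kernel `2w / (z² - w²)`. -/
def ker (z w : ℂ) : ℂ := (z - w)⁻¹ - (z + w)⁻¹

lemma ker_eq {z w : ℂ} (h1 : z - w ≠ 0) (h2 : z + w ≠ 0) :
    ker z w = 2 * w / ((z - w) * (z + w)) := by
  rw [ker]; field_simp; ring

/-- Both `‖z - w‖²` and `‖z + w‖²` are at least `(1 - c)(‖z‖² + ‖w‖²)`, hence so is `‖z - w‖ ‖z +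
w‖`. The outcome is a Poisson-type kernel, homogeneous of degree `-1`. -/
lemma norm_ker_le {c : ℝ} (hc : 0 ≤ c) (hc1 : c < 1) {z w : ℂ} (hz : z ≠ 0)
    (h : |(z * (starRingEnd ℂ) w).re| ≤ c * (‖z‖ * ‖w‖)) :
    z - w ≠ 0 ∧ z + w ≠ 0 ∧ ‖ker z w‖ ≤ 2 / (1 - c) * (‖w‖ / (‖z‖ ^ 2 + ‖w‖ ^ 2)) := by
  have hz' : 0 < ‖z‖ := norm_pos_iff.2 hz
  obtain ⟨h1, h2⟩ := abs_le.1 h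
  have e1 := sq_norm_sub_ge hc h2
  have e2 := sq_norm_add_ge hc h1
  have hd : 0 < (1 - c) * (‖z‖ ^ 2 + ‖w‖ ^ 2) := mul_pos (by linarith) (by positivity)
  have p1 : 0 < ‖z - w‖ := by
    by_contra hcon
    have : ‖z - w‖ = 0 := le_antisymm (not_lt.1 hcon) (norm_nonneg _)
    rw [this] at e1; linarith
  have p2 : 0 < ‖z + w‖ := by
    by_contra hcon
    have : ‖z + w‖ = 0 := le_antisymm (not_lt.1 hcon) (norm_nonneg _)
    rw [this] at e2; linarith
  have n1 : z - w ≠ 0 := norm_pos_iff.1 p1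
  have n2 : z + w ≠ 0 := norm_pos_iff.1 p2
  refine ⟨n1, n2, ?_⟩
  rw [ker_eq n1 n2, norm_div, norm_mul, norm_mul, Complex.norm_ofNat]
  have hprod : (1 - c) * (‖z‖ ^ 2 + ‖w‖ ^ 2) ≤ ‖z - w‖ * ‖z + w‖ :=
    le_mul_of_le_sq hd.le (norm_nonneg _) (norm_nonneg _) e1 e2
  calc 2 * ‖w‖ / (‖z - w‖ * ‖z + w‖) ≤ 2 * ‖w‖ / ((1 - c) * (‖z‖ ^ 2 + ‖w‖ ^ 2)) := by gcongr
    _ = _ := by rw [mul_div_mul_comm]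

/-! ### Rotation of rays -/

lemma wt_one_div {ρ : ℝ} (hρ : 0 < ρ) : wt 1 ρ / ρ = (1 + ρ ^ 2)⁻¹ := by
  rw [wt_eq hρ.le, Real.rpow_one]; field_simp

/-- This is `ray_integral_eq` for an arc of the unit circle; decay like `1 / (1 + s²)` is the weight
with exponent `1` divided by `s`. -/
lemma ray_rotate {E : Type*} [NormedAddCommGroup E] [NormedSpace ℂ E] [CompleteSpace E]
    {g : ℂ → E} {U : Set ℂ} {φ₁ φ₂ K : ℝ} (hU : IsOpen U)
    (hg : DifferentiableOn ℂ g U) (hφ : φ₁ ≤ φ₂)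
    (hmem : ∀ s : ℝ, 0 < s → ∀ τ ∈ Icc φ₁ φ₂, (s : ℂ) * Complex.exp (τ * Complex.I) ∈ U)
    (hb : ∀ s : ℝ, 0 < s → ∀ τ ∈ Icc φ₁ φ₂,
      ‖g (s * Complex.exp (τ * Complex.I))‖ * (1 + s ^ 2) ≤ K) :
    IntegrableOn (fun s : ℝ => Complex.exp (φ₁ * Complex.I) •
      g (s * Complex.exp (φ₁ * Complex.I))) (Ioi 0) ∧
    IntegrableOn (fun s : ℝ => Complex.exp (φ₂ * Complex.I) •
      g (s * Complex.exp (φ₂ * Complex.I))) (Ioi 0) ∧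
    ∫ s in Ioi (0 : ℝ), Complex.exp (φ₁ * Complex.I) • g (s * Complex.exp (φ₁ * Complex.I)) =
      ∫ s in Ioi (0 : ℝ), Complex.exp (φ₂ * Complex.I) • g (s * Complex.exp (φ₂ * Complex.I)) := by
  have hb' : ∀ s : ℝ, 0 < s → ∀ τ ∈ Icc φ₁ φ₂,
      ‖g (s * Complex.exp (τ * Complex.I))‖ ≤ K * (wt 1 s / s) := by
    intro s hs τ hτ
    rw [wt_one_div hs, ← div_eq_mul_inv, le_div_iff₀ (by positivity)]
    exact hb s hs τ hτ
  have hd : ∀ τ : ℝ, HasDerivAt (fun τ : ℝ => Complex.exp (τ * Complex.I))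
      (Complex.exp (τ * Complex.I) * Complex.I) τ := by
    intro τ
    have := ((hasDerivAt_id τ).ofReal_comp.mul_const Complex.I).cexp
    simpa using this
  have h := ray_integral_eq one_pos hU hg hφ (fun τ _ => hd τ)
    (by fun_prop) hmem hb'
  have hi1 := integrableOn_ray measurableSet_Ioi subset_rfl one_pos hg
    (fun s hs => hmem s hs φ₁ ⟨le_rfl, hφ⟩) (fun s hs => hb' s hs φ₁ ⟨le_rfl, hφ⟩)
  have hi2 := integrableOn_ray measurableSet_Ioi subset_rfl one_pos hg
    (fun s hs => hmem s hs φ₂ ⟨hφ, le_rfl⟩) (fun s hs => hb' s hs φ₂ ⟨hφ, le_rfl⟩)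
  refine ⟨hi1, hi2, ?_⟩
  rw [integral_sub hi2 hi1] at h
  exact (sub_eq_zero.1 h).symm

lemma norm_ray {s : ℝ} (hs : 0 < s) (τ : ℝ) : ‖(s : ℂ) * Complex.exp (τ * Complex.I)‖ = s := by
  rw [norm_mul, Complex.norm_exp_ofReal_mul_I, mul_one, Complex.norm_real,
    Real.norm_of_nonneg hs.le]

lemma ray_point_re (s τ : ℝ) : ((s : ℂ) * Complex.exp (τ * Complex.I)).re = s * Real.cos τ := by
  rw [Complex.re_ofReal_mul, Complex.exp_ofReal_mul_I_re]

lemma exp_neg_eq (ν : ℝ) : Complex.exp (-((ν : ℂ) * Complex.I)) =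
    Complex.exp (((-ν : ℝ) : ℂ) * Complex.I) := by
  push_cast; ring_nf

lemma sq_norm_sub_one_ge {ν : ℝ} (hν : 0 ≤ Real.cos ν) {w : ℂ} (hw : w.re ≤ ‖w‖ * Real.cos ν) :
    (1 - Real.cos ν) * (1 + ‖w‖ ^ 2) ≤ ‖w - 1‖ ^ 2 := by
  have := sq_norm_sub_ge (z := w) (w := 1) hν (by simpa [mul_comm] using hw)
  simpa [add_comm] using this

lemma sq_norm_add_one_ge {w : ℂ} (hw : 0 ≤ w.re) : 1 + ‖w‖ ^ 2 ≤ ‖w + 1‖ ^ 2 := by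
  have := sq_norm_add_ge (z := w) (w := 1) le_rfl (by simpa using hw)
  simpa [add_comm] using this

/-- The function `w ↦ 1/(w-1) - 1/(w+1)`. -/
def unitKer (w : ℂ) : ℂ := (w - 1)⁻¹ - (w + 1)⁻¹

/-- This stands in for the residue at `1`. Both rays are rotated to the imaginary half-axes without
meeting `±1`, and there the integrands are `±2i / (1 + s²)`. -/
lemma integral_rays_unitKer {ν : ℝ} (h0 : 0 < ν) (h1 : ν < Real.pi / 2) :
    IntegrableOn (fun s : ℝ => Complex.exp (((-ν : ℝ) : ℂ) * Complex.I) •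
      unitKer (s * Complex.exp (((-ν : ℝ) : ℂ) * Complex.I))) (Ioi 0) ∧
    IntegrableOn (fun s : ℝ => Complex.exp ((ν : ℂ) * Complex.I) •
      unitKer (s * Complex.exp ((ν : ℂ) * Complex.I))) (Ioi 0) ∧
    (∫ s in Ioi (0 : ℝ), Complex.exp (((-ν : ℝ) : ℂ) * Complex.I) •
        unitKer (s * Complex.exp (((-ν : ℝ) : ℂ) * Complex.I))) -
      ∫ s in Ioi (0 : ℝ), Complex.exp ((ν : ℂ) * Complex.I) •
        unitKer (s * Complex.exp ((ν : ℂ) * Complex.I)) = 2 * Real.pi * Complex.I := by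
  have hc : 0 < Real.cos ν := Real.cos_pos_of_mem_Ioo ⟨by linarith, h1⟩
  have hc1 : Real.cos ν < 1 := by
    rw [← Real.cos_zero]
    exact Real.cos_lt_cos_of_nonneg_of_le_pi le_rfl (by linarith) h0
  set U : Set ℂ := {w | w ≠ 1 ∧ w ≠ -1} with hUdef
  have hU : IsOpen U := isOpen_ne.inter isOpen_ne
  have hg : DifferentiableOn ℂ unitKer U := by
    intro w hw
    have e1 : w - 1 ≠ 0 := sub_ne_zero.2 hw.1
    have e2 : w + 1 ≠ 0 := fun h => hw.2 (eq_neg_of_add_eq_zero_left h)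
    unfold unitKer
    exact (((differentiableAt_fun_id.sub_const (1 : ℂ)).inv e1).sub
      ((differentiableAt_fun_id.add_const (1 : ℂ)).inv e2)).differentiableWithinAt
  have key : ∀ w : ℂ, 0 ≤ w.re → w.re ≤ ‖w‖ * Real.cos ν →
      w ∈ U ∧ ‖unitKer w‖ * (1 + ‖w‖ ^ 2) ≤ 2 / (1 - Real.cos ν) := by
    intro w hw1 hw2
    have e1 := sq_norm_sub_one_ge hc.le hw2
    have e2 := sq_norm_add_one_ge hw1
    have hp : 0 < 1 - Real.cos ν := by linarith
    have p1 : 0 < ‖w - 1‖ ^ 2 := lt_of_lt_of_le (by positivity) e1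
    have p2 : 0 < ‖w + 1‖ ^ 2 := lt_of_lt_of_le (by positivity) e2
    have n1 : w - 1 ≠ 0 := by rintro h; simp [h] at p1
    have n2 : w + 1 ≠ 0 := by rintro h; simp [h] at p2
    refine ⟨⟨sub_ne_zero.1 n1, fun h => n2 (by simp [h])⟩, ?_⟩
    have e3 : unitKer w = 2 / ((w - 1) * (w + 1)) := by rw [unitKer]; field_simp; ring
    rw [e3, norm_div, norm_mul, Complex.norm_ofNat, div_mul_eq_mul_div]
    have hq1 : 0 < ‖w - 1‖ := norm_pos_iff.2 n1
    have hq2 : 0 < ‖w + 1‖ := norm_pos_iff.2 n2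
    rw [div_le_div_iff₀ (by positivity) hp]
    have e4 : (1 - Real.cos ν) * (1 + ‖w‖ ^ 2) ≤ ‖w - 1‖ * ‖w + 1‖ := by
      refine le_mul_of_le_sq (by positivity) hq1.le hq2.le e1 (le_trans ?_ e2)
      exact mul_le_of_le_one_left (by positivity) (by linarith)
    linarith
  have hτ1 : ∀ s : ℝ, 0 < s → ∀ τ ∈ Icc ν (Real.pi / 2),
      0 ≤ ((s : ℂ) * Complex.exp (τ * Complex.I)).re ∧
      ((s : ℂ) * Complex.exp (τ * Complex.I)).re ≤
        ‖(s : ℂ) * Complex.exp (τ * Complex.I)‖ * Real.cos ν := by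
    intro s hs τ hτ
    rw [ray_point_re, norm_ray hs]
    exact ⟨mul_nonneg hs.le (Real.cos_nonneg_of_mem_Icc ⟨by linarith [hτ.1], hτ.2⟩),
      mul_le_mul_of_nonneg_left
        (Real.cos_le_cos_of_nonneg_of_le_pi h0.le (by linarith [hτ.2]) hτ.1) hs.le⟩
  have hτ2 : ∀ s : ℝ, 0 < s → ∀ τ ∈ Icc (-(Real.pi / 2)) (-ν),
      0 ≤ ((s : ℂ) * Complex.exp (τ * Complex.I)).re ∧
      ((s : ℂ) * Complex.exp (τ * Complex.I)).re ≤
        ‖(s : ℂ) * Complex.exp (τ * Complex.I)‖ * Real.cos ν := by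
    intro s hs τ hτ
    have := hτ1 s hs (-τ) ⟨by linarith [hτ.2], by linarith [hτ.1]⟩
    rw [ray_point_re, norm_ray hs] at this ⊢
    rwa [Real.cos_neg] at this
  obtain ⟨a1, a2, a3⟩ := ray_rotate hU hg h1.le (fun s hs τ hτ => (key _ (hτ1 s hs τ hτ).1
    (hτ1 s hs τ hτ).2).1) (fun s hs τ hτ => by
      have := (key _ (hτ1 s hs τ hτ).1 (hτ1 s hs τ hτ).2).2
      rwa [norm_ray hs] at this)
  obtain ⟨b1, b2, b3⟩ := ray_rotate (φ₁ := -(Real.pi / 2)) (φ₂ := -ν) hU hg (by linarith)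
    (fun s hs τ hτ => (key _ (hτ2 s hs τ hτ).1
    (hτ2 s hs τ hτ).2).1) (fun s hs τ hτ => by
      have := (key _ (hτ2 s hs τ hτ).1 (hτ2 s hs τ hτ).2).2
      rwa [norm_ray hs] at this)
  refine ⟨b2, a1, ?_⟩
  rw [a3, ← b3]
  have hI : Complex.exp (((Real.pi / 2 : ℝ) : ℂ) * Complex.I) = Complex.I := by
    push_cast; exact Complex.exp_pi_div_two_mul_I
  have hI' : Complex.exp (((-(Real.pi / 2) : ℝ) : ℂ) * Complex.I) = -Complex.I := by
    push_cast; rw [← neg_div]; exact Complex.exp_neg_pi_div_two_mul_I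
  rw [hI, hI']
  have hval : ∀ s : ℝ, (s : ℂ) ^ 2 + 1 ≠ 0 := by
    intro s
    have : (s : ℂ) ^ 2 + 1 = ((s ^ 2 + 1 : ℝ) : ℂ) := by push_cast; ring
    rw [this]
    exact_mod_cast (by positivity : s ^ 2 + 1 ≠ 0)
  have hI2 : Complex.I ^ 2 = -1 := Complex.I_sq
  have n1 : ∀ s : ℝ, (s : ℂ) * Complex.I - 1 ≠ 0 := by
    intro s h
    have := congrArg Complex.re h
    simp at this
  have n2 : ∀ s : ℝ, (s : ℂ) * Complex.I + 1 ≠ 0 := by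
    intro s h
    have := congrArg Complex.re h
    simp at this
  have v1 : ∀ s : ℝ, Complex.I • unitKer (s * Complex.I) =
      -(2 * Complex.I) * (((1 + s ^ 2)⁻¹ : ℝ) : ℂ) := by
    intro s
    have := hval s
    have e : ((s : ℂ) * Complex.I - 1) * (s * Complex.I + 1) = -((s : ℂ) ^ 2 + 1) := by
      linear_combination (s : ℂ) ^ 2 * hI2
    have e3 : unitKer (s * Complex.I) = 2 / -((s : ℂ) ^ 2 + 1) := by
      rw [← e, unitKer]
      have := n1 s
      have := n2 s
      field_simp; ring
    rw [e3, smul_eq_mul]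
    push_cast
    rw [add_comm (1 : ℂ)]
    field_simp
  have v2 : ∀ s : ℝ, (-Complex.I) • unitKer (s * -Complex.I) =
      (2 * Complex.I) * (((1 + s ^ 2)⁻¹ : ℝ) : ℂ) := by
    intro s
    have h := v1 (-s)
    have : ((-s : ℝ) : ℂ) * Complex.I = s * -Complex.I := by push_cast; ring
    rw [this, neg_sq] at h
    rw [neg_smul, h]; ring
  simp_rw [v1, v2]
  rw [integral_const_mul, integral_const_mul, integral_complex_ofReal, integral_Ioi_inv_one_add_sq,
    Real.arctan_zero]
  push_cast
  ring

/-! ### The kernel calculus in a Banach algebra -/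

section Algebra

variable {𝔸 : Type*} [NormedRing 𝔸] [NormedAlgebra ℂ 𝔸]

lemma resolvent_mul_self {a : 𝔸} {z : ℂ} (hz : z ∈ resolventSet ℂ a) :
    resolvent a z * (algebraMap ℂ 𝔸 z - a) = 1 := Ring.inverse_mul_cancel _ hz

lemma self_mul_resolvent {a : 𝔸} {z : ℂ} (hz : z ∈ resolventSet ℂ a) :
    (algebraMap ℂ 𝔸 z - a) * resolvent a z = 1 := Ring.mul_inverse_cancel _ hz

lemma resolvent_mul_right {a : 𝔸} {z : ℂ} (hz : z ∈ resolventSet ℂ a) :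
    resolvent a z * a = z • resolvent a z - 1 := by
  have h := resolvent_mul_self hz
  rw [mul_sub, Algebra.algebraMap_eq_smul_one, mul_smul_comm, mul_one] at h
  rw [← h]; abel

lemma resolvent_mul_left {a : 𝔸} {z : ℂ} (hz : z ∈ resolventSet ℂ a) :
    a * resolvent a z = z • resolvent a z - 1 := by
  have h := self_mul_resolvent hz
  rw [sub_mul, Algebra.algebraMap_eq_smul_one, smul_mul_assoc, one_mul] at h
  rw [← h]; abel

lemma resolvent_identity {a : 𝔸} {w z : ℂ} (hw : w ∈ resolventSet ℂ a)
    (hz : z ∈ resolventSet ℂ a) :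
    (z - w) • (resolvent a w * resolvent a z) = resolvent a w - resolvent a z := by
  have h1 : resolvent a w = resolvent a w * ((algebraMap ℂ 𝔸 z - a) * resolvent a z) := by
    rw [self_mul_resolvent hz, mul_one]
  have h2 : resolvent a z = (resolvent a w * (algebraMap ℂ 𝔸 w - a)) * resolvent a z := by
    rw [resolvent_mul_self hw, one_mul]
  have h3 : resolvent a w - resolvent a z = resolvent a w * ((algebraMap ℂ 𝔸 z - a) *
      resolvent a z) - (resolvent a w * (algebraMap ℂ 𝔸 w - a)) * resolvent a z := by
    rw [← h1, ← h2]
  rw [h3, mul_assoc (resolvent a w), ← mul_sub, ← sub_mul, sub_sub_sub_cancel_right, ← map_sub,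
    Algebra.algebraMap_eq_smul_one, smul_mul_assoc, one_mul, mul_smul_comm]

lemma differentiableOn_resolvent [CompleteSpace 𝔸] (a : 𝔸) :
    DifferentiableOn ℂ (resolvent a) (resolventSet ℂ a) := fun _ hz =>
  (spectrum.hasDerivAt_resolvent_const_left hz).differentiableAt.differentiableWithinAt

/-- The value `2a (z² - a²)⁻¹` of the kernel at `a`. -/
def kerOp (a : 𝔸) (z : ℂ) : 𝔸 := resolvent a z + resolvent a (-z)

/-- The resolvent identity at `z` and at `-z` separates the singularities in `w`: the first term has
them only in the spectrum of `a`, the other only at `±z`. -/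
lemma ker_smul_resolvent {a : 𝔸} {w z : ℂ} (hw : w ∈ resolventSet ℂ a)
    (hz : z ∈ resolventSet ℂ a) (hz' : -z ∈ resolventSet ℂ a) (h1 : z - w ≠ 0) (h2 : z + w ≠ 0) :
    ker z w • resolvent a w = resolvent a w * kerOp a z +
      ((z - w)⁻¹ • resolvent a z - (z + w)⁻¹ • resolvent a (-z)) := by
  have e1 : resolvent a w * resolvent a z = (z - w)⁻¹ • (resolvent a w - resolvent a z) := by
    rw [← resolvent_identity hw hz, smul_smul, inv_mul_cancel₀ h1, one_smul]
  have e2 : resolvent a w * resolvent a (-z) =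
      -((z + w)⁻¹ • (resolvent a w - resolvent a (-z))) := by
    rw [← resolvent_identity hw hz', smul_smul, ← neg_smul]
    have : -((z + w)⁻¹ * (-z - w)) = 1 := by field_simp; ring
    rw [this, one_smul]
  rw [kerOp, mul_add, e1, e2, ker, sub_smul, smul_sub, smul_sub]
  abel

/-- The factor `a` on the left is what matters: it makes `resolvent a w * kerOp a z` bounded as `w →
0`, where the resolvent alone is only `O(1 / |w|)`. -/
lemma kerOp_eq {a : 𝔸} {z : ℂ} (hz : z ∈ resolventSet ℂ a) (hz' : -z ∈ resolventSet ℂ a) :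
    kerOp a z = a * ((-2 : ℂ) • (resolvent a z * resolvent a (-z))) := by
  have h := resolvent_mul_left hz
  have e1 := resolvent_identity hz hz'
  have e2 : (-2 * z) • (resolvent a z * resolvent a (-z)) = resolvent a z - resolvent a (-z) := by
    rw [← e1]; congr 1; ring
  rw [mul_smul_comm, ← mul_assoc, h, sub_mul, one_mul, smul_mul_assoc, smul_sub, smul_smul, e2,
    kerOp, neg_smul, two_smul]
  abel

lemma integral_add_add {α E : Type*} [MeasurableSpace α] {μ : Measure α} [NormedAddCommGroup E]
    [NormedSpace ℝ E] {f g h : α → E} (hf : Integrable f μ) (hg : Integrable g μ)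
    (hh : Integrable h μ) :
    ∫ x, (f x + g x + h x) ∂μ = (∫ x, f x ∂μ) + (∫ x, g x ∂μ) + ∫ x, h x ∂μ := by
  rw [← integral_add hf hg]
  exact integral_add (hf.add hg) hh

variable [CompleteSpace 𝔸]

/-- The complement of the closed sector of angle `ν`. -/
def leftRegion (ν : ℝ) : Set ℂ := {w | w.re < ‖w‖ * Real.cos ν}

lemma isOpen_leftRegion (ν : ℝ) : IsOpen (leftRegion ν) :=
  isOpen_lt Complex.continuous_re (by fun_prop)

lemma leftRegion_ne_zero {ν : ℝ} {w : ℂ} (hw : w ∈ leftRegion ν) : w ≠ 0 := by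
  rintro rfl
  simp [leftRegion] at hw

lemma ray_mem_leftRegion {ν₁ ν : ℝ} (h0 : 0 ≤ ν₁) (h1 : ν₁ < ν) (h2 : ν ≤ Real.pi) {z : ℂ}
    (hz : z ≠ 0) (hre : z.re ≤ ‖z‖ * Real.cos ν) : z ∈ leftRegion ν₁ :=
  hre.trans_lt (mul_lt_mul_of_pos_left (Real.cos_lt_cos_of_nonneg_of_le_pi h0 h2 h1)
    (norm_pos_iff.2 hz))

/-- The integrand is holomorphic outside the sector, so the ray of angle `ν` can be rotated through
the negative axis to angle `2π - ν`. The term `(w - 1)⁻¹`, whose pole lies inside the sector,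
cancels the `1 / w` behaviour at infinity. -/
lemma integral_rays_left {a : 𝔸} {ν₁ ν K : ℝ} (h0 : 0 < ν₁) (h1 : ν₁ < ν)
    (h2 : ν < Real.pi / 2) (hL : leftRegion ν₁ ⊆ resolventSet ℂ a)
    (hK : ∀ w ∈ leftRegion ν₁, ‖w‖ * ‖resolvent a w‖ ≤ K) (M : 𝔸) :
    IntegrableOn (fun s : ℝ => Complex.exp (((-ν : ℝ) : ℂ) * Complex.I) •
      (fun w : ℂ => resolvent a w * (a * M) - (w - 1)⁻¹ • (a * M))
        (s * Complex.exp (((-ν : ℝ) : ℂ) * Complex.I))) (Ioi 0) ∧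
    IntegrableOn (fun s : ℝ => Complex.exp ((ν : ℂ) * Complex.I) •
      (fun w : ℂ => resolvent a w * (a * M) - (w - 1)⁻¹ • (a * M))
        (s * Complex.exp ((ν : ℂ) * Complex.I))) (Ioi 0) ∧
    (∫ s in Ioi (0 : ℝ), Complex.exp (((-ν : ℝ) : ℂ) * Complex.I) •
        (fun w : ℂ => resolvent a w * (a * M) - (w - 1)⁻¹ • (a * M))
          (s * Complex.exp (((-ν : ℝ) : ℂ) * Complex.I))) =
      ∫ s in Ioi (0 : ℝ), Complex.exp ((ν : ℂ) * Complex.I) •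
        (fun w : ℂ => resolvent a w * (a * M) - (w - 1)⁻¹ • (a * M))
          (s * Complex.exp ((ν : ℂ) * Complex.I)) := by
  set D : ℂ → 𝔸 := fun w : ℂ => resolvent a w * (a * M) - (w - 1)⁻¹ • (a * M) with hD
  have hc : 0 < Real.cos ν₁ := Real.cos_pos_of_mem_Ioo ⟨by linarith, by linarith⟩
  have hc1 : Real.cos ν₁ < 1 := by
    rw [← Real.cos_zero]
    exact Real.cos_lt_cos_of_nonneg_of_le_pi le_rfl (by linarith) h0
  have hne1 : ∀ w ∈ leftRegion ν₁, w - 1 ≠ 0 := by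
    intro w hw h
    rw [sub_eq_zero] at h
    subst h
    simp [leftRegion] at hw
    linarith
  have hg : DifferentiableOn ℂ D (leftRegion ν₁) := by
    intro w hw
    have e1 : DifferentiableAt ℂ (fun w => resolvent a w) w :=
      (spectrum.hasDerivAt_resolvent_const_left (hL hw)).differentiableAt
    have e2 : DifferentiableAt ℂ (fun w : ℂ => (w - 1)⁻¹) w :=
      (differentiableAt_fun_id.sub_const (1 : ℂ)).inv (hne1 w hw)
    exact ((e1.mul_const (a * M)).sub (e2.smul_const (a * M))).differentiableWithinAt
  set δ := Real.sqrt (1 - Real.cos ν₁) with hδ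
  have hδ0 : 0 < δ := Real.sqrt_pos.2 (by linarith)
  have hdist : ∀ w ∈ leftRegion ν₁, δ ≤ ‖w - 1‖ ∧ δ * ‖w‖ ≤ ‖w - 1‖ := by
    intro w hw
    have h := sq_norm_sub_one_ge hc.le (le_of_lt hw)
    have hsq : δ ^ 2 = 1 - Real.cos ν₁ := Real.sq_sqrt (by linarith)
    rw [← hsq] at h
    constructor
    · refine le_of_sq_le_sq (le_trans ?_ h) (norm_nonneg _)
      nlinarith [sq_nonneg (δ * ‖w‖)]
    · refine le_of_sq_le_sq (le_trans ?_ h) (norm_nonneg _)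
      nlinarith [sq_nonneg δ]
  obtain ⟨C, hC⟩ : ∃ C : ℝ, ∀ w ∈ leftRegion ν₁, ‖D w‖ * (1 + ‖w‖ ^ 2) ≤ C := by
    refine ⟨((K + ‖(1 : 𝔸)‖) * ‖M‖ + δ⁻¹ * ‖a * M‖) + δ⁻¹ * (K * ‖(a - 1) * (a * M)‖), fun w hw => ?_⟩
    obtain ⟨hd1, hd2⟩ := hdist w hw
    have hw0 : 0 < ‖w‖ := norm_pos_iff.2 (leftRegion_ne_zero hw)
    have hw1 : 0 < ‖w - 1‖ := norm_pos_iff.2 (hne1 w hw)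
    -- Boundedness, in particular near `0`, from `R(w) a = w R(w) - 1`.
    have b1 : ‖D w‖ ≤ (K + ‖(1 : 𝔸)‖) * ‖M‖ + δ⁻¹ * ‖a * M‖ := by
      have : D w = (w • resolvent a w - 1) * M - (w - 1)⁻¹ • (a * M) := by
        rw [hD]; simp only; rw [← mul_assoc, resolvent_mul_right (hL hw)]
      rw [this]
      refine (norm_sub_le _ _).trans (add_le_add ?_ ?_)
      · refine (norm_mul_le _ _).trans (mul_le_mul_of_nonneg_right ?_ (norm_nonneg _))
        refine (norm_sub_le _ _).trans (add_le_add_left ?_ _)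
        rw [norm_smul]
        exact hK w hw
      · rw [norm_smul, norm_inv]
        gcongr
    -- Quadratic decay at infinity, from `R(w) - (w - 1)⁻¹ = (w - 1)⁻¹ R(w) (a - 1)`.
    have b2 : ‖D w‖ * ‖w‖ ^ 2 ≤ δ⁻¹ * (K * ‖(a - 1) * (a * M)‖) := by
      have : D w = (w - 1)⁻¹ • (resolvent a w * ((a - 1) * (a * M))) := by
        have e : resolvent a w * (a - 1) = (w - 1) • resolvent a w - 1 := by
          rw [mul_sub, resolvent_mul_right (hL hw), mul_one, sub_smul, one_smul]; abel
        rw [← mul_assoc, e, sub_mul, one_mul, smul_mul_assoc, smul_sub, smul_smul,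
          inv_mul_cancel₀ (hne1 w hw), one_smul]
      rw [this, norm_smul, norm_inv]
      have e2 : ‖resolvent a w * ((a - 1) * (a * M))‖ * ‖w‖ ≤ K * ‖(a - 1) * (a * M)‖ := by
        calc _ ≤ (‖resolvent a w‖ * ‖(a - 1) * (a * M)‖) * ‖w‖ := by
              gcongr; exact norm_mul_le _ _
          _ = (‖w‖ * ‖resolvent a w‖) * ‖(a - 1) * (a * M)‖ := by ring
          _ ≤ _ := by gcongr; exact hK w hw
      have e3 : ‖w - 1‖⁻¹ * ‖w‖ ≤ δ⁻¹ := by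
        rw [inv_mul_eq_div, div_le_iff₀ hw1, inv_mul_eq_div, le_div_iff₀ hδ0, mul_comm]
        exact hd2
      calc _ = (‖w - 1‖⁻¹ * ‖w‖) * (‖resolvent a w * ((a - 1) * (a * M))‖ * ‖w‖) := by ring
        _ ≤ _ := mul_le_mul e3 e2 (by positivity) (by positivity)
    linarith
  have hmem : ∀ s : ℝ, 0 < s → ∀ τ ∈ Icc ν (2 * Real.pi - ν),
      (s : ℂ) * Complex.exp (τ * Complex.I) ∈ leftRegion ν₁ := by
    intro s hs τ hτ
    refine ray_mem_leftRegion h0.le h1 (by linarith) ?_ ?_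
    · rw [← norm_pos_iff, norm_ray hs]; exact hs
    · rw [ray_point_re, norm_ray hs]
      refine mul_le_mul_of_nonneg_left ?_ hs.le
      have h3 : |τ - Real.pi| ≤ Real.pi - ν := abs_le.2 ⟨by linarith [hτ.1], by linarith [hτ.2]⟩
      have := Real.cos_le_cos_of_nonneg_of_le_pi (abs_nonneg (τ - Real.pi)) (by linarith) h3
      rw [Real.cos_abs, Real.cos_sub_pi, Real.cos_pi_sub] at this
      linarith
  obtain ⟨a1, a2, a3⟩ := ray_rotate (isOpen_leftRegion ν₁) hg
    (by linarith [Real.pi_pos] : ν ≤ 2 * Real.pi - ν) hmem (fun s hs τ hτ => by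
      have := hC _ (hmem s hs τ hτ)
      rwa [norm_ray hs] at this)
  have hper : Complex.exp (((2 * Real.pi - ν : ℝ) : ℂ) * Complex.I) =
      Complex.exp (((-ν : ℝ) : ℂ) * Complex.I) := by
    have : ((2 * Real.pi - ν : ℝ) : ℂ) * Complex.I =
        ((-ν : ℝ) : ℂ) * Complex.I + 2 * Real.pi * Complex.I := by push_cast; ring
    rw [this, Complex.exp_add, Complex.exp_two_pi_mul_I, mul_one]
  rw [hper] at a2 a3
  exact ⟨a2, a1, a3.symm⟩

/-- All poles `z`, `-z`, `-1` lie outside the closed sector of angle `ν`, so one ray can be rotated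
to the other through the positive axis. The terms `(w + 1)⁻¹` are inserted to get quadratic decay at
infinity. -/
lemma integral_rays_right {ν β : ℝ} (h0 : 0 < ν) (h1 : ν < β) (h2 : β < Real.pi / 2) {z : ℂ}
    (hz : z ≠ 0) (hre : z.re = ‖z‖ * Real.cos β) (P Q : 𝔸) :
    IntegrableOn (fun s : ℝ => Complex.exp (((-ν : ℝ) : ℂ) * Complex.I) •
      (fun w : ℂ => ((z - w)⁻¹ + (w + 1)⁻¹) • P + ((w + 1)⁻¹ - (z + w)⁻¹) • Q)
        (s * Complex.exp (((-ν : ℝ) : ℂ) * Complex.I))) (Ioi 0) ∧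
    IntegrableOn (fun s : ℝ => Complex.exp ((ν : ℂ) * Complex.I) •
      (fun w : ℂ => ((z - w)⁻¹ + (w + 1)⁻¹) • P + ((w + 1)⁻¹ - (z + w)⁻¹) • Q)
        (s * Complex.exp ((ν : ℂ) * Complex.I))) (Ioi 0) ∧
    (∫ s in Ioi (0 : ℝ), Complex.exp (((-ν : ℝ) : ℂ) * Complex.I) •
        (fun w : ℂ => ((z - w)⁻¹ + (w + 1)⁻¹) • P + ((w + 1)⁻¹ - (z + w)⁻¹) • Q)
          (s * Complex.exp (((-ν : ℝ) : ℂ) * Complex.I))) =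
      ∫ s in Ioi (0 : ℝ), Complex.exp ((ν : ℂ) * Complex.I) •
        (fun w : ℂ => ((z - w)⁻¹ + (w + 1)⁻¹) • P + ((w + 1)⁻¹ - (z + w)⁻¹) • Q)
          (s * Complex.exp ((ν : ℂ) * Complex.I)) := by
  set G : ℂ → 𝔸 := fun w : ℂ => ((z - w)⁻¹ + (w + 1)⁻¹) • P + ((w + 1)⁻¹ - (z + w)⁻¹) • Q
    with hG
  set c := angleConst ν β β with hcdef
  have hc0 : 0 ≤ c := angleConst_nonneg h0.le h1 le_rfl h2
  have hc1 : c < 1 := angleConst_lt_one h0.le h1 le_rfl h2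
  have hcν : 0 < Real.cos ν := Real.cos_pos_of_mem_Ioo ⟨by linarith, by linarith⟩
  have hz0 : 0 < ‖z‖ := norm_pos_iff.2 hz
  set U : Set ℂ := {w | z - w ≠ 0 ∧ z + w ≠ 0 ∧ w + 1 ≠ 0} with hUdef
  have hU : IsOpen U :=
    (isOpen_ne_fun (by fun_prop) (by fun_prop)).inter
      ((isOpen_ne_fun (by fun_prop) (by fun_prop)).inter
        (isOpen_ne_fun (by fun_prop) (by fun_prop)))
  have hg : DifferentiableOn ℂ G U := by
    rintro w ⟨e1, e2, e3⟩
    have d1 : DifferentiableAt ℂ (fun w : ℂ => (z - w)⁻¹) w :=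
      (differentiableAt_fun_id.const_sub z).inv e1
    have d2 : DifferentiableAt ℂ (fun w : ℂ => (z + w)⁻¹) w :=
      (differentiableAt_fun_id.const_add z).inv e2
    have d3 : DifferentiableAt ℂ (fun w : ℂ => (w + 1)⁻¹) w :=
      (differentiableAt_fun_id.add_const (1 : ℂ)).inv e3
    exact (((d1.add d3).smul_const P).add ((d3.sub d2).smul_const Q)).differentiableWithinAt
  set δ := Real.sqrt (1 - c) with hδ
  have hδ0 : 0 < δ := Real.sqrt_pos.2 (by linarith)
  have hsq : δ ^ 2 = 1 - c := Real.sq_sqrt (by linarith)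
  have key : ∀ w : ℂ, ‖w‖ * Real.cos ν ≤ w.re → w ∈ U ∧ ‖G w‖ * (1 + ‖w‖ ^ 2) ≤
      (‖z + 1‖ * ‖P‖ + ‖z - 1‖ * ‖Q‖) * ((δ * ‖z‖)⁻¹ + δ⁻¹) := by
    intro w hw
    have hw0 : 0 ≤ w.re := le_trans (by positivity) hw
    obtain ⟨h3, h4⟩ := abs_le.1 (abs_re_mul_conj_le h0.le h1 le_rfl le_rfl h2 hz hre hw)
    have e1 := sq_norm_sub_ge hc0 h4
    have e2 := sq_norm_add_ge hc0 h3
    have e3 := sq_norm_add_one_ge hw0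
    rw [← hsq] at e1 e2
    have f1 : δ * ‖z‖ ≤ ‖z - w‖ := le_of_sq_le_sq (by nlinarith [sq_nonneg (δ * ‖w‖)]) (norm_nonneg _)
    have f2 : δ * ‖z‖ ≤ ‖z + w‖ := le_of_sq_le_sq (by nlinarith [sq_nonneg (δ * ‖w‖)]) (norm_nonneg _)
    have f1' : δ * ‖w‖ ≤ ‖z - w‖ := le_of_sq_le_sq (by nlinarith [sq_nonneg (δ * ‖z‖)]) (norm_nonneg _)
    have f2' : δ * ‖w‖ ≤ ‖z + w‖ := le_of_sq_le_sq (by nlinarith [sq_nonneg (δ * ‖z‖)]) (norm_nonneg _)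
    have f3 : 1 ≤ ‖w + 1‖ := le_of_sq_le_sq (by nlinarith [sq_nonneg ‖w‖]) (norm_nonneg _)
    have f3' : ‖w‖ ≤ ‖w + 1‖ := le_of_sq_le_sq (by nlinarith) (norm_nonneg _)
    have p0 : 0 < δ * ‖z‖ := by positivity
    have p1 : 0 < ‖z - w‖ := p0.trans_le f1
    have p2 : 0 < ‖z + w‖ := p0.trans_le f2
    have p3 : 0 < ‖w + 1‖ := one_pos.trans_le f3
    have n1 := norm_pos_iff.1 p1
    have n2 := norm_pos_iff.1 p2
    have n3 := norm_pos_iff.1 p3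
    refine ⟨⟨n1, n2, n3⟩, ?_⟩
    have hq : ∀ u : ℝ, 0 < u → δ * ‖z‖ ≤ u → δ * ‖w‖ ≤ u →
        (u * ‖w + 1‖)⁻¹ * (1 + ‖w‖ ^ 2) ≤ (δ * ‖z‖)⁻¹ + δ⁻¹ := by
      intro u hu hu1 hu2
      have g1 : u⁻¹ ≤ (δ * ‖z‖)⁻¹ := inv_anti₀ p0 hu1
      have g2 : u⁻¹ * ‖w‖ ≤ δ⁻¹ := by
        rw [inv_mul_eq_div, div_le_iff₀ hu, inv_mul_eq_div, le_div_iff₀ hδ0, mul_comm]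
        exact hu2
      have g3 : ‖w + 1‖⁻¹ ≤ 1 := inv_le_one_of_one_le₀ f3
      have g4 : ‖w + 1‖⁻¹ * ‖w‖ ≤ 1 := by
        rw [inv_mul_eq_div, div_le_one p3]; exact f3'
      calc (u * ‖w + 1‖)⁻¹ * (1 + ‖w‖ ^ 2)
          = u⁻¹ * ‖w + 1‖⁻¹ + (u⁻¹ * ‖w‖) * (‖w + 1‖⁻¹ * ‖w‖) := by rw [mul_inv]; ring
        _ ≤ (δ * ‖z‖)⁻¹ * 1 + δ⁻¹ * 1 := by gcongr
        _ = _ := by ring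
    have q1 : (z - w)⁻¹ + (w + 1)⁻¹ = (z + 1) * ((z - w) * (w + 1))⁻¹ := by
      field_simp; ring
    have q2 : (w + 1)⁻¹ - (z + w)⁻¹ = (z - 1) * ((z + w) * (w + 1))⁻¹ := by
      field_simp; ring
    have r1 := hq _ p1 f1 f1'
    have r2 := hq _ p2 f2 f2'
    have hn : ‖G w‖ ≤ ‖z + 1‖ * (‖z - w‖ * ‖w + 1‖)⁻¹ * ‖P‖ +
        ‖z - 1‖ * (‖z + w‖ * ‖w + 1‖)⁻¹ * ‖Q‖ := by
      rw [hG]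
      simp only
      rw [q1, q2]
      refine (norm_add_le _ _).trans ?_
      rw [norm_smul, norm_smul, norm_mul, norm_mul, norm_inv, norm_inv, norm_mul, norm_mul]
    calc ‖G w‖ * (1 + ‖w‖ ^ 2) ≤ _ := mul_le_mul_of_nonneg_right hn (by positivity)
      _ = ‖z + 1‖ * ‖P‖ * ((‖z - w‖ * ‖w + 1‖)⁻¹ * (1 + ‖w‖ ^ 2)) +
        ‖z - 1‖ * ‖Q‖ * ((‖z + w‖ * ‖w + 1‖)⁻¹ * (1 + ‖w‖ ^ 2)) := by ring
      _ ≤ ‖z + 1‖ * ‖P‖ * ((δ * ‖z‖)⁻¹ + δ⁻¹) + ‖z - 1‖ * ‖Q‖ * ((δ * ‖z‖)⁻¹ + δ⁻¹) := by gcongr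
      _ = _ := by ring
  have hτ : ∀ s : ℝ, 0 < s → ∀ τ ∈ Icc (-ν) ν,
      ‖(s : ℂ) * Complex.exp (τ * Complex.I)‖ * Real.cos ν ≤
        ((s : ℂ) * Complex.exp (τ * Complex.I)).re := by
    intro s hs τ hτ
    rw [ray_point_re, norm_ray hs, ← Real.cos_abs τ]
    exact mul_le_mul_of_nonneg_left (Real.cos_le_cos_of_nonneg_of_le_pi (abs_nonneg _)
      (by linarith) (abs_le.2 hτ)) hs.le
  exact ray_rotate hU hg (by linarith) (fun s hs τ h => (key _ (hτ s hs τ h)).1)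
    (fun s hs τ h => by
      have := (key _ (hτ s hs τ h)).2
      rwa [norm_ray hs] at this)

/-- The sectorial calculus of the kernel `ker z`. -/
theorem integral_ker_smul_resolvent {a : 𝔸} {ν₁ ν β K : ℝ} (h0 : 0 < ν₁) (h1 : ν₁ < ν)
    (hνβ : ν < β) (h2 : β < Real.pi / 2) (hL : leftRegion ν₁ ⊆ resolventSet ℂ a)
    (hK : ∀ w ∈ leftRegion ν₁, ‖w‖ * ‖resolvent a w‖ ≤ K) {z : ℂ}
    (hz : z ≠ 0) (hre : z.re = ‖z‖ * Real.cos β)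
    (hint : Integrable fun t => deriv (sectorBoundary ν) t •
      (ker z (sectorBoundary ν t) • resolvent a (sectorBoundary ν t))) :
    ∫ t, deriv (sectorBoundary ν) t •
      (ker z (sectorBoundary ν t) • resolvent a (sectorBoundary ν t)) =
      (2 * Real.pi * Complex.I) • kerOp a z := by
  have hz0 : 0 < ‖z‖ := norm_pos_iff.2 hz
  have hcβ : 0 < Real.cos β := Real.cos_pos_of_mem_Ioo ⟨by linarith, h2⟩
  have hcν₁ : 0 < Real.cos ν₁ := Real.cos_pos_of_mem_Ioo ⟨by linarith, by linarith⟩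
  have hzL : z ∈ resolventSet ℂ a :=
    hL (ray_mem_leftRegion h0.le (h1.trans hνβ) (by linarith) hz hre.le)
  have hzL' : -z ∈ resolventSet ℂ a := by
    refine hL ?_
    change (-z).re < ‖-z‖ * Real.cos ν₁
    rw [Complex.neg_re, norm_neg, hre]
    nlinarith [mul_pos hz0 hcβ, mul_pos hz0 hcν₁]
  obtain ⟨M, hM⟩ : ∃ M : 𝔸, kerOp a z = a * M := ⟨_, kerOp_eq hzL hzL'⟩
  obtain ⟨l1, l2, l3⟩ := integral_rays_left h0 h1 (hνβ.trans h2) hL hK M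
  obtain ⟨r1, r2, r3⟩ := integral_rays_right (h0.trans h1) hνβ h2 hz hre (resolvent a z)
    (resolvent a (-z))
  obtain ⟨u1, u2, u3⟩ := integral_rays_unitKer (h0.trans h1) (hνβ.trans h2)
  -- The integrand is cut into a part holomorphic outside the sector, a part holomorphic inside it,
  -- and the correction `unitKer p • kerOp a z` compensating the inserted terms. The first two
  -- integrate to zero, the third to `2πi kerOp a z`.
  have hdec : ∀ p : ℂ, ‖p‖ * Real.cos ν = p.re → p ≠ 0 →
      ker z p • resolvent a p =
        (fun w : ℂ => resolvent a w * (a * M) - (w - 1)⁻¹ • (a * M)) p +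
        (fun w : ℂ => ((z - w)⁻¹ + (w + 1)⁻¹) • resolvent a z +
          ((w + 1)⁻¹ - (z + w)⁻¹) • resolvent a (-z)) p + unitKer p • kerOp a z := by
    intro p hp hp0
    have hpL := hL (ray_mem_leftRegion h0.le h1 (by linarith) hp0 hp.ge)
    obtain ⟨n1, n2, -⟩ := norm_ker_le (angleConst_nonneg (h0.trans h1).le hνβ le_rfl h2)
      (angleConst_lt_one (h0.trans h1).le hνβ le_rfl h2) hz
      (abs_re_mul_conj_le (h0.trans h1).le hνβ le_rfl le_rfl h2 hz hre hp.le)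
    rw [ker_smul_resolvent hpL hzL hzL' n1 n2]
    simp only
    rw [← hM, unitKer]
    simp only [kerOp, smul_add, sub_smul, add_smul]
    abel
  have hray : ∀ φ : ℝ, Real.cos φ = Real.cos ν → ∀ s ∈ Ioi (0 : ℝ),
      Complex.exp (φ * Complex.I) • (ker z (s * Complex.exp (φ * Complex.I)) •
        resolvent a (s * Complex.exp (φ * Complex.I))) =
      Complex.exp (φ * Complex.I) • (fun w : ℂ => resolvent a w * (a * M) -
          (w - 1)⁻¹ • (a * M)) (s * Complex.exp (φ * Complex.I)) +
        Complex.exp (φ * Complex.I) • (fun w : ℂ => ((z - w)⁻¹ + (w + 1)⁻¹) • resolvent a z +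
          ((w + 1)⁻¹ - (z + w)⁻¹) • resolvent a (-z)) (s * Complex.exp (φ * Complex.I)) +
        (Complex.exp (φ * Complex.I) • unitKer (s * Complex.exp (φ * Complex.I))) •
          kerOp a z := by
    intro φ hφ s hs
    rw [hdec (s * Complex.exp (φ * Complex.I))
      (by rw [ray_point_re, norm_ray hs, hφ])
      (by rw [← norm_pos_iff, norm_ray hs]; exact hs), smul_add, smul_add, smul_assoc]
  rw [integral_sectorBoundary (g := fun w => ker z w • resolvent a w) hint, exp_neg_eq,
    setIntegral_congr_fun measurableSet_Ioi (hray (-ν) (Real.cos_neg ν)),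
    setIntegral_congr_fun measurableSet_Ioi (hray ν rfl),
    integral_add_add l1 r1 (u1.smul_const _), integral_add_add l2 r2 (u2.smul_const _), l3, r3, integral_smul_const, integral_smul_const,
    add_sub_add_left_eq_sub, ← sub_smul, u3]

end Algebra

/-! ### Products of resolvents -/

section Products

variable {X : Type*} [NormedAddCommGroup X] [NormedSpace ℂ X]

lemma resolventProd_succ {n : ℕ} (A : Fin (n + 1) → X →L[ℂ] X) (z : Fin (n + 1) → ℂ) :
    resolventProd A z = resolvent (A 0) (z 0) *
      resolventProd (fun j => A j.succ) (fun j => z j.succ) := by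
  simp [resolventProd, List.ofFn_succ]

lemma commute_resolvent {a b : X →L[ℂ] X} (h : Commute a b) (z w : ℂ) :
    Commute (resolvent a z) (resolvent b w) := by
  refine Commute.ringInverse_ringInverse ?_
  exact (Algebra.commute_algebraMap_left z _).sub_left
    ((Algebra.commute_algebraMap_right w a).sub_right h)

/-- The product of resolvents is ordered; commutation of the tuple allows any chosen factor to be
pulled to the front. -/
lemma resolventProd_succAbove {n : ℕ} (A : Fin (n + 1) → X →L[ℂ] X)
    (hA : ∀ i j, Commute (A i) (A j)) (i : Fin (n + 1)) (z : Fin (n + 1) → ℂ) :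
    resolventProd A z = resolvent (A i) (z i) *
      resolventProd (fun j => A (i.succAbove j)) (fun j => z (i.succAbove j)) := by
  induction n with
  | zero =>
    obtain rfl : i = 0 := Fin.fin_one_eq_zero i
    rw [resolventProd_succ]
    simp [resolventProd]
  | succ n ih =>
    refine Fin.cases ?_ (fun k => ?_) i
    · rw [resolventProd_succ]
      simp [Fin.zero_succAbove]
    · rw [resolventProd_succ, ih (fun j => A j.succ) (fun _ _ => hA _ _) k (fun j => z j.succ),
        resolventProd_succ (fun j => A (k.succ.succAbove j))]
      simp only [Fin.succ_succAbove_zero, Fin.succ_succAbove_succ]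
      rw [← mul_assoc, ← mul_assoc, (commute_resolvent (hA 0 k.succ) _ _).eq]

lemma norm_resolventProd_le {n : ℕ} (A : Fin n → X →L[ℂ] X) (z : Fin n → ℂ) :
    ‖resolventProd A z‖ ≤ ∏ i, ‖resolvent (A i) (z i)‖ := by
  induction n with
  | zero =>
    simp only [resolventProd, List.ofFn_zero, List.prod_nil, Finset.univ_eq_empty,
      Finset.prod_empty]
    exact ContinuousLinearMap.norm_id_le
  | succ n ih =>
    rw [resolventProd_succ, Fin.prod_univ_succ]
    exact (norm_mul_le _ _).trans (mul_le_mul_of_nonneg_left (ih _ _) (norm_nonneg _))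

lemma continuousOn_resolventProd [CompleteSpace X] {n : ℕ} (A : Fin n → X →L[ℂ] X) :
    ContinuousOn (resolventProd A) (prodDomain fun i => resolventSet ℂ (A i)) := by
  induction n with
  | zero => exact (continuous_of_const fun x y => by simp [resolventProd]).continuousOn
  | succ n ih =>
    have : resolventProd A = fun z => resolvent (A 0) (z 0) *
        resolventProd (fun j => A j.succ) (fun j => z j.succ) :=
      funext fun z => resolventProd_succ A z
    rw [this]
    refine ContinuousOn.mul ?_ ?_
    · exact (differentiableOn_resolvent (A 0)).continuousOn.comp (by fun_prop)
        fun z hz => hz 0 (mem_univ _)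
    · exact (ih (fun j => A j.succ)).comp (f := fun (z : Fin (n + 1) → ℂ) (j : Fin n) => z j.succ)
        (by fun_prop) fun z hz j _ => hz j.succ (mem_univ _)

/-! ### Splitting off one variable -/

lemma insertNth_mem_prodDomain {n : ℕ} {D : Fin (n + 1) → Set ℂ} {i : Fin (n + 1)} {w : ℂ}
    {ζ : Fin n → ℂ} : (i.insertNth w ζ : Fin (n + 1) → ℂ) ∈ prodDomain D ↔
      w ∈ D i ∧ ζ ∈ prodDomain fun j => D (i.succAbove j) := by
  simp [prodDomain, Set.mem_pi, Fin.forall_iff_succAbove i]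

lemma isOpen_prodDomain {n : ℕ} {D : Fin n → Set ℂ} (hD : ∀ i, IsOpen (D i)) :
    IsOpen (prodDomain D) := isOpen_set_pi finite_univ fun i _ => hD i

/-- The measure on the parameter space of a product of curves. -/
def paramMeasure {n : ℕ} (S : Fin n → Set ℝ) : Measure (Fin n → ℝ) :=
  Measure.pi fun i => volume.restrict (S i)

instance {n : ℕ} (S : Fin n → Set ℝ) : SigmaFinite (paramMeasure S) := by
  unfold paramMeasure; infer_instance

/-- The density `∏ᵢ cᵢ'(tᵢ)` of a product of curves. -/
def curveDeriv {n : ℕ} (c : Fin n → ℝ → ℂ) (t : Fin n → ℝ) : ℂ := ∏ i, deriv (c i) (t i)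

/-- The point `(cᵢ(tᵢ))ᵢ` of a product of curves. -/
def curvePt {n : ℕ} (c : Fin n → ℝ → ℂ) (t : Fin n → ℝ) : Fin n → ℂ := fun i => c i (t i)

lemma measurable_curveDeriv {n : ℕ} (c : Fin n → ℝ → ℂ) : Measurable (curveDeriv c) :=
  Finset.measurable_fun_prod _ fun i _ => (measurable_deriv (c i)).comp (measurable_pi_apply i)

lemma contourIntegral_succAbove {n : ℕ} {E : Type*} [NormedAddCommGroup E] [NormedSpace ℂ E]
    (S : Fin (n + 1) → Set ℝ) (c : Fin (n + 1) → ℝ → ℂ) (F : (Fin (n + 1) → ℂ) → E)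
    (i : Fin (n + 1)) :
    contourIntegral S c F =
      ∫ p, (deriv (c i) p.1 * curveDeriv (fun j => c (i.succAbove j)) p.2) •
        F (i.insertNth (c i p.1) (curvePt (fun j => c (i.succAbove j)) p.2))
        ∂((volume.restrict (S i)).prod (paramMeasure fun j => S (i.succAbove j))) := by
  rw [contourIntegral, volume_pi, Measure.restrict_pi_pi]
  rw [paramMeasure, ← (measurePreserving_piFinSuccAbove
    (fun i => (volume : Measure ℝ).restrict (S i)) i).integral_comp'
    (f := MeasurableEquiv.piFinSuccAbove (fun _ => ℝ) i)]
  refine integral_congr_ae (.of_forall fun t => ?_)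
  simp only [MeasurableEquiv.piFinSuccAbove, curveDeriv]
  rw [Fin.prod_univ_succAbove _ i]
  congr 2
  funext k
  refine Fin.succAboveCases i ?_ (fun j => ?_) k
  · simp only [Fin.insertNth_apply_same]; rfl
  · simp only [Fin.insertNth_apply_succAbove]; rfl

/-- The curve `c : S → ℂ` in `D` avoids the spectrum of `a`, and the resolvent of `a` is
controlled by `1 / |z|` along it. -/
def Admissible (a : X →L[ℂ] X) (D : Set ℂ) (S : Set ℝ) (c : ℝ → ℂ) : Prop :=
  ∃ V : Set ℂ, IsOpen V ∧ V ⊆ D ∧ V ⊆ resolventSet ℂ a ∧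
    (∃ K : ℝ, ∀ z ∈ V, ‖resolvent a z‖ ≤ K / ‖z‖) ∧ IsDecayContour V S c

variable {n : ℕ} {A : Fin n → X →L[ℂ] X} {D : Fin n → Set ℂ} {S : Fin n → Set ℝ}
  {c : Fin n → ℝ → ℂ}

lemma measurable_curvePt (hc : ∀ i, Measurable (c i)) : Measurable (curvePt c) :=
  measurable_pi_lambda _ fun i => (hc i).comp (measurable_pi_apply i)

lemma ae_curvePt_mem {V : Fin n → Set ℂ} (h : ∀ i, ∀ᵐ t ∂volume.restrict (S i), c i t ∈ V i) :
    ∀ᵐ t ∂paramMeasure S, curvePt c t ∈ prodDomain V := by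
  have : ∀ᵐ t ∂paramMeasure S, ∀ i, c i (t i) ∈ V i :=
    ae_all_iff.2 fun i => (Measure.tendsto_eval_ae_ae (μ := fun i => volume.restrict (S i))).eventually (h i)
  filter_upwards [this] with t ht i _ using ht i

lemma ae_curvePt_mem_of_admissible (h : ∀ i, Admissible (A i) (D i) (S i) (c i)) :
    ∀ᵐ t ∂paramMeasure S, curvePt c t ∈ prodDomain D :=
  ae_curvePt_mem fun i => by
    obtain ⟨V, -, hVD, -, -, hc⟩ := h i
    exact hc.mem.mono fun t ht => hVD ht

lemma aestronglyMeasurable_resolventProd [CompleteSpace X]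
    (h : ∀ i, Admissible (A i) (D i) (S i) (c i)) :
    AEStronglyMeasurable (fun t => resolventProd A (curvePt c t)) (paramMeasure S) := by
  refine aestronglyMeasurable_comp_of_continuousOn
    (isOpen_prodDomain fun i => spectrum.isOpen_resolventSet (A i))
    (continuousOn_resolventProd A) (measurable_curvePt fun i => ?_) (ae_curvePt_mem fun i => ?_)
  · obtain ⟨V, -, -, -, -, hc⟩ := h i
    exact hc.measurable
  · obtain ⟨V, -, -, hV, -, hc⟩ := h i
    exact hc.mem.mono fun t ht => hV ht

/-- Each resolvent is bounded by `K i / ‖z‖` along its curve, so the integrand is dominated by a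
product of integrable functions of one variable each. -/
lemma integrable_weight [CompleteSpace X] (h : ∀ i, Admissible (A i) (D i) (S i) (c i)) {s : ℝ}
    (hs : 0 < s) : Integrable (fun t => ‖curveDeriv c t‖ * (∏ i, wt s ‖c i (t i)‖) *
      ‖resolventProd A (curvePt c t)‖) (paramMeasure S) := by
  have h' := h
  choose V hVo hVD hVr hK hc using h
  choose K hK using hK
  have hint : Integrable (fun t : Fin n → ℝ => ∏ i, (K i * (‖deriv (c i) (t i)‖ *
      (wt s ‖c i (t i)‖ / ‖c i (t i)‖)))) (paramMeasure S) :=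
    Integrable.fintype_prod (μ := fun i => volume.restrict (S i))
      (f := fun i t => K i * (‖deriv (c i) t‖ * (wt s ‖c i t‖ / ‖c i t‖)))
      fun i => ((hc i).integrable s hs).const_mul (K i)
  refine hint.mono' ?_ ?_
  · refine (((measurable_curveDeriv c).norm.mul ?_).aestronglyMeasurable).mul
      (aestronglyMeasurable_resolventProd h').norm
    exact Finset.measurable_fun_prod _ fun i _ => (measurable_wt s).comp
      (((hc i).measurable.comp (measurable_pi_apply i)).norm)
  · filter_upwards [ae_curvePt_mem (V := V) fun i => (hc i).mem] with t ht
    have hw : ∀ i, 0 ≤ wt s ‖c i (t i)‖ := fun i => wt_nonneg (norm_nonneg _) s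
    rw [Real.norm_of_nonneg (mul_nonneg (mul_nonneg (norm_nonneg _)
      (Finset.prod_nonneg fun i _ => hw i)) (norm_nonneg _)), curveDeriv, norm_prod,
      ← Finset.prod_mul_distrib]
    refine (mul_le_mul_of_nonneg_left (norm_resolventProd_le A _)
      (Finset.prod_nonneg fun i _ => mul_nonneg (norm_nonneg _) (hw i))).trans ?_
    rw [← Finset.prod_mul_distrib]
    refine Finset.prod_le_prod (fun i _ => by have := hw i; positivity) fun i _ => ?_
    have := hK i (c i (t i)) (ht i (mem_univ _))
    calc ‖deriv (c i) (t i)‖ * wt s ‖c i (t i)‖ * ‖resolvent (A i) (curvePt c t i)‖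
        ≤ ‖deriv (c i) (t i)‖ * wt s ‖c i (t i)‖ * (K i / ‖c i (t i)‖) :=
          mul_le_mul_of_nonneg_left this (mul_nonneg (norm_nonneg _) (hw i))
      _ = _ := by ring

/-- Integrability of the contour integrand after splitting off one variable, for which the
resolvent may be replaced by another operator function `H`. -/
lemma integrable_split [CompleteSpace X] (h : ∀ i, Admissible (A i) (D i) (S i) (c i)) {s C : ℝ}
    (hs : 0 < s) {i : Fin (n + 1)} {V : Set ℂ} (hV : IsOpen V) (hD : ∀ j, IsOpen (D j))
    {S₀ : Set ℝ} {b : ℝ → ℂ} (hb : Measurable b) (hbV : ∀ᵐ t ∂volume.restrict S₀, b t ∈ V)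
    {H : ℂ → X →L[ℂ] X} (hH : ContinuousOn H V) {f : (Fin (n + 1) → ℂ) → ℂ}
    {k : ℂ → ℝ}
    (hf : ContinuousOn (fun p : ℂ × (Fin n → ℂ) => f (i.insertNth p.1 p.2)) (V ×ˢ prodDomain D))
    (hk : IntegrableOn (fun t => ‖deriv b t‖ * (k (b t) * ‖H (b t)‖)) S₀)
    (hfk : ∀ z ∈ V, ∀ ζ ∈ prodDomain D,
      ‖f (i.insertNth z ζ)‖ ≤ C * (k z * ∏ j, wt s ‖ζ j‖)) :
    Integrable (fun p : ℝ × (Fin n → ℝ) => (deriv b p.1 * curveDeriv c p.2) •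
      (f (i.insertNth (b p.1) (curvePt c p.2)) • (H (b p.1) * resolventProd A (curvePt c p.2))))
      ((volume.restrict S₀).prod (paramMeasure S)) := by
  have hmem : ∀ᵐ p ∂((volume.restrict S₀).prod (paramMeasure S)),
      b p.1 ∈ V ∧ curvePt c p.2 ∈ prodDomain D :=
    (Measure.quasiMeasurePreserving_fst.ae hbV).and
      (Measure.quasiMeasurePreserving_snd.ae (ae_curvePt_mem_of_admissible h))
  have hcm : ∀ j, Measurable (c j) := fun j => by
    obtain ⟨V, -, -, -, -, hc⟩ := h j
    exact hc.measurable
  refine Integrable.mono' ((hk.mul_prod (integrable_weight h hs)).const_mul C) ?_ ?_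
  · have m1 : AEStronglyMeasurable (fun p : ℝ × (Fin n → ℝ) => deriv b p.1 * curveDeriv c p.2)
        ((volume.restrict S₀).prod (paramMeasure S)) :=
      (((measurable_deriv b).comp measurable_fst).mul
        ((measurable_curveDeriv c).comp measurable_snd)).aestronglyMeasurable
    have m2 := aestronglyMeasurable_comp_of_continuousOn (hV.prod (isOpen_prodDomain hD)) hf
        (c := fun p : ℝ × (Fin n → ℝ) => (b p.1, curvePt c p.2))
        ((hb.comp measurable_fst).prodMk ((measurable_curvePt hcm).comp measurable_snd)) hmem
    have m3 := aestronglyMeasurable_comp_of_continuousOn hV hH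
      (c := fun p : ℝ × (Fin n → ℝ) => b p.1) (hb.comp measurable_fst)
        (hmem.mono fun p hp => hp.1)
    have m4 : AEStronglyMeasurable (fun p : ℝ × (Fin n → ℝ) => resolventProd A (curvePt c p.2))
        ((volume.restrict S₀).prod (paramMeasure S)) :=
      (aestronglyMeasurable_resolventProd h).comp_snd
    exact m1.smul (m2.smul (m3.mul m4))
  · filter_upwards [hmem] with p hp
    rw [norm_smul, norm_smul, norm_mul]
    calc ‖deriv b p.1‖ * ‖curveDeriv c p.2‖ * (‖f (i.insertNth (b p.1) (curvePt c p.2))‖ *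
          ‖H (b p.1) * resolventProd A (curvePt c p.2)‖)
        ≤ ‖deriv b p.1‖ * ‖curveDeriv c p.2‖ * ((C * (k (b p.1) * ∏ j, wt s ‖curvePt c p.2 j‖)) *
          (‖H (b p.1)‖ * ‖resolventProd A (curvePt c p.2)‖)) := by
          have h1 := hfk _ hp.1 _ hp.2
          have h2 := norm_mul_le (H (b p.1)) (resolventProd A (curvePt c p.2))
          exact mul_le_mul_of_nonneg_left (mul_le_mul h1 h2 (norm_nonneg _)
            ((norm_nonneg _).trans h1)) (by positivity)
      _ = _ := by simp only [curvePt]; ring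

end Products

/-! ### Functions with decay on products of plane domains -/

/-- `f` is bounded, holomorphic and decays at `0` and at infinity on `∏ᵢ D i`. -/
def IsHZero {n : ℕ} (D : Fin n → Set ℂ) (f : (Fin n → ℂ) → ℂ) : Prop :=
  IsHInfty (prodDomain D) f ∧ ∃ C s : ℝ, 0 < C ∧ 0 < s ∧
    ∀ z ∈ prodDomain D, ‖f z‖ ≤ C * ∏ i, wt s ‖z i‖

section HZero

variable {n : ℕ}

lemma norm_le_supNorm {D : Set (Fin n → ℂ)} {f : (Fin n → ℂ) → ℂ} (hf : IsHInfty D f)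
    {z : Fin n → ℂ} (hz : z ∈ D) : ‖f z‖ ≤ supNorm D f := by
  obtain ⟨-, M, hM⟩ := hf
  refine le_csSup ⟨M, ?_⟩ (mem_image_of_mem _ hz)
  rintro _ ⟨y, hy, rfl⟩
  exact hM y hy

lemma supNorm_nonneg (D : Set (Fin n → ℂ)) (f : (Fin n → ℂ) → ℂ) : 0 ≤ supNorm D f := by
  refine Real.sSup_nonneg ?_
  rintro _ ⟨y, -, rfl⟩
  exact norm_nonneg _

lemma supNorm_le {D : Set (Fin n → ℂ)} {f : (Fin n → ℂ) → ℂ} {M : ℝ} (hM : 0 ≤ M)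
    (h : ∀ z ∈ D, ‖f z‖ ≤ M) : supNorm D f ≤ M := by
  refine Real.sSup_le ?_ hM
  rintro _ ⟨y, hy, rfl⟩
  exact h y hy

lemma IsHZero.mono {D D' : Fin n → Set ℂ} {f : (Fin n → ℂ) → ℂ} (hf : IsHZero D f)
    (h : ∀ i, D' i ⊆ D i) : IsHZero D' f := by
  obtain ⟨⟨hd, M, hM⟩, C, s, hC, hs, hb⟩ := hf
  have hsub : prodDomain D' ⊆ prodDomain D := pi_mono fun i _ => h i
  exact ⟨⟨hd.mono hsub, M, fun z hz => hM z (hsub hz)⟩, C, s, hC, hs, fun z hz => hb z (hsub hz)⟩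

lemma differentiable_insertNth_left (i : Fin (n + 1)) (ζ : Fin n → ℂ) :
    Differentiable ℂ fun z : ℂ => (i.insertNth z ζ : Fin (n + 1) → ℂ) := by
  rw [differentiable_pi]
  intro k
  refine Fin.succAboveCases i ?_ (fun j => ?_) k
  · simp
  · simp

lemma continuous_insertNth (i : Fin (n + 1)) :
    Continuous fun p : ℂ × (Fin n → ℂ) => (i.insertNth p.1 p.2 : Fin (n + 1) → ℂ) := by
  refine continuous_pi fun k => ?_
  refine Fin.succAboveCases i ?_ (fun j => ?_) k
  · simpa using continuous_fst
  · simp only [Fin.insertNth_apply_succAbove]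
    exact (continuous_apply j).comp continuous_snd

variable {D : Fin (n + 1) → Set ℂ} {f : (Fin (n + 1) → ℂ) → ℂ}

lemma differentiableOn_insertNth (hf : DifferentiableOn ℂ f (prodDomain D)) (i : Fin (n + 1))
    {ζ : Fin n → ℂ} (hζ : ζ ∈ prodDomain fun j => D (i.succAbove j)) :
    DifferentiableOn ℂ (fun z => f (i.insertNth z ζ)) (D i) :=
  hf.comp (differentiable_insertNth_left i ζ).differentiableOn
    fun _ hz => insertNth_mem_prodDomain.2 ⟨hz, hζ⟩

lemma continuousOn_insertNth (hf : DifferentiableOn ℂ f (prodDomain D)) (i : Fin (n + 1)) :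
    ContinuousOn (fun p : ℂ × (Fin n → ℂ) => f (i.insertNth p.1 p.2))
      (D i ×ˢ prodDomain fun j => D (i.succAbove j)) :=
  hf.continuousOn.comp (continuous_insertNth i).continuousOn
    fun _ hp => insertNth_mem_prodDomain.2 hp

lemma decay_insertNth {C s : ℝ} (hb : ∀ z ∈ prodDomain D, ‖f z‖ ≤ C * ∏ i, wt s ‖z i‖)
    (i : Fin (n + 1)) {z : ℂ} (hz : z ∈ D i) {ζ : Fin n → ℂ}
    (hζ : ζ ∈ prodDomain fun j => D (i.succAbove j)) :
    ‖f (i.insertNth z ζ)‖ ≤ C * (wt s ‖z‖ * ∏ j, wt s ‖ζ j‖) := by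
  have := hb _ (insertNth_mem_prodDomain.2 ⟨hz, hζ⟩)
  rw [Fin.prod_univ_succAbove _ i] at this
  simpa using this

end HZero

/-! ### Replacing contours one variable at a time. -/

section Swap

lemma resolventProd_insertNth {X : Type*} [NormedAddCommGroup X] [NormedSpace ℂ X] {n : ℕ}
    {A : Fin (n + 1) → X →L[ℂ] X} (hA : ∀ i j, Commute (A i) (A j)) (i : Fin (n + 1)) (z : ℂ)
    (ζ : Fin n → ℂ) : resolventProd A (i.insertNth z ζ) = resolvent (A i) z *
      resolventProd (fun j => A (i.succAbove j)) ζ := by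
  rw [resolventProd_succAbove A hA i]
  simp

variable {X : Type*} [NormedAddCommGroup X] [NormedSpace ℂ X] [CompleteSpace X]
  {n : ℕ} {A : Fin (n + 1) → X →L[ℂ] X} {D : Fin (n + 1) → Set ℂ}
  {S S' : Fin (n + 1) → Set ℝ} {c c' : Fin (n + 1) → ℝ → ℂ} {f : (Fin (n + 1) → ℂ) → ℂ}

lemma integrable_contour_split (hD : ∀ i, IsOpen (D i))
    (h : ∀ i, Admissible (A i) (D i) (S i) (c i)) (hf : IsHZero D f) (i : Fin (n + 1)) :
    Integrable (fun p : ℝ × (Fin n → ℝ) =>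
      (deriv (c i) p.1 * curveDeriv (fun j => c (i.succAbove j)) p.2) •
      (f (i.insertNth (c i p.1) (curvePt (fun j => c (i.succAbove j)) p.2)) •
        (resolvent (A i) (c i p.1) * resolventProd (fun j => A (i.succAbove j))
          (curvePt (fun j => c (i.succAbove j)) p.2))))
      ((volume.restrict (S i)).prod (paramMeasure fun j => S (i.succAbove j))) := by
  obtain ⟨⟨hd, -⟩, C, s, hC, hs, hb⟩ := hf
  obtain ⟨V, hVo, hVD, hVr, ⟨K, hK⟩, hc⟩ := h i
  refine integrable_split (fun j => h (i.succAbove j)) hs (V := V) (k := fun z => wt s ‖z‖)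
    (C := C) hVo (fun j => hD _) hc.measurable hc.mem
    ((differentiableOn_resolvent (A i)).continuousOn.mono hVr)
    ((continuousOn_insertNth hd i).mono (prod_mono_left hVD)) ?_
    (fun z hz ζ hζ => decay_insertNth hb i (hVD hz) hζ)
  refine ((hc.integrable s hs).const_mul K).mono' ?_ ?_
  · have m1 := aestronglyMeasurable_comp_of_continuousOn hVo
      ((differentiableOn_resolvent (A i)).continuousOn.mono hVr) hc.measurable hc.mem
    exact (measurable_deriv (c i)).norm.aestronglyMeasurable.mul
      (((measurable_wt s).comp hc.measurable.norm).aestronglyMeasurable.mul m1.norm)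
  · filter_upwards [hc.mem] with t ht
    have hw := wt_nonneg (norm_nonneg (c i t)) s
    rw [Real.norm_of_nonneg (by positivity)]
    calc ‖deriv (c i) t‖ * (wt s ‖c i t‖ * ‖resolvent (A i) (c i t)‖)
        ≤ ‖deriv (c i) t‖ * (wt s ‖c i t‖ * (K / ‖c i t‖)) := by gcongr; exact hK _ ht
      _ = _ := by ring

/-- The contour integral as an iterated integral, the integral over one variable being the inner
one. -/
lemma contourIntegral_eq_iterated (hA : ∀ i j, Commute (A i) (A j)) (hD : ∀ i, IsOpen (D i))
    (h : ∀ i, Admissible (A i) (D i) (S i) (c i)) (hf : IsHZero D f) (i : Fin (n + 1)) :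
    contourIntegral S c (fun z => f z • resolventProd A z) =
      ∫ τ, curveDeriv (fun j => c (i.succAbove j)) τ • (∫ t in S i, deriv (c i) t •
        (f (i.insertNth (c i t) (curvePt (fun j => c (i.succAbove j)) τ)) •
        (resolvent (A i) (c i t) * resolventProd (fun j => A (i.succAbove j))
          (curvePt (fun j => c (i.succAbove j)) τ))))
        ∂(paramMeasure fun j => S (i.succAbove j)) := by
  rw [contourIntegral_succAbove S c _ i]
  simp_rw [resolventProd_insertNth hA]
  rw [integral_prod_symm _ (integrable_contour_split hD h hf i)]
  refine integral_congr_ae (.of_forall fun τ => ?_)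
  simp only
  rw [← integral_smul]
  refine integral_congr_ae (.of_forall fun t => ?_)
  simp only
  rw [mul_comm, mul_smul]

/-- One of the curves of a contour integral may be replaced by a curve over which the integrals of
holomorphic functions with decay are the same. -/
theorem contourIntegral_replace (hA : ∀ i j, Commute (A i) (A j)) (hD : ∀ i, IsOpen (D i))
    (h : ∀ i, Admissible (A i) (D i) (S i) (c i)) (h' : ∀ i, Admissible (A i) (D i) (S' i) (c' i))
    (hf : IsHZero D f) (i : Fin (n + 1)) (hS : ∀ j, S' (i.succAbove j) = S (i.succAbove j))
    (hc : ∀ j, c' (i.succAbove j) = c (i.succAbove j))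
    {U : Set ℂ} (hUD : U ⊆ D i) (hUr : U ⊆ resolventSet ℂ (A i)) {K : ℝ}
    (hUK : ∀ z ∈ U, ‖resolvent (A i) z‖ ≤ K / ‖z‖)
    (hint : ∀ (g : ℂ → X →L[ℂ] X) (M ε : ℝ), 0 ≤ M → 0 < ε → DifferentiableOn ℂ g U →
      (∀ z ∈ U, ‖g z‖ ≤ M * (wt ε ‖z‖ / ‖z‖)) →
      ∫ t in S i, deriv (c i) t • g (c i t) = ∫ t in S' i, deriv (c' i) t • g (c' i t)) :
    contourIntegral S c (fun z => f z • resolventProd A z) =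
      contourIntegral S' c' (fun z => f z • resolventProd A z) := by
  rw [contourIntegral_eq_iterated hA hD h hf i, contourIntegral_eq_iterated hA hD h' hf i]
  simp_rw [hS, hc]
  refine integral_congr_ae ?_
  obtain ⟨⟨hd, -⟩, C, s, hC, hs, hb⟩ := hf
  filter_upwards [ae_curvePt_mem_of_admissible (fun j => h (i.succAbove j))] with τ hτ
  set ζ := curvePt (fun j => c (i.succAbove j)) τ
  set Q := resolventProd (fun j => A (i.succAbove j)) ζ
  congr 1
  have hw : 0 ≤ ∏ j, wt s ‖ζ j‖ := Finset.prod_nonneg fun j _ => wt_nonneg (norm_nonneg _) s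
  -- The bound handed over has to be nonnegative, whereas `K` may be negative when `U` is empty;
  -- hence `max K 0`.
  refine hint (fun z => f (i.insertNth z ζ) • (resolvent (A i) z * Q))
    (C * (∏ j, wt s ‖ζ j‖) * (max K 0) * ‖Q‖) s (by positivity) hs ?_ ?_
  · exact ((differentiableOn_insertNth hd i hτ).mono hUD).smul
      (((differentiableOn_resolvent (A i)).mono hUr).mul_const Q)
  · intro z hz
    rw [norm_smul]
    have h1 := decay_insertNth hb i (hUD hz) hτ
    have h2 : ‖resolvent (A i) z * Q‖ ≤ (max K 0) / ‖z‖ * ‖Q‖ := by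
      refine (norm_mul_le _ _).trans (mul_le_mul_of_nonneg_right ((hUK z hz).trans ?_)
        (norm_nonneg _))
      gcongr
      exact le_max_left _ _
    calc _ ≤ (C * (wt s ‖z‖ * ∏ j, wt s ‖ζ j‖)) * ((max K 0) / ‖z‖ * ‖Q‖) :=
          mul_le_mul h1 h2 (norm_nonneg _) ((norm_nonneg _).trans h1)
      _ = _ := by ring

end Swap

section ReplaceAll

variable {X : Type*} [NormedAddCommGroup X] [NormedSpace ℂ X] [CompleteSpace X]

/-- All the curves of a contour integral may be replaced by curves over which the integrals of
holomorphic functions with decay are the same. -/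
theorem contourIntegral_replace_all {n : ℕ} {A : Fin n → X →L[ℂ] X} {D : Fin n → Set ℂ}
    {S S' : Fin n → Set ℝ} {c c' : Fin n → ℝ → ℂ} {f : (Fin n → ℂ) → ℂ}
    (hA : ∀ i j, Commute (A i) (A j)) (hD : ∀ i, IsOpen (D i))
    (h : ∀ i, Admissible (A i) (D i) (S i) (c i)) (h' : ∀ i, Admissible (A i) (D i) (S' i) (c' i))
    (hf : IsHZero D f) {U : Fin n → Set ℂ} (hUD : ∀ i, U i ⊆ D i)
    (hUr : ∀ i, U i ⊆ resolventSet ℂ (A i)) {K : Fin n → ℝ}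
    (hUK : ∀ i, ∀ z ∈ U i, ‖resolvent (A i) z‖ ≤ K i / ‖z‖)
    (hint : ∀ (i : Fin n) (g : ℂ → X →L[ℂ] X) (M ε : ℝ), 0 ≤ M → 0 < ε →
      DifferentiableOn ℂ g (U i) → (∀ z ∈ U i, ‖g z‖ ≤ M * (wt ε ‖z‖ / ‖z‖)) →
      ∫ t in S i, deriv (c i) t • g (c i t) = ∫ t in S' i, deriv (c' i) t • g (c' i t)) :
    contourIntegral S c (fun z => f z • resolventProd A z) =
      contourIntegral S' c' (fun z => f z • resolventProd A z) := by
  -- Hybrid contours, with the variables of `s` already replaced, reduce the claim to a change in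
  -- one variable.
  have key : ∀ s : Finset (Fin n), contourIntegral S c (fun z => f z • resolventProd A z) =
      contourIntegral (fun i => if i ∈ s then S' i else S i)
        (fun i => if i ∈ s then c' i else c i) (fun z => f z • resolventProd A z) := by
    intro s
    induction s using Finset.induction_on with
    | empty => simp
    | insert i s his ih =>
      rw [ih]
      cases n with
      | zero => exact i.elim0
      | succ n =>
        refine contourIntegral_replace hA hD (fun j => ?_) (fun j => ?_) hf i (fun j => ?_)
          (fun j => ?_) (hUD i) (hUr i) (hUK i) ?_
        · by_cases hj : j ∈ s
          · simpa [hj] using h' j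
          · simpa [hj] using h j
        · by_cases hj : j ∈ insert i s
          · simpa only [hj, if_true] using h' j
          · simpa only [hj, if_false] using h j
        · simp [Fin.succAbove_ne]
        · simp [Fin.succAbove_ne]
        · simpa [his] using hint i
  simpa using key Finset.univ

end ReplaceAll

/-! ### Ritt operators and the sectorial operators `1 - T` -/

lemma sin_pos_of_mem {α : ℝ} (h0 : 0 < α) (h1 : α < Real.pi / 2) : 0 < Real.sin α :=
  Real.sin_pos_of_pos_of_lt_pi h0 (by linarith [Real.pi_pos])

lemma cdstolz_mono {α β : ℝ} (h0 : 0 < α) (h : α ≤ β) (h1 : β < Real.pi / 2) :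
    cdstolz α ⊆ cdstolz β := by
  rintro w ⟨r, hr, hw⟩
  exact ⟨r, hr, hw.trans (mul_le_mul_of_nonneg_left
    (Real.sin_le_sin_of_le_of_le_pi_div_two (by linarith [Real.pi_pos]) h1.le h) hr.1)⟩

lemma dstolz_mono {α β : ℝ} (h0 : 0 < α) (h : α ≤ β) (h1 : β < Real.pi / 2) :
    dstolz α ⊆ dstolz β := by
  rintro w ⟨r, hr, hw⟩
  exact ⟨r, hr, hw.trans_le (mul_le_mul_of_nonneg_left
    (Real.sin_le_sin_of_le_of_le_pi_div_two (by linarith [Real.pi_pos]) h1.le h) hr.1.le)⟩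

lemma stolz_mono {α β : ℝ} (h0 : 0 < α) (h : α ≤ β) (h1 : β < Real.pi / 2) :
    stolz α ⊆ stolz β := fun _ hz =>
  (mem_stolz_iff (sin_pos_of_mem (h0.trans_le h) h1)).2 (dstolz_mono h0 h h1
    ((mem_stolz_iff (sin_pos_of_mem h0 (h.trans_lt h1))).1 hz))

lemma zero_mem_cdstolz (α : ℝ) : (0 : ℂ) ∈ cdstolz α := ⟨0, by simp, by simp⟩

section Ritt

variable {X : Type*} [NormedAddCommGroup X] [NormedSpace ℂ X]

lemma IsRittOfType.mono {T : X →L[ℂ] X} {α β : ℝ} (h : IsRittOfType T α) (hαβ : α ≤ β)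
    (hβ : β < Real.pi / 2) : IsRittOfType T β :=
  ⟨⟨h.1.1.trans_le hαβ, hβ⟩, h.2.1.trans (closure_mono (stolz_mono h.1.1 hαβ hβ)),
    fun ν hν => h.2.2 ν ⟨hαβ.trans_lt hν.1, hν.2⟩⟩

lemma algebraMap_sub_id_sub (T : X →L[ℂ] X) (w : ℂ) :
    algebraMap ℂ (X →L[ℂ] X) w - (ContinuousLinearMap.id ℂ X - T) =
      -(algebraMap ℂ (X →L[ℂ] X) (1 - w) - T) := by
  have : ContinuousLinearMap.id ℂ X = (1 : X →L[ℂ] X) := rfl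
  rw [this, map_sub, map_one]
  abel

lemma mem_resolventSet_id_sub {T : X →L[ℂ] X} {w : ℂ} :
    w ∈ resolventSet ℂ (ContinuousLinearMap.id ℂ X - T) ↔ 1 - w ∈ resolventSet ℂ T := by
  rw [spectrum.mem_resolventSet_iff, spectrum.mem_resolventSet_iff, algebraMap_sub_id_sub,
    IsUnit.neg_iff]

lemma ringInverse_neg {R : Type*} [Ring R] (a : R) : Ring.inverse (-a) = -Ring.inverse a := by
  by_cases h : IsUnit a
  · obtain ⟨u, rfl⟩ := h
    rw [← Units.val_neg, Ring.inverse_unit, Ring.inverse_unit, inv_neg, Units.val_neg]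
  · rw [Ring.inverse_non_unit _ h, Ring.inverse_non_unit _ (fun h' => h (IsUnit.neg_iff a |>.1 h')),
      neg_zero]

lemma resolvent_id_sub (T : X →L[ℂ] X) (w : ℂ) :
    resolvent (ContinuousLinearMap.id ℂ X - T) w = -resolvent T (1 - w) := by
  rw [resolvent, algebraMap_sub_id_sub, resolvent, ringInverse_neg]

lemma resolventProd_id_sub {n : ℕ} (T : Fin n → X →L[ℂ] X) (w : Fin n → ℂ) :
    resolventProd (fun i => ContinuousLinearMap.id ℂ X - T i) w =
      (-1 : ℂ) ^ n • resolventProd T (1 - w) := by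
  induction n with
  | zero => simp [resolventProd]
  | succ n ih =>
    rw [resolventProd_succ, resolventProd_succ, ih, resolvent_id_sub, mul_smul_comm, neg_mul,
      pow_succ, mul_neg_one, neg_smul, smul_neg]
    rfl

lemma IsRittOfType.resolvent_bound {T : X →L[ℂ] X} {α β : ℝ} (h : IsRittOfType T α) (hαβ : α < β)
    (hβ : β < Real.pi / 2) :
    (cdstolz β)ᶜ ⊆ resolventSet ℂ (ContinuousLinearMap.id ℂ X - T) ∧
      ∃ K : ℝ, ∀ w ∉ cdstolz β, ‖resolvent (ContinuousLinearMap.id ℂ X - T) w‖ ≤ K / ‖w‖ := by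
  have hα := h.1.1
  refine ⟨fun w hw => ?_, ?_⟩
  · rw [mem_resolventSet_id_sub]
    by_contra hc
    refine hw (cdstolz_mono hα hαβ.le hβ ?_)
    simpa using closure_stolz_subset (sin_pos_of_mem hα h.1.2) (h.2.1 hc)
  · obtain ⟨K, hK⟩ := (h.2.2 β ⟨hαβ, hβ⟩).exists_norm_le
    refine ⟨K, fun w hw => ?_⟩
    have hw0 : 0 < ‖w‖ := norm_pos_iff.2 fun hc => hw (hc ▸ zero_mem_cdstolz β)
    have hm : 1 - w ∈ (closure (stolz β))ᶜ := fun hc => hw (by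
      simpa using closure_stolz_subset (sin_pos_of_mem (hα.trans hαβ) hβ) hc)
    have := hK _ (mem_image_of_mem _ hm)
    rw [sub_sub_cancel, norm_smul] at this
    rw [resolvent_id_sub, norm_neg, le_div_iff₀ hw0, mul_comm]
    exact this

lemma one_sub_mem_closure_stolz {α : ℝ} (h0 : 0 < α) (h1 : α < Real.pi / 2) {w : ℂ}
    (hw : 1 - w ∈ closure (stolz α)) : w ∈ closure (sector α) := by
  have : MapsTo (fun z : ℂ => 1 - z) (stolz α) (sector α) := fun z hz =>
    dstolz_subset_sector h0 h1 ((mem_stolz_iff (sin_pos_of_mem h0 h1)).1 hz)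
  simpa using map_mem_closure (continuous_const.sub continuous_id) hw this

lemma IsRittOfType.isSectorialOfType {T : X →L[ℂ] X} {α : ℝ} (h : IsRittOfType T α) :
    IsSectorialOfType (ContinuousLinearMap.id ℂ X - T) α := by
  obtain ⟨⟨h0, h1⟩, hs, hb⟩ := h
  refine ⟨⟨h0, by linarith [Real.pi_pos]⟩, fun w hw => ?_, fun ν hν => ?_⟩
  · refine one_sub_mem_closure_stolz h0 h1 (hs ?_)
    exact fun hc => hw (mem_resolventSet_id_sub.2 hc)
  -- Ritt bounds exist only for angles below `π / 2`, while `ν` ranges up to `π`. Lowering the angle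
  -- is harmless, since the complement of a closed sector grows when its angle shrinks.
  · have hβ1 : α < min ν ((α + Real.pi / 2) / 2) := lt_min hν.1 (by linarith)
    have hβ2 : min ν ((α + Real.pi / 2) / 2) < Real.pi / 2 :=
      (min_le_right _ _).trans_lt (by linarith)
    obtain ⟨K, hK⟩ := (hb _ ⟨hβ1, hβ2⟩).exists_norm_le
    refine isBounded_iff_forall_norm_le.2 ⟨K, ?_⟩
    rintro _ ⟨w, hw, rfl⟩
    have hm : 1 - w ∈ (closure (stolz (min ν ((α + Real.pi / 2) / 2))))ᶜ := fun hc =>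
      hw (closure_mono (sector_mono (min_le_left _ _))
        (one_sub_mem_closure_stolz (h0.trans hβ1) hβ2 hc))
    have := hK _ (mem_image_of_mem _ hm)
    rw [sub_sub_cancel, norm_smul] at this
    simp only
    rwa [norm_smul, resolvent_id_sub, norm_neg]

lemma commute_id_sub {n : ℕ} {T : Fin n → X →L[ℂ] X} (h : ∀ i j, Commute (T i) (T j))
    (i j : Fin n) :
    Commute (ContinuousLinearMap.id ℂ X - T i) (ContinuousLinearMap.id ℂ X - T j) :=
  ((Commute.one_left (1 : X →L[ℂ] X)).sub_left (Commute.one_right (T i))).sub_right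
    ((Commute.one_left (T j)).sub_left (h i j))

/-! ### The calculus of a Ritt tuple as a contour integral for `1 - T` -/

lemma deriv_bcurve_eq (β t : ℝ) : deriv (bcurve β) t = -deriv (stolzBoundary β) t :=
  deriv_const_sub _

/-- The substitution `w = 1 - z` produces `(-1) ^ n` from the derivatives of the curves and another
`(-1) ^ n` from the resolvents; they cancel. -/
lemma rittCalculus_eq {n : ℕ} (T : Fin n → X →L[ℂ] X) (β : Fin n → ℝ) (φ : (Fin n → ℂ) → ℂ) :
    rittCalculus T β φ = (1 / (2 * (Real.pi : ℂ) * Complex.I)) ^ n •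
      contourIntegral (fun _ => Icc 0 3) (fun i => bcurve (β i)) (fun w => φ (1 - w) •
        resolventProd (fun i => ContinuousLinearMap.id ℂ X - T i) w) := by
  rw [rittCalculus, contourIntegral, contourIntegral]
  congr 1
  refine integral_congr_ae (.of_forall fun t => ?_)
  simp only [resolventProd_id_sub, deriv_bcurve_eq]
  have h1 : (1 - fun i => bcurve (β i) (t i) : Fin n → ℂ) = fun i => stolzBoundary (β i) (t i) := by
    funext i
    simp [bcurve]
  have h2 : ((-1 : ℂ) ^ n) * (-1) ^ n = 1 := by rw [← mul_pow]; simp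
  rw [h1, Finset.prod_neg, Finset.card_univ, Fintype.card_fin, smul_comm (φ _), smul_smul ((-1) ^ n * _),
    mul_right_comm, h2, one_mul]

end Ritt

variable {n : ℕ} {γ : Fin n → ℝ}

lemma one_sub_mem_stolz (hγ : ∀ i, γ i ∈ Ioo 0 (Real.pi / 2)) {w : Fin n → ℂ} :
    1 - w ∈ (prodDomain fun i => stolz (γ i)) ↔ w ∈ prodDomain fun i => dstolz (γ i) := by
  simp only [prodDomain, mem_univ_pi, Pi.sub_apply, Pi.one_apply]
  refine forall_congr' fun i => ?_
  rw [mem_stolz_iff (sin_pos_of_mem (hγ i).1 (hγ i).2), sub_sub_cancel]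

lemma supNorm_stolz (hγ : ∀ i, γ i ∈ Ioo 0 (Real.pi / 2)) (φ : (Fin n → ℂ) → ℂ) :
    supNorm (prodDomain fun i => stolz (γ i)) φ =
      supNorm (prodDomain fun i => dstolz (γ i)) fun w => φ (1 - w) := by
  unfold supNorm
  congr 1
  ext x
  constructor
  · rintro ⟨z, hz, rfl⟩
    exact ⟨1 - z, (one_sub_mem_stolz hγ).1 (by simpa using hz), by simp⟩
  · rintro ⟨w, hw, rfl⟩
    exact ⟨1 - w, (one_sub_mem_stolz hγ).2 hw, rfl⟩

lemma differentiableOn_one_sub {D D' : Set (Fin n → ℂ)} {f : (Fin n → ℂ) → ℂ}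
    (hf : DifferentiableOn ℂ f D) (h : ∀ w ∈ D', 1 - w ∈ D) :
    DifferentiableOn ℂ (fun w => f (1 - w)) D' :=
  hf.comp ((differentiable_id.const_sub (1 : Fin n → ℂ)).differentiableOn) h

/-- The reflected domain lies in `‖w‖ ≤ 2`, where a pure power is at most `1 + 2 ^ (2s)` times the
weight. On such domains the two notions of decay therefore agree. -/
lemma IsHZeroStolz.isHZero (hγ : ∀ i, γ i ∈ Ioo 0 (Real.pi / 2)) {φ : (Fin n → ℂ) → ℂ}
    (h : IsHZeroStolz γ φ) : IsHZero (fun i => dstolz (γ i)) fun w => φ (1 - w) := by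
  obtain ⟨⟨hd, M, hM⟩, c, s, hc, hs, hb⟩ := h
  refine ⟨⟨differentiableOn_one_sub hd fun w hw => (one_sub_mem_stolz hγ).2 hw, M,
    fun w hw => hM _ ((one_sub_mem_stolz hγ).2 hw)⟩, c * (1 + 2 ^ (2 * s)) ^ n, s, by positivity,
    hs, fun w hw => ?_⟩
  refine (hb _ ((one_sub_mem_stolz hγ).2 hw)).trans ?_
  rw [mul_assoc]
  refine mul_le_mul_of_nonneg_left ?_ hc.le
  calc ∏ i, ‖1 - (1 - w) i‖ ^ s = ∏ i, ‖w i‖ ^ s := by simp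
    _ ≤ ∏ i, ((1 + 2 ^ (2 * s)) * wt s ‖w i‖) := by
        refine Finset.prod_le_prod (fun i _ => by positivity) fun i _ => ?_
        have h2 := norm_le_two_of_mem_dstolz (hw i (mem_univ i))
        have h3 : ‖w i‖ ^ (2 * s) ≤ 2 ^ (2 * s) :=
          Real.rpow_le_rpow (norm_nonneg _) h2 (by positivity)
        have h4 : 0 ≤ ‖w i‖ ^ (2 * s) := by positivity
        have h5 : 0 ≤ ‖w i‖ ^ s := by positivity
        rw [wt, ← mul_div_assoc, le_div_iff₀ (by positivity), mul_comm]
        gcongr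
    _ = _ := by rw [Finset.prod_mul_distrib]; simp

lemma isHZeroStolz_of_isHZero (hγ : ∀ i, γ i ∈ Ioo 0 (Real.pi / 2)) {f : (Fin n → ℂ) → ℂ}
    (h : IsHZero (fun i => dstolz (γ i)) f) : IsHZeroStolz γ fun z => f (1 - z) := by
  obtain ⟨⟨hd, M, hM⟩, c, s, hc, hs, hb⟩ := h
  have hm : ∀ z ∈ prodDomain fun i => stolz (γ i), 1 - z ∈ prodDomain fun i => dstolz (γ i) :=
    fun z hz => (one_sub_mem_stolz hγ).1 (by simpa using hz)
  refine ⟨⟨differentiableOn_one_sub hd hm, M, fun w hw => hM _ (hm w hw)⟩, c, s, hc, hs,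
    fun w hw => (hb _ (hm w hw)).trans ?_⟩
  refine mul_le_mul_of_nonneg_left (Finset.prod_le_prod
    (fun i _ => wt_nonneg (norm_nonneg _) s) fun i _ => wt_le_rpow (norm_nonneg _) s) hc.le

/-! ### From the calculus of `T` to the calculus of `1 - T` -/

section

variable {X : Type*} [NormedAddCommGroup X] [NormedSpace ℂ X] [CompleteSpace X]

/-- Each variable is moved from the sector boundary to the reflected Stolz boundary of the same
angle `β i`. In between, both `f` and the resolvent are holomorphic. -/
lemma sectorialCalculus_eq_rittCalculus {T : Fin n → X →L[ℂ] X}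
    (hcomm : ∀ i j, Commute (T i) (T j)) (hγ : ∀ i, γ i ∈ Ioo 0 (Real.pi / 2)) {α β : Fin n → ℝ}
    (hT : ∀ i, IsRittOfType (T i) (α i)) (hβ : ∀ i, β i ∈ Ioo (α i) (γ i))
    {f : (Fin n → ℂ) → ℂ} (hf : IsHZeroSector γ f) :
    sectorialCalculus (fun i => ContinuousLinearMap.id ℂ X - T i) β f =
      rittCalculus T β fun z => f (1 - z) := by
  rw [rittCalculus_eq, sectorialCalculus]
  simp only [sub_sub_cancel]
  have h0 : ∀ i, 0 < α i := fun i => (hT i).1.1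
  -- The midpoint leaves room on both sides: above the type `α i` for the resolvent bound, below `β
  -- i` so that the contours avoid the excluded set.
  have hm : ∀ i, α i < (α i + β i) / 2 ∧ (α i + β i) / 2 < β i := fun i =>
    ⟨by linarith [(hβ i).1], by linarith [(hβ i).1]⟩
  have hα' : ∀ i, 0 < (α i + β i) / 2 := fun i => (h0 i).trans (hm i).1
  have hβ' : ∀ i, β i < Real.pi / 2 := fun i => (hβ i).2.trans (hγ i).2
  have hres : ∀ i, _ := fun i => (hT i).resolvent_bound (hm i).1 ((hm i).2.trans (hβ' i))
  choose hr K hK using hres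
  have hopen : ∀ i, IsOpen (sector (γ i)) := fun i =>
    isOpen_sector (hγ i).1.le (by linarith [(hγ i).2, Real.pi_pos])
  have hopen' : ∀ i, IsOpen (sector (γ i) \ cdstolz ((α i + β i) / 2)) := fun i =>
    (hopen i).sdiff (isClosed_cdstolz (sin_pos_of_mem (hα' i) ((hm i).2.trans (hβ' i))).le)
  have h1 : ∀ i, IsDecayContour (sector (γ i) \ cdstolz ((α i + β i) / 2)) univ
      (sectorBoundary (β i)) := fun i => isDecayContour_sectorBoundary fun z hz hre => by
    refine ⟨(mem_sector_iff (hγ i).1.le (by linarith [(hγ i).2, Real.pi_pos])).2 ?_,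
      ray_notMem_cdstolz (hα' i) (hm i).2 (hβ' i) hz hre⟩
    rw [hre]
    exact mul_lt_mul_of_pos_left (Real.cos_lt_cos_of_nonneg_of_le_pi
      ((hα' i).trans (hm i).2).le (by linarith [(hγ i).2, Real.pi_pos]) (hβ i).2)
      (norm_pos_iff.2 hz)
  have h2 : ∀ i, IsDecayContour (sector (γ i) \ cdstolz ((α i + β i) / 2)) (Icc 0 3)
      (bcurve (β i)) := fun i =>
    (isDecayContour_bcurve (hα' i) (hm i).2 (hβ i).2 (hγ i).2).mono
      (sdiff_subset_sdiff_left (dstolz_subset_sector (hγ i).1 (hγ i).2))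
  congr 1
  refine contourIntegral_replace_all (D := fun i => sector (γ i)) (commute_id_sub hcomm) hopen
    (fun i => ⟨_, hopen' i, sdiff_subset, fun z hz => hr i hz.2, ⟨K i, fun z hz => hK i z hz.2⟩,
      h1 i⟩)
    (fun i => ⟨_, hopen' i, sdiff_subset, fun z hz => hr i hz.2, ⟨K i, fun z hz => hK i z hz.2⟩,
      h2 i⟩) hf (fun i => sdiff_subset) (fun i z hz => hr i hz.2) (fun i z hz => hK i z hz.2)
    fun i g M ε hM hε hg hb => ?_
  rw [Measure.restrict_univ]
  exact integral_sectorBoundary_eq_integral_bcurve (hα' i) (hm i).2 (hβ i).2 (hγ i).2 hε hg hM hb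

theorem HasRittCalculus.hasSectorialCalculus {T : Fin n → X →L[ℂ] X}
    (hcomm : ∀ i j, Commute (T i) (T j)) (hγ : ∀ i, γ i ∈ Ioo 0 (Real.pi / 2))
    (h : HasRittCalculus T γ) :
    HasSectorialCalculus (fun i => ContinuousLinearMap.id ℂ X - T i) γ := by
  obtain ⟨α, hα, C, hC, hb⟩ := h
  refine ⟨α, fun i => ⟨(hα i).1.isSectorialOfType, (hα i).2⟩, C, hC, fun f hf β hβ => ?_⟩
  -- On sectors, `IsHZeroSector` is `IsHZero` with the weight unfolded, so `hf` is accepted as it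
  -- stands.
  have hf' : IsHZero (fun i => dstolz (γ i)) f :=
    IsHZero.mono (D := fun i => sector (γ i)) hf fun i => dstolz_subset_sector (hγ i).1 (hγ i).2
  rw [sectorialCalculus_eq_rittCalculus hcomm hγ (fun i => (hα i).1) hβ hf]
  refine (hb _ (isHZeroStolz_of_isHZero hγ hf') β hβ).trans
    (mul_le_mul_of_nonneg_left ?_ hC.le)
  rw [supNorm_stolz hγ]
  simp only [sub_sub_cancel]
  refine supNorm_le (supNorm_nonneg _ _) fun z hz => norm_le_supNorm hf.1 ?_
  exact pi_mono (fun i _ => dstolz_subset_sector (hγ i).1 (hγ i).2) hz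

end

/-! ### The kernel on rays -/

lemma wt_one_div_ratio {ρ r : ℝ} (hρ : 0 < ρ) : r / (ρ ^ 2 + r ^ 2) = wt 1 (r * ρ⁻¹) / ρ := by
  rw [wt, mul_one, Real.rpow_one, Real.rpow_two]
  field_simp

/-- The Poisson-type kernel is `wt 1 (r / ρ) / ρ`, a function of the ratio. It can pass half of the
decay in `ρ` on to `r` while leaving an integrable weight in `ρ`; this is how the transform acquires
decay in the new variable. -/
lemma wt_mul_div_le {s ρ r : ℝ} (hs : 0 < s) (hs2 : s ≤ 2) (hρ : 0 < ρ) (hr : 0 ≤ r) :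
    wt s ρ * (r / (ρ ^ 2 + r ^ 2)) ≤ 2 * (wt (s / 2) ρ / ρ) * wt (s / 2) r := by
  have h1 : wt 1 (r * ρ⁻¹) ≤ (ρ⁻¹ ^ (s / 2) + ρ⁻¹ ^ (-(s / 2))) * wt (s / 2) r :=
    (wt_anti (by positivity) (by linarith) (by linarith)).trans (wt_mul_le hr (by positivity) _)
  have h2 : wt s ρ * (ρ⁻¹ ^ (s / 2) + ρ⁻¹ ^ (-(s / 2))) ≤ 2 * wt (s / 2) ρ := by
    rw [Real.inv_rpow hρ.le, Real.rpow_neg (by positivity), Real.inv_rpow hρ.le, inv_inv,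
      wt_eq hρ.le, wt_eq hρ.le]
    have h3 : ρ ^ s = (ρ ^ (s / 2)) ^ 2 := by
      rw [← rpow_two_mul hρ.le]; congr 1; ring
    rw [h3]
    have hx : 0 < ρ ^ (s / 2) := Real.rpow_pos_of_pos hρ _
    generalize ρ ^ (s / 2) = x at hx
    have h4 : x ^ 2 / (1 + (x ^ 2) ^ 2) * (x⁻¹ + x) = x * (1 + x ^ 2) / (1 + (x ^ 2) ^ 2) := by
      field_simp
    rw [h4, ← mul_div_assoc, div_le_div_iff₀ (by positivity) (by positivity)]
    nlinarith [mul_nonneg hx.le (sq_nonneg (x ^ 2 - 1))]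
  have hw := wt_nonneg hr (s / 2)
  have hw' := wt_nonneg hρ.le s
  rw [wt_one_div_ratio hρ]
  calc wt s ρ * (wt 1 (r * ρ⁻¹) / ρ)
      ≤ wt s ρ * ((ρ⁻¹ ^ (s / 2) + ρ⁻¹ ^ (-(s / 2))) * wt (s / 2) r / ρ) := by gcongr
    _ = wt s ρ * (ρ⁻¹ ^ (s / 2) + ρ⁻¹ ^ (-(s / 2))) * (wt (s / 2) r / ρ) := by ring
    _ ≤ 2 * wt (s / 2) ρ * (wt (s / 2) r / ρ) := by gcongr
    _ = _ := by ring

lemma norm_ker_ray_le {θ α β γ : ℝ} (hθ : 0 ≤ θ) (h1 : θ < α) (hαβ : α ≤ β) (hβγ : β ≤ γ)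
    (h3 : γ < Real.pi / 2) {z w : ℂ} (hz : z ≠ 0) (hzβ : z.re = ‖z‖ * Real.cos β)
    (hw : w ∈ sector θ) : z - w ≠ 0 ∧ z + w ≠ 0 ∧
      ‖ker z w‖ ≤ 2 / (1 - angleConst θ α γ) * (‖w‖ / (‖z‖ ^ 2 + ‖w‖ ^ 2)) :=
  norm_ker_le (angleConst_nonneg hθ h1 (hαβ.trans hβγ) h3)
    (angleConst_lt_one hθ h1 (hαβ.trans hβγ) h3) hz
    (abs_re_mul_conj_le hθ h1 hαβ hβγ h3 hz hzβ ((mem_sector_iff hθ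
      (by linarith [Real.pi_pos])).1 hw).le)

lemma ae_raySet : ∀ᵐ t ∂volume.restrict raySet, t ∈ raySet ∧ t ≠ 3 :=
  (ae_restrict_mem measurableSet_raySet).and (ae_ne_restrict _ _)

lemma bcurve_mem_dstolz {β γ : ℝ} (hβ : 0 < β) (hβγ : β < γ) (hγ : γ < Real.pi / 2) {t : ℝ}
    (ht : t ∈ raySet) (h3 : t ≠ 3) : bcurve β t ∈ dstolz γ := by
  have h := bcurve_on_raySet hβ (hβγ.trans hγ) ht h3
  exact ray_mem_dstolz hβ hβγ hγ h.1 h.2.1 h.2.2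

lemma integrableOn_raySet_wt {β : ℝ} (hβ : 0 < β) (hβ' : β < Real.pi / 2) {ε : ℝ} (hε : 0 < ε) :
    IntegrableOn (fun t => ‖deriv (bcurve β) t‖ * (wt ε ‖bcurve β t‖ / ‖bcurve β t‖)) raySet :=
  ((isDecayContour_bcurve (α := β / 2) (γ := (β + Real.pi / 2) / 2) (by linarith) (by linarith)
    (by linarith) (by linarith)).integrable ε hε).mono_set raySet_subset

/-- On each segment the primitive is `arctan (s cos β / r)`, of total increase at most `π / 2`,
whatever `r` is. This uniformity is what makes the transform bounded. -/
lemma integral_raySet_poisson_le {β : ℝ} (hβ : 0 < β) (hβ' : β < Real.pi / 2) {r : ℝ}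
    (hr : 0 < r) : IntegrableOn (fun t => ‖deriv (bcurve β) t‖ *
      (r / (‖bcurve β t‖ ^ 2 + r ^ 2))) raySet ∧
    ∫ t in raySet, ‖deriv (bcurve β) t‖ * (r / (‖bcurve β t‖ ^ 2 + r ^ 2)) ≤ Real.pi := by
  have hc : 0 < Real.cos β := Real.cos_pos_of_mem_Ioo ⟨by linarith, hβ'⟩
  set G : ℝ → ℝ := fun s => Real.cos β * (r / ((s * Real.cos β) ^ 2 + r ^ 2)) with hG
  have hcont : Continuous G := by
    refine continuous_const.mul (continuous_const.div (by fun_prop) fun s => ?_)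
    positivity
  have hint : IntegrableOn G (Ioc 0 1) := hcont.integrableOn_Ioc
  have e1 : ∀ t ∈ Ioo (0 : ℝ) 1,
      ‖deriv (bcurve β) t‖ * (r / (‖bcurve β t‖ ^ 2 + r ^ 2)) = G t := fun t ht => by
    rw [deriv_bcurve_of_lt_one ht.2, bcurve_of_le_one ht.2.le, norm_mul, norm_corner hc.le,
      Complex.norm_real, Real.norm_of_nonneg ht.1.le]
  have e2 : ∀ t ∈ Ioo (2 : ℝ) 3,
      ‖deriv (bcurve β) t‖ * (r / (‖bcurve β t‖ ^ 2 + r ^ 2)) = G (3 - t) := fun t ht => by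
    rw [deriv_bcurve_of_two_lt ht.1, bcurve_of_two_lt ht.1, norm_neg, norm_mul,
      norm_corner' hc.le, Complex.norm_real, Real.norm_of_nonneg (by linarith [ht.2])]
  refine ⟨integrableOn_raySet hint hint e1 e2, ?_⟩
  rw [integral_raySet hint hint e1 e2]
  have hd : ∀ s : ℝ, HasDerivAt (fun s => Real.arctan (s * (Real.cos β / r))) (G s) s := fun s => by
    have := ((hasDerivAt_id s).mul_const (Real.cos β / r)).arctan
    refine this.congr_deriv ?_
    rw [hG]
    simp only [id]
    field_simp
    ring
  have h2 : ∫ s in Ioc 0 1, G s ≤ Real.pi / 2 := by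
    rw [← intervalIntegral.integral_of_le zero_le_one,
      intervalIntegral.integral_eq_sub_of_hasDerivAt (fun s _ => hd s)
        (hcont.intervalIntegrable _ _)]
    simpa using (Real.arctan_lt_pi_div_two (1 * (Real.cos β / r))).le
  linarith

/-! ### The transform carrying functions on Stolz domains to functions on sectors -/

section Transform

variable {n : ℕ}

lemma IsHZero.exists_decay {D : Fin n → Set ℂ} {f : (Fin n → ℂ) → ℂ} (hf : IsHZero D f) :
    ∃ C s : ℝ, 0 < C ∧ 0 < s ∧ s ≤ 1 ∧ ∀ z ∈ prodDomain D, ‖f z‖ ≤ C * ∏ i, wt s ‖z i‖ := by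
  obtain ⟨-, C, s, hC, hs, hb⟩ := hf
  refine ⟨C, min s 1, hC, by positivity, min_le_right _ _, fun z hz => (hb z hz).trans ?_⟩
  exact mul_le_mul_of_nonneg_left (Finset.prod_le_prod (fun i _ => wt_nonneg (norm_nonneg _) s)
    fun i _ => wt_anti (norm_nonneg _) (by positivity) (min_le_left _ _)) hC.le

lemma mem_prodDomain_succAbove {D : Fin (n + 1) → Set ℂ} (i : Fin (n + 1)) {y : Fin (n + 1) → ℂ} :
    y ∈ prodDomain D ↔ y i ∈ D i ∧
      (fun j => y (i.succAbove j)) ∈ prodDomain fun j => D (i.succAbove j) := by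
  simp [prodDomain, Set.mem_pi, Fin.forall_iff_succAbove i]

lemma differentiable_insertNth_right (i : Fin (n + 1)) (z : ℂ) :
    Differentiable ℂ fun y : Fin (n + 1) → ℂ =>
      (i.insertNth z (fun j => y (i.succAbove j)) : Fin (n + 1) → ℂ) := by
  rw [differentiable_pi]
  intro k
  refine Fin.succAboveCases i ?_ (fun j => ?_) k
  · simp
  · simp only [Fin.insertNth_apply_succAbove]
    fun_prop

lemma differentiableAt_ker {z w : ℂ} (h1 : z - w ≠ 0) (h2 : z + w ≠ 0) :
    DifferentiableAt ℂ (ker z) w := by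
  unfold ker
  exact ((differentiableAt_id.const_sub z).inv h1).sub ((differentiableAt_id.const_add z).inv h2)

lemma measurable_ker (w : ℂ) : Measurable fun z => ker z w := by
  unfold ker
  exact (measurable_id.sub_const w).inv.sub (measurable_id.add_const w).inv

/-- The integrand of `rayTransform`. -/
def rayIntegrand (β : ℝ) (i : Fin (n + 1)) (f : (Fin (n + 1) → ℂ) → ℂ) (y : Fin (n + 1) → ℂ)
    (u : ℝ) : ℂ :=
  deriv (bcurve β) u * f (i.insertNth (bcurve β u) fun j => y (i.succAbove j)) *
    ker (bcurve β u) (y i)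

/-- The integral of `f` against the kernel `ker` over the two segments of the boundary of a
reflected Stolz domain, in the variable `i`. -/
def rayTransform (β : ℝ) (i : Fin (n + 1)) (f : (Fin (n + 1) → ℂ) → ℂ) (y : Fin (n + 1) → ℂ) : ℂ :=
  (2 * Real.pi * Complex.I)⁻¹ * ∫ u in raySet, rayIntegrand β i f y u

variable {D D' : Fin (n + 1) → Set ℂ} {i : Fin (n + 1)} {f : (Fin (n + 1) → ℂ) → ℂ}
  {θ α β γ C s : ℝ}

lemma insertNth_mem_of_rest (hD'i : D' i = dstolz γ)
    (hDD : ∀ j, D' (i.succAbove j) = D (i.succAbove j)) {z : ℂ} (hz : z ∈ dstolz γ)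
    {ζ : Fin n → ℂ} (hζ : ζ ∈ prodDomain fun j => D (i.succAbove j)) :
    (i.insertNth z ζ : Fin (n + 1) → ℂ) ∈ prodDomain D' := by
  refine insertNth_mem_prodDomain.2 ⟨hD'i ▸ hz, ?_⟩
  simpa only [hDD] using hζ

/-- Only the supremum of `f` may enter the final constant, so `f` is estimated by its supremum here
and the kernel alone provides integrability. -/
lemma norm_rayIntegrand_le_sup (hθ : 0 ≤ θ) (hθα : θ < α) (hαβ : α ≤ β) (hβγ : β < γ)
    (hγ : γ < Real.pi / 2) (hDi : D i = sector θ) (hD'i : D' i = dstolz γ)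
    (hDD : ∀ j, D' (i.succAbove j) = D (i.succAbove j)) (hf : IsHInfty (prodDomain D') f)
    {y : Fin (n + 1) → ℂ} (hy : y ∈ prodDomain D) {u : ℝ} (hu : u ∈ raySet) (hu3 : u ≠ 3) :
    ‖rayIntegrand β i f y u‖ ≤ supNorm (prodDomain D') f * (2 / (1 - angleConst θ α γ)) *
      (‖deriv (bcurve β) u‖ * (‖y i‖ / (‖bcurve β u‖ ^ 2 + ‖y i‖ ^ 2))) := by
  obtain ⟨hyi, hyr⟩ := (mem_prodDomain_succAbove i).1 hy
  rw [hDi] at hyi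
  have hβ : 0 < β := by linarith
  obtain ⟨hb0, hbre, -⟩ := bcurve_on_raySet hβ (hβγ.trans hγ) hu hu3
  have hk := (norm_ker_ray_le hθ hθα hαβ hβγ.le hγ hb0 hbre hyi).2.2
  have hfb := norm_le_supNorm hf (insertNth_mem_of_rest hD'i hDD
    (bcurve_mem_dstolz hβ hβγ hγ hu hu3) hyr)
  rw [rayIntegrand, norm_mul, norm_mul]
  calc _ ≤ ‖deriv (bcurve β) u‖ * supNorm (prodDomain D') f * (2 / (1 - angleConst θ α γ) *
        (‖y i‖ / (‖bcurve β u‖ ^ 2 + ‖y i‖ ^ 2))) := by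
        have := supNorm_nonneg (prodDomain D') f
        gcongr
    _ = _ := by ring

/-- This estimate uses the decay of `f`. It is qualitative: it yields holomorphy and `H_0^∞` decay
of the transform, and its constant does not reach the calculus bound. -/
lemma norm_rayIntegrand_le (hθ : 0 ≤ θ) (hθα : θ < α) (hαβ : α ≤ β) (hβγ : β < γ)
    (hγ : γ < Real.pi / 2) (hDi : D i = sector θ) (hD'i : D' i = dstolz γ)
    (hDD : ∀ j, D' (i.succAbove j) = D (i.succAbove j)) (hC : 0 < C) (hs : 0 < s) (hs1 : s ≤ 1)
    (hb : ∀ z ∈ prodDomain D', ‖f z‖ ≤ C * ∏ i, wt s ‖z i‖)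
    {y : Fin (n + 1) → ℂ} (hy : y ∈ prodDomain D) {u : ℝ} (hu : u ∈ raySet) (hu3 : u ≠ 3) :
    ‖rayIntegrand β i f y u‖ ≤ C * (2 / (1 - angleConst θ α γ)) * 2 *
      (wt (s / 2) ‖y i‖ * ∏ j, wt s ‖y (i.succAbove j)‖) *
      (‖deriv (bcurve β) u‖ * (wt (s / 2) ‖bcurve β u‖ / ‖bcurve β u‖)) := by
  obtain ⟨hyi, hyr⟩ := (mem_prodDomain_succAbove i).1 hy
  rw [hDi] at hyi
  have hβ : 0 < β := by linarith
  obtain ⟨hb0, hbre, -⟩ := bcurve_on_raySet hβ (hβγ.trans hγ) hu hu3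
  have hk := (norm_ker_ray_le hθ hθα hαβ hβγ.le hγ hb0 hbre hyi).2.2
  have hfb := hb _ (insertNth_mem_of_rest hD'i hDD (bcurve_mem_dstolz hβ hβγ hγ hu hu3) hyr)
  rw [Fin.prod_univ_succAbove _ i] at hfb
  simp only [Fin.insertNth_apply_same, Fin.insertNth_apply_succAbove] at hfb
  have hP : 0 ≤ ∏ j, wt s ‖y (i.succAbove j)‖ :=
    Finset.prod_nonneg fun j _ => wt_nonneg (norm_nonneg _) s
  have hw := wt_mul_div_le hs (by linarith) (norm_pos_iff.2 hb0) (norm_nonneg (y i))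
  have hc : 0 ≤ 2 / (1 - angleConst θ α γ) :=
    div_nonneg zero_le_two (sub_nonneg.2 (angleConst_lt_one hθ hθα (hαβ.trans hβγ.le) hγ).le)
  have hw' := wt_nonneg (norm_nonneg (bcurve β u)) s
  rw [rayIntegrand, norm_mul, norm_mul]
  calc _ ≤ ‖deriv (bcurve β) u‖ * (C * (wt s ‖bcurve β u‖ * ∏ j, wt s ‖y (i.succAbove j)‖)) *
        (2 / (1 - angleConst θ α γ) * (‖y i‖ / (‖bcurve β u‖ ^ 2 + ‖y i‖ ^ 2))) := by gcongr
    _ = ‖deriv (bcurve β) u‖ * C * (2 / (1 - angleConst θ α γ)) *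
        (∏ j, wt s ‖y (i.succAbove j)‖) *
        (wt s ‖bcurve β u‖ * (‖y i‖ / (‖bcurve β u‖ ^ 2 + ‖y i‖ ^ 2))) := by ring
    _ ≤ ‖deriv (bcurve β) u‖ * C * (2 / (1 - angleConst θ α γ)) *
        (∏ j, wt s ‖y (i.succAbove j)‖) *
        (2 * (wt (s / 2) ‖bcurve β u‖ / ‖bcurve β u‖) * wt (s / 2) ‖y i‖) := by gcongr
    _ = _ := by ring

lemma aestronglyMeasurable_rayIntegrand (hβ : 0 < β) (hβγ : β < γ)
    (hγ : γ < Real.pi / 2) (hD'i : D' i = dstolz γ)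
    (hDD : ∀ j, D' (i.succAbove j) = D (i.succAbove j))
    (hf : DifferentiableOn ℂ f (prodDomain D')) {y : Fin (n + 1) → ℂ} (hy : y ∈ prodDomain D) :
    AEStronglyMeasurable (rayIntegrand β i f y) (volume.restrict raySet) := by
  have hyr := ((mem_prodDomain_succAbove i).1 hy).2
  have hyr' : (fun j => y (i.succAbove j)) ∈ prodDomain fun j => D' (i.succAbove j) := by
    simpa only [hDD] using hyr
  have hg := (differentiableOn_insertNth hf i hyr').continuousOn
  rw [hD'i] at hg
  have hm := aestronglyMeasurable_comp_of_continuousOn (μ := volume.restrict raySet)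
    (isOpen_dstolz γ) hg (measurable_bcurve β)
    (ae_raySet.mono fun t ht => bcurve_mem_dstolz hβ hβγ hγ ht.1 ht.2)
  exact (((measurable_deriv _).aestronglyMeasurable).mul hm).mul
    ((measurable_ker (y i)).comp (measurable_bcurve β)).aestronglyMeasurable

lemma rayTransform_norm_le {M : ℝ} {y : Fin (n + 1) → ℂ}
    (h : ‖∫ u in raySet, rayIntegrand β i f y u‖ ≤ (2 * Real.pi) * M) :
    ‖rayTransform β i f y‖ ≤ M := by
  have hpi := Real.pi_pos
  rw [rayTransform, norm_mul, norm_inv, norm_mul, norm_mul, Complex.norm_I, Complex.norm_real,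
    Complex.norm_ofNat, Real.norm_of_nonneg hpi.le, mul_one, inv_mul_le_iff₀ (by positivity)]
  exact h

/-- The constant is `(2π)⁻¹` from the Cauchy normalisation, times `2 / (1 - c)` from the kernel,
times `π` from the Poisson integral over the segments. It does not depend on `β`. -/
theorem norm_rayTransform_le (hθ : 0 ≤ θ) (hθα : θ < α) (hαβ : α ≤ β) (hβγ : β < γ)
    (hγ : γ < Real.pi / 2) (hDi : D i = sector θ) (hD'i : D' i = dstolz γ)
    (hDD : ∀ j, D' (i.succAbove j) = D (i.succAbove j)) (hf : IsHInfty (prodDomain D') f)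
    {y : Fin (n + 1) → ℂ} (hy : y ∈ prodDomain D) :
    ‖rayTransform β i f y‖ ≤ 1 / (1 - angleConst θ α γ) * supNorm (prodDomain D') f := by
  have hβ : 0 < β := by linarith
  have hyi := ((mem_prodDomain_succAbove i).1 hy).1
  rw [hDi] at hyi
  obtain ⟨hi, hle⟩ := integral_raySet_poisson_le hβ (hβγ.trans hγ) (norm_pos_iff.2 hyi.1)
  have hc : 0 < 1 - angleConst θ α γ :=
    sub_pos.2 (angleConst_lt_one hθ hθα (hαβ.trans hβγ.le) hγ)
  have hsup := supNorm_nonneg (prodDomain D') f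
  refine rayTransform_norm_le ((norm_integral_le_of_norm_le
    (hi.const_mul (supNorm (prodDomain D') f * (2 / (1 - angleConst θ α γ))))
    (ae_raySet.mono fun u hu => norm_rayIntegrand_le_sup hθ hθα hαβ hβγ hγ hDi hD'i hDD hf hy
      hu.1 hu.2)).trans ?_)
  rw [integral_const_mul]
  calc _ ≤ supNorm (prodDomain D') f * (2 / (1 - angleConst θ α γ)) * Real.pi := by gcongr
    _ = _ := by ring

/-- In the variable `i` the kernel extends the function from the reflected Stolz domain to the whole
sector and supplies decay with exponent `s / 2`; in the other variables the decay of `f` is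
inherited. -/
theorem isHZero_rayTransform (hD : ∀ j, IsOpen (D j)) (hθ : 0 ≤ θ) (hθα : θ < α) (hαβ : α ≤ β)
    (hβγ : β < γ) (hγ : γ < Real.pi / 2) (hDi : D i = sector θ) (hD'i : D' i = dstolz γ)
    (hDD : ∀ j, D' (i.succAbove j) = D (i.succAbove j)) (hf : IsHZero D' f) :
    IsHZero D (rayTransform β i f) := by
  have hβ : 0 < β := by linarith
  have hc : 0 < 1 - angleConst θ α γ :=
    sub_pos.2 (angleConst_lt_one hθ hθα (hαβ.trans hβγ.le) hγ)
  have hfi := hf.1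
  obtain ⟨C, s, hC, hs, hs1, hb⟩ := hf.exists_decay
  have hI := integrableOn_raySet_wt hβ (hβγ.trans hγ) (half_pos hs)
  set J := ∫ u in raySet, ‖deriv (bcurve β) u‖ * (wt (s / 2) ‖bcurve β u‖ / ‖bcurve β u‖) with hJ
  have hJ0 : 0 ≤ J := integral_nonneg fun u => mul_nonneg (norm_nonneg _)
    (div_nonneg (wt_nonneg (norm_nonneg _) _) (norm_nonneg _))
  refine ⟨⟨?_, _, fun y hy => norm_rayTransform_le hθ hθα hαβ hβγ hγ hDi hD'i hDD hfi hy⟩,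
    C * (2 / (1 - angleConst θ α γ)) * 2 * (J + 1), s / 2, by positivity, half_pos hs,
    fun y hy => ?_⟩
  · refine DifferentiableOn.const_mul (differentiableOn_integral (isOpen_prodDomain hD) ?_
      (fun y hy => aestronglyMeasurable_rayIntegrand hβ hβγ hγ hD'i hDD hfi.1 hy) ?_) _
    · filter_upwards [ae_raySet] with u hu y hy
      obtain ⟨hyi, hyr⟩ := (mem_prodDomain_succAbove i).1 hy
      rw [hDi] at hyi
      obtain ⟨hb0, hbre, -⟩ := bcurve_on_raySet hβ (hβγ.trans hγ) hu.1 hu.2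
      have hk := norm_ker_ray_le hθ hθα hαβ hβγ.le hγ hb0 hbre hyi
      have h1 : DifferentiableWithinAt ℂ (fun y : Fin (n + 1) → ℂ =>
          f (i.insertNth (bcurve β u) fun j => y (i.succAbove j))) (prodDomain D) y := by
        refine (hfi.1 _ (insertNth_mem_of_rest hD'i hDD
          (bcurve_mem_dstolz hβ hβγ hγ hu.1 hu.2) hyr)).comp y
          (differentiable_insertNth_right i _ y).differentiableWithinAt fun x hx => ?_
        exact insertNth_mem_of_rest hD'i hDD (bcurve_mem_dstolz hβ hβγ hγ hu.1 hu.2)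
          ((mem_prodDomain_succAbove i).1 hx).2
      have h2 : DifferentiableAt ℂ (fun y : Fin (n + 1) → ℂ => ker (bcurve β u) (y i)) y :=
        (differentiableAt_ker hk.1 hk.2.1).comp (f := fun y : Fin (n + 1) → ℂ => y i)
          y (differentiableAt_apply i y)
      exact (h1.const_mul _).mul h2.differentiableWithinAt
    · intro x hx
      obtain ⟨r, hr, hrU⟩ := Metric.isOpen_iff.1 (isOpen_prodDomain hD) x hx
      refine ⟨r, hr, _, hI.const_mul (C * (2 / (1 - angleConst θ α γ)) * 2 * (1 * 1)), ?_⟩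
      filter_upwards [ae_raySet] with u hu y hy
      refine (norm_rayIntegrand_le hθ hθα hαβ hβγ hγ hDi hD'i hDD hC hs hs1 hb (hrU hy) hu.1
        hu.2).trans ?_
      have h1 := wt_nonneg (norm_nonneg (bcurve β u)) (s / 2)
      have h2 : ∏ j, wt s ‖y (i.succAbove j)‖ ≤ 1 := Finset.prod_le_one
        (fun j _ => wt_nonneg (norm_nonneg _) s) fun j _ => wt_le_one (norm_nonneg _) s
      have h3 := wt_le_one (norm_nonneg (y i)) (s / 2)
      have h4 : 0 ≤ ∏ j, wt s ‖y (i.succAbove j)‖ := Finset.prod_nonneg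
        fun j _ => wt_nonneg (norm_nonneg _) s
      have h5 := wt_nonneg (norm_nonneg (y i)) (s / 2)
      gcongr
  · have hP : 0 ≤ ∏ j, wt s ‖y (i.succAbove j)‖ := Finset.prod_nonneg
        fun j _ => wt_nonneg (norm_nonneg _) s
    have hw := wt_nonneg (norm_nonneg (y i)) (s / 2)
    have hPQ : ∏ j, wt s ‖y (i.succAbove j)‖ ≤ ∏ j, wt (s / 2) ‖y (i.succAbove j)‖ :=
      Finset.prod_le_prod (fun j _ => wt_nonneg (norm_nonneg _) s)
        fun j _ => wt_anti (norm_nonneg _) (half_pos hs) (by linarith)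
    rw [Fin.prod_univ_succAbove _ i]
    refine rayTransform_norm_le ((norm_integral_le_of_norm_le (hI.const_mul _)
      (ae_raySet.mono fun u hu => norm_rayIntegrand_le hθ hθα hαβ hβγ hγ hDi hD'i hDD hC hs hs1 hb
        hy hu.1 hu.2)).trans ?_)
    rw [integral_const_mul, ← hJ]
    calc C * (2 / (1 - angleConst θ α γ)) * 2 *
          (wt (s / 2) ‖y i‖ * ∏ j, wt s ‖y (i.succAbove j)‖) * J
        ≤ C * (2 / (1 - angleConst θ α γ)) * 2 *
          (wt (s / 2) ‖y i‖ * ∏ j, wt (s / 2) ‖y (i.succAbove j)‖) * (J + 1) := by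
          have : 0 ≤ ∏ j, wt (s / 2) ‖y (i.succAbove j)‖ := hP.trans hPQ
          gcongr
          linarith
      _ = 1 * (C * (2 / (1 - angleConst θ α γ)) * 2 * (J + 1) *
          (wt (s / 2) ‖y i‖ * ∏ j, wt (s / 2) ‖y (i.succAbove j)‖)) := by ring
      _ ≤ _ := by
          have : 0 ≤ ∏ j, wt (s / 2) ‖y (i.succAbove j)‖ := hP.trans hPQ
          gcongr
          linarith [Real.pi_gt_three]

/-- The product of a slice of `f` with the kernel. -/
theorem isHZero_slice_mul_ker (hθ : 0 ≤ θ) (hθα : θ < α) (hαβ : α ≤ β)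
    (hβγ : β < γ) (hγ : γ < Real.pi / 2) (hDi : D i = sector θ) (hD'i : D' i = dstolz γ)
    (hDD : ∀ j, D' (i.succAbove j) = D (i.succAbove j)) (hf : IsHZero D' f) {z₀ b : ℂ}
    (hz₀ : ‖z₀‖ = 1) (hre : z₀.re = ‖z₀‖ * Real.cos β) (hbm : b ∈ dstolz γ) :
    IsHZero D (fun y => f (i.insertNth b fun j => y (i.succAbove j)) * ker z₀ (y i)) ∧
    supNorm (prodDomain D) (fun y => f (i.insertNth b fun j => y (i.succAbove j)) *
      ker z₀ (y i)) ≤ 1 / (1 - angleConst θ α γ) * supNorm (prodDomain D') f := by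
  have hz0 : z₀ ≠ 0 := norm_pos_iff.1 (hz₀ ▸ one_pos)
  have hc : 0 < 1 - angleConst θ α γ :=
    sub_pos.2 (angleConst_lt_one hθ hθα (hαβ.trans hβγ.le) hγ)
  have hsup := supNorm_nonneg (prodDomain D') f
  have hfi := hf.1
  obtain ⟨C, s, hC, hs, hs1, hb⟩ := hf.exists_decay
  have hmem : ∀ y ∈ prodDomain D,
      (i.insertNth b fun j => y (i.succAbove j) : Fin (n + 1) → ℂ) ∈ prodDomain D' := fun y hy =>
    insertNth_mem_of_rest hD'i hDD hbm ((mem_prodDomain_succAbove i).1 hy).2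
  have hk : ∀ y ∈ prodDomain D, z₀ - y i ≠ 0 ∧ z₀ + y i ≠ 0 ∧
      ‖ker z₀ (y i)‖ ≤ 2 / (1 - angleConst θ α γ) * (‖y i‖ / (1 + ‖y i‖ ^ 2)) := fun y hy => by
    have := norm_ker_ray_le hθ hθα hαβ hβγ.le hγ hz0 hre
      (hDi ▸ ((mem_prodDomain_succAbove i).1 hy).1)
    simpa only [hz₀, one_pow] using this
  have hle : ∀ y ∈ prodDomain D, ‖f (i.insertNth b fun j => y (i.succAbove j)) * ker z₀ (y i)‖ ≤
      1 / (1 - angleConst θ α γ) * supNorm (prodDomain D') f := fun y hy => by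
    have h1 : ‖y i‖ / (1 + ‖y i‖ ^ 2) ≤ 1 / 2 := by
      rw [div_le_div_iff₀ (by positivity) two_pos]
      nlinarith [sq_nonneg (‖y i‖ - 1)]
    rw [norm_mul, mul_comm]
    calc _ ≤ (2 / (1 - angleConst θ α γ) * (1 / 2)) * supNorm (prodDomain D') f :=
          mul_le_mul ((hk y hy).2.2.trans (by gcongr)) (norm_le_supNorm hfi (hmem y hy))
            (norm_nonneg _) (by positivity)
      _ = _ := by ring
  refine ⟨⟨⟨fun y hy => ?_, _, hle⟩, C * (2 / (1 - angleConst θ α γ)), s, by positivity, hs,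
    fun y hy => ?_⟩, supNorm_le (by positivity) hle⟩
  · refine DifferentiableWithinAt.mul ((hfi.1 _ (hmem y hy)).comp y
      (differentiable_insertNth_right i _ y).differentiableWithinAt hmem) ?_
    exact ((differentiableAt_ker (hk y hy).1 (hk y hy).2.1).comp (f := fun y : Fin (n + 1) → ℂ => y i)
      y (differentiableAt_apply i y)).differentiableWithinAt
  · have hfb := hb _ (hmem y hy)
    rw [Fin.prod_univ_succAbove _ i] at hfb ⊢
    simp only [Fin.insertNth_apply_same, Fin.insertNth_apply_succAbove] at hfb
    -- The slice is constant in the variable `i`, so all decay there comes from the kernel, whose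
    -- weight has exponent `1 ≥ s`.
    have h1 : ‖y i‖ / (1 + ‖y i‖ ^ 2) ≤ wt s ‖y i‖ := by
      have := wt_anti (norm_nonneg (y i)) hs hs1
      rwa [wt, mul_one, Real.rpow_one, Real.rpow_two] at this
    have hP : 0 ≤ ∏ j, wt s ‖y (i.succAbove j)‖ := Finset.prod_nonneg
        fun j _ => wt_nonneg (norm_nonneg _) s
    have hw := wt_le_one (norm_nonneg b) s
    rw [norm_mul]
    calc _ ≤ (C * (wt s ‖b‖ * ∏ j, wt s ‖y (i.succAbove j)‖)) *
          (2 / (1 - angleConst θ α γ) * (‖y i‖ / (1 + ‖y i‖ ^ 2))) :=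
          mul_le_mul hfb (hk y hy).2.2 (norm_nonneg _) ((norm_nonneg _).trans hfb)
      _ ≤ (C * (1 * ∏ j, wt s ‖y (i.succAbove j)‖)) *
          (2 / (1 - angleConst θ α γ) * wt s ‖y i‖) := by gcongr
      _ = _ := by ring

end Transform

/-! ### The even kernel applied to one operator: segments and arc of a Stolz boundary. -/

section Operator

variable {X : Type*} [NormedAddCommGroup X] [NormedSpace ℂ X]

/-- Resolvent bounds off the closed sector of angle `ν₁` and off a reflected Stolz domain. -/
structure SectorStolzBound (a : X →L[ℂ] X) (ν₁ δ K : ℝ) : Prop where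
  left_mem : leftRegion ν₁ ⊆ resolventSet ℂ a
  left_le : ∀ w ∈ leftRegion ν₁, ‖w‖ * ‖resolvent a w‖ ≤ K
  out_mem : (cdstolz δ)ᶜ ⊆ resolventSet ℂ a
  out_le : ∀ w ∉ cdstolz δ, ‖resolvent a w‖ ≤ K / ‖w‖

/-- Angles used to pass from a sector of angle `θ` to Stolz domains of angles between `α` and `γ`:
the contours are the boundary of the sector of angle `ν`, and Stolz boundaries. -/
structure AngleChain (ν₁ ν θ δ α γ : ℝ) : Prop where
  pos : 0 < ν₁
  lt_left : ν₁ < ν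
  lt_sector : ν < θ
  lt_stolz : θ < α
  delta_pos : 0 < δ
  delta_lt : δ < α
  le : α ≤ γ
  lt : γ < Real.pi / 2

variable {a : X →L[ℂ] X} {ν₁ ν θ δ α β γ K : ℝ}

lemma SectorStolzBound.nonneg (h : SectorStolzBound a ν₁ δ K) (hν : 0 < ν₁) (hν' : ν₁ < Real.pi / 2) :
    0 ≤ K := by
  have hc : 0 < Real.cos ν₁ := Real.cos_pos_of_mem_Ioo ⟨by linarith, hν'⟩
  have : (-1 : ℂ) ∈ leftRegion ν₁ := by
    simp only [leftRegion, mem_ofPred_eq, Complex.neg_re, Complex.one_re, norm_neg, norm_one]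
    linarith
  exact (mul_nonneg (norm_nonneg _) (norm_nonneg _)).trans (h.left_le _ this)

lemma AngleChain.nonneg (hA : AngleChain ν₁ ν θ δ α γ) (h : SectorStolzBound a ν₁ δ K) : 0 ≤ K :=
  h.nonneg hA.pos (by linarith [hA.lt_left, hA.lt_sector, hA.lt_stolz, hA.le, hA.lt])

lemma SectorStolzBound.left_le' (h : SectorStolzBound a ν₁ δ K) {w : ℂ} (hw : w ∈ leftRegion ν₁) :
    ‖resolvent a w‖ ≤ K / ‖w‖ := by
  rw [le_div_iff₀ (norm_pos_iff.2 (leftRegion_ne_zero hw)), mul_comm]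
  exact h.left_le w hw

lemma neg_mem_leftRegion (hν : 0 < ν₁) (hν' : ν₁ < Real.pi / 2) (hγ : 0 < γ)
    (hγ' : γ < Real.pi / 2) {z : ℂ} (hz : z ∈ dstolz γ) : -z ∈ leftRegion ν₁ := by
  have h1 := (mem_sector_iff hγ.le (by linarith [Real.pi_pos])).1 (dstolz_subset_sector hγ hγ' hz)
  have hc : 0 < Real.cos ν₁ := Real.cos_pos_of_mem_Ioo ⟨by linarith, hν'⟩
  have hc' : 0 < Real.cos γ := Real.cos_pos_of_mem_Ioo ⟨by linarith, hγ'⟩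
  have h2 : 0 ≤ ‖z‖ * Real.cos γ := by positivity
  have h3 : 0 ≤ ‖z‖ * Real.cos ν₁ := by positivity
  simp only [leftRegion, mem_ofPred_eq, Complex.neg_re, norm_neg]
  linarith

lemma isOpen_dstolz_sdiff (hδ : 0 < δ) (hδ' : δ < Real.pi / 2) :
    IsOpen (dstolz γ \ cdstolz δ) :=
  (isOpen_dstolz γ).sdiff (isClosed_cdstolz (sin_pos_of_mem hδ hδ').le)

lemma AngleChain.isDecayContour_bcurve (hA : AngleChain ν₁ ν θ δ α γ) (hαβ : α < β)
    (hβγ : β < γ) : IsDecayContour (dstolz γ \ cdstolz δ) (Icc 0 3) (bcurve β) :=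
  RittCalculus.isDecayContour_bcurve hA.delta_pos (hA.delta_lt.trans hαβ) hβγ hA.lt

lemma AngleChain.isDecayContour_sectorBoundary (hA : AngleChain ν₁ ν θ δ α γ) :
    IsDecayContour (sector θ ∩ leftRegion ν₁) univ (sectorBoundary ν) := by
  have h1 := hA.pos
  have h2 := hA.lt_left
  have h3 := hA.lt_sector
  have h4 : θ < Real.pi / 2 := hA.lt_stolz.trans (hA.le.trans_lt hA.lt)
  have hpi := Real.pi_pos
  refine RittCalculus.isDecayContour_sectorBoundary fun z hz hre => ⟨?_, ?_⟩
  · rw [mem_sector_iff (by linarith) (by linarith), hre]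
    exact mul_lt_mul_of_pos_left (Real.cos_lt_cos_of_nonneg_of_le_pi (by linarith)
      (by linarith) h3) (norm_pos_iff.2 hz)
  · exact ray_mem_leftRegion h1.le h2 (by linarith) hz hre.le

lemma AngleChain.isOpen_sector_inter (hA : AngleChain ν₁ ν θ δ α γ) :
    IsOpen (sector θ ∩ leftRegion ν₁) :=
  (isOpen_sector (by linarith [hA.pos, hA.lt_left, hA.lt_sector])
    (by linarith [hA.lt_stolz, hA.le, hA.lt, Real.pi_pos])).inter (isOpen_leftRegion ν₁)

lemma SectorStolzBound.admissible_bcurve (h : SectorStolzBound a ν₁ δ K)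
    (hA : AngleChain ν₁ ν θ δ α γ) (hαβ : α < β) (hβγ : β < γ) :
    Admissible a (dstolz γ) (Icc 0 3) (bcurve β) :=
  ⟨_, isOpen_dstolz_sdiff hA.delta_pos (hA.delta_lt.trans (hA.le.trans_lt hA.lt)), sdiff_subset,
    fun _ hz => h.out_mem hz.2, ⟨K, fun z hz => h.out_le z hz.2⟩,
    hA.isDecayContour_bcurve hαβ hβγ⟩

lemma SectorStolzBound.admissible_sectorBoundary (h : SectorStolzBound a ν₁ δ K)
    (hA : AngleChain ν₁ ν θ δ α γ) : Admissible a (sector θ) univ (sectorBoundary ν) :=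
  ⟨_, hA.isOpen_sector_inter, inter_subset_left,
    fun _ hz => h.left_mem hz.2, ⟨K, fun _ hz => h.left_le' hz.2⟩,
    hA.isDecayContour_sectorBoundary⟩

lemma norm_kerOp_le (h : SectorStolzBound a ν₁ δ K) (hA : AngleChain ν₁ ν θ δ α γ) {z : ℂ}
    (hz : z ∈ dstolz γ \ cdstolz δ) : ‖kerOp a z‖ ≤ 2 * K / ‖z‖ := by
  have hlt := hA.lt
  have h1 : ν₁ < γ := by linarith [hA.lt_left, hA.lt_sector, hA.lt_stolz, hA.le]
  have h2 := h.left_le' (neg_mem_leftRegion hA.pos (h1.trans hlt) (hA.pos.trans h1) hlt hz.1)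
  rw [norm_neg] at h2
  calc _ ≤ ‖resolvent a z‖ + ‖resolvent a (-z)‖ := norm_add_le _ _
    _ ≤ K / ‖z‖ + K / ‖z‖ := add_le_add (h.out_le z hz.2) h2
    _ = _ := by ring

variable [CompleteSpace X]

lemma continuousOn_kerOp (h : SectorStolzBound a ν₁ δ K) (hA : AngleChain ν₁ ν θ δ α γ) :
    ContinuousOn (kerOp a) (dstolz γ \ cdstolz δ) := by
  have hlt := hA.lt
  have h1 : ν₁ < γ := by linarith [hA.lt_left, hA.lt_sector, hA.lt_stolz, hA.le]
  have hr := (differentiableOn_resolvent a).continuousOn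
  refine (hr.mono fun z hz => h.out_mem hz.2).add ?_
  exact hr.comp continuous_neg.continuousOn fun z hz => h.left_mem
    (neg_mem_leftRegion hA.pos (h1.trans hlt) (hA.pos.trans h1) hlt hz.1)

/-- On the boundary of a reflected Stolz domain, the resolvent may be replaced by `kerOp`. -/
lemma integral_bcurve_kerOp (h : SectorStolzBound a ν₁ δ K) (hA : AngleChain ν₁ ν θ δ α γ)
    (hαβ : α < β) (hβγ : β < γ) {g : ℂ → ℂ} (hg : DifferentiableOn ℂ g (dstolz γ)) {M s : ℝ}
    (hM : 0 ≤ M) (hs : 0 < s) (hb : ∀ z ∈ dstolz γ, ‖g z‖ ≤ M * wt s ‖z‖) (Q : X →L[ℂ] X) :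
    ∫ t in Icc 0 3, deriv (bcurve β) t • (g (bcurve β t) • (resolvent a (bcurve β t) * Q)) =
      (∫ u in raySet, deriv (bcurve β) u • (g (bcurve β u) • (kerOp a (bcurve β u) * Q))) +
        ∫ u in Ioc 1 2, deriv (bcurve β) u • (g (bcurve β u) • (kerOp a (bcurve β u) * Q)) := by
  have hlt := hA.lt
  have hK := hA.nonneg h
  have h1 : ν₁ < γ := by linarith [hA.lt_left, hA.lt_sector, hA.lt_stolz, hA.le]
  have hneg : ∀ z ∈ dstolz γ, -z ∈ leftRegion ν₁ := fun z hz =>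
    neg_mem_leftRegion hA.pos (h1.trans hlt) (hA.pos.trans h1) hlt hz
  have hδ : δ < Real.pi / 2 := hA.delta_lt.trans (hA.le.trans_lt hA.lt)
  have hdc := hA.isDecayContour_bcurve hαβ hβγ
  have hdr := differentiableOn_resolvent a
  have hbd : ∀ (z : ℂ) (B : X →L[ℂ] X) (κ : ℝ), z ∈ dstolz γ → ‖B‖ ≤ κ / ‖z‖ →
      ‖g z • (B * Q)‖ ≤ (M * κ * ‖Q‖) * (wt s ‖z‖ / ‖z‖) := fun z B κ hz hB => by
    rw [norm_smul]
    calc ‖g z‖ * ‖B * Q‖ ≤ (M * wt s ‖z‖) * (κ / ‖z‖ * ‖Q‖) := by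
          refine mul_le_mul (hb z hz) ((norm_mul_le _ _).trans ?_) (norm_nonneg _)
            ((norm_nonneg _).trans (hb z hz))
          gcongr
      _ = _ := by ring
  have i1 := hdc.integrable_smul (isOpen_dstolz_sdiff hA.delta_pos hδ)
    (g := fun z => g z • (kerOp a z * Q))
    ((hg.continuousOn.mono sdiff_subset).smul ((continuousOn_kerOp h hA).mul continuousOn_const)) hs
    fun z hz => hbd z _ _ hz.1 (norm_kerOp_le h hA hz)
  have hgn : DifferentiableOn ℂ (fun z => g z • (resolvent a (-z) * Q)) (dstolz γ) :=
    hg.smul ((hdr.comp differentiable_neg.differentiableOn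
      fun z hz => h.left_mem (hneg z hz)).mul_const Q)
  have hbn : ∀ z ∈ dstolz γ, ‖g z • (resolvent a (-z) * Q)‖ ≤
      (M * K * ‖Q‖) * (wt s ‖z‖ / ‖z‖) := fun z hz => by
    have := h.left_le' (hneg z hz)
    rw [norm_neg] at this
    exact hbd z _ _ hz this
  have i2 := hdc.integrable_smul (isOpen_dstolz_sdiff hA.delta_pos hδ)
    (g := fun z => g z • (resolvent a (-z) * Q)) (hgn.continuousOn.mono sdiff_subset) hs
    fun z hz => hbn z hz.1
  have hβ : 0 < β := by linarith [hA.delta_pos, hA.delta_lt]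
  -- For `z` in the reflected Stolz domain `-z` lies left of the sector, so the integrand with
  -- `R(-z)` is holomorphic inside the contour and `R(z)` may be completed to `kerOp` for free.
  have hz := integral_bcurve_eq_zero (g := fun z => g z • (resolvent a (-z) * Q)) hβ hβγ hlt hs hgn
    (by positivity) hbn
  rw [← integral_bcurve_split i1, ← sub_zero (∫ t in Icc 0 3, deriv (bcurve β) t •
    (g (bcurve β t) • (kerOp a (bcurve β t) * Q))), ← hz, ← integral_sub i1 i2]
  refine integral_congr_ae (.of_forall fun t => ?_)
  simp only [kerOp]
  rw [← smul_sub, ← smul_sub, ← sub_mul, add_sub_cancel_right]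

/-- The Cauchy integral of the kernel against the resolvent over a sector boundary. -/
lemma integral_sectorBoundary_ker (h : SectorStolzBound a ν₁ δ K) (hA : AngleChain ν₁ ν θ δ α γ)
    (hαβ : α < β) (hβγ : β < γ) {z : ℂ} (hz : z ≠ 0) (hre : z.re = ‖z‖ * Real.cos β) (v : ℂ)
    (Q : X →L[ℂ] X) :
    ∫ t, deriv (sectorBoundary ν) t •
      ((v * ker z (sectorBoundary ν t)) • (resolvent a (sectorBoundary ν t) * Q)) =
      (2 * Real.pi * Complex.I) • (v • (kerOp a z * Q)) := by
  have hlt := hA.lt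
  have hK := hA.nonneg h
  have hθ : 0 ≤ θ := by linarith [hA.pos, hA.lt_left, hA.lt_sector]
  have hνβ : ν < β := by linarith [hA.lt_sector, hA.lt_stolz]
  have hc : 0 < 1 - angleConst θ α γ :=
    sub_pos.2 (angleConst_lt_one hθ hA.lt_stolz hA.le hlt)
  have hk := fun w (hw : w ∈ sector θ) =>
    norm_ker_ray_le hθ hA.lt_stolz hαβ.le hβγ.le hlt hz hre hw
  have hρ : 0 < ‖z‖ := norm_pos_iff.2 hz
  -- For fixed `z` the kernel decays in `w` with exponent `1`; the constant is that of `wt_mul_le`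
  -- for the dilation by `‖z‖⁻¹`.
  have hint := hA.isDecayContour_sectorBoundary.integrable_smul hA.isOpen_sector_inter
    (g := fun w => ker z w • resolvent a w) (ε := 1) (K := 2 / (1 - angleConst θ α γ) *
      (((‖z‖⁻¹) ^ (1 : ℝ) + (‖z‖⁻¹) ^ (-1 : ℝ)) / ‖z‖) * K)
    (fun w hw => ((differentiableAt_ker (hk w hw.1).1 (hk w hw.1).2.1).continuousAt.smul
      (((differentiableOn_resolvent a).differentiableAt
        ((spectrum.isOpen_resolventSet a).mem_nhds
          (h.left_mem hw.2))).continuousAt)).continuousWithinAt) one_pos ?_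
  · rw [integrableOn_univ] at hint
    have e1 := integral_ker_smul_resolvent hA.pos hA.lt_left hνβ (hβγ.trans hlt) h.left_mem
      h.left_le hz hre hint
    have e2 : ∀ t, deriv (sectorBoundary ν) t •
        ((v * ker z (sectorBoundary ν t)) • (resolvent a (sectorBoundary ν t) * Q)) =
        v • ((deriv (sectorBoundary ν) t • (ker z (sectorBoundary ν t) •
          resolvent a (sectorBoundary ν t))) * Q) := fun t => by
      simp only [smul_mul_assoc, smul_smul]
      congr 1
      ring
    simp_rw [e2]
    rw [integral_smul, integral_mul_const_of_integrable hint, e1, smul_mul_assoc, smul_comm]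
  · intro w hw
    have hw0 : 0 < ‖w‖ := norm_pos_iff.2 (leftRegion_ne_zero hw.2)
    have h1 : ‖w‖ / (‖z‖ ^ 2 + ‖w‖ ^ 2) ≤
        ((‖z‖⁻¹) ^ (1 : ℝ) + (‖z‖⁻¹) ^ (-1 : ℝ)) / ‖z‖ * wt 1 ‖w‖ := by
      rw [wt_one_div_ratio hρ, div_mul_eq_mul_div]
      gcongr
      exact wt_mul_le hw0.le (by positivity) 1
    rw [norm_smul]
    calc _ ≤ (2 / (1 - angleConst θ α γ) * (((‖z‖⁻¹) ^ (1 : ℝ) + (‖z‖⁻¹) ^ (-1 : ℝ)) / ‖z‖ *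
          wt 1 ‖w‖)) * (K / ‖w‖) := by
          have hw1 := wt_nonneg hw0.le 1
          refine mul_le_mul ((hk w hw.1).2.2.trans ?_) (h.left_le' hw.2) (norm_nonneg _)
            (by positivity)
          gcongr
      _ = _ := by ring

/-- This justifies Fubini for the sector boundary and the segments. By `wt_mul_div_le` the exponent
`s` of `g` is shared as `s / 2` for each contour, so the dominating function is a product. -/
lemma integrable_ker_prod (h : SectorStolzBound a ν₁ δ K) (hA : AngleChain ν₁ ν θ δ α γ)
    (hαβ : α < β) (hβγ : β < γ) {g : ℂ → ℂ} (hg : ContinuousOn g (dstolz γ)) {M s : ℝ}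
    (hM : 0 ≤ M) (hs : 0 < s) (hs1 : s ≤ 1) (hb : ∀ z ∈ dstolz γ, ‖g z‖ ≤ M * wt s ‖z‖)
    (Q : X →L[ℂ] X) :
    Integrable (fun p : ℝ × ℝ => (deriv (bcurve β) p.2 * g (bcurve β p.2) *
      ker (bcurve β p.2) (sectorBoundary ν p.1)) • (deriv (sectorBoundary ν) p.1 •
        (resolvent a (sectorBoundary ν p.1) * Q)))
      ((volume.restrict univ).prod (volume.restrict raySet)) := by
  have hlt := hA.lt
  have hK := hA.nonneg h
  have hθ : 0 ≤ θ := by linarith [hA.pos, hA.lt_left, hA.lt_sector]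
  have hβ : 0 < β := by linarith [hA.delta_pos, hA.delta_lt]
  have hc : 0 < 1 - angleConst θ α γ :=
    sub_pos.2 (angleConst_lt_one hθ hA.lt_stolz hA.le hlt)
  have hdc := hA.isDecayContour_sectorBoundary
  have hray := fun t (ht : t ∈ raySet ∧ t ≠ 3) => bcurve_mem_dstolz hβ hβγ hlt ht.1 ht.2
  refine (((hdc.integrable (s / 2) (half_pos hs)).mul_prod
    (integrableOn_raySet_wt hβ (hβγ.trans hlt) (half_pos hs))).const_mul
    (M * (2 / (1 - angleConst θ α γ)) * 2 * K * ‖Q‖)).mono' ?_ ?_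
  · have m1 := (aestronglyMeasurable_comp_of_continuousOn (isOpen_dstolz γ) hg
      (measurable_bcurve β) (ae_raySet.mono hray)).comp_snd (μ := volume.restrict (univ : Set ℝ))
    have m2 := (aestronglyMeasurable_comp_of_continuousOn hA.isOpen_sector_inter
      ((differentiableOn_resolvent a).continuousOn.mono fun w hw => h.left_mem hw.2)
      hdc.measurable hdc.mem).comp_fst (ν := volume.restrict raySet)
    have m3 : Measurable fun p : ℝ × ℝ => ker (bcurve β p.2) (sectorBoundary ν p.1) := by
      have hx := (measurable_bcurve β).comp (measurable_snd : Measurable (Prod.snd : ℝ × ℝ → ℝ))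
      have hy := hdc.measurable.comp (measurable_fst : Measurable (Prod.fst : ℝ × ℝ → ℝ))
      unfold ker
      exact (hx.sub hy).inv.sub (hx.add hy).inv
    have m4 := ((measurable_deriv (sectorBoundary ν)).comp
      (measurable_fst : Measurable (Prod.fst : ℝ × ℝ → ℝ))).aestronglyMeasurable
      (μ := (volume.restrict univ).prod (volume.restrict raySet))
    exact ((((measurable_deriv _).comp measurable_snd).aestronglyMeasurable.mul m1).mul
      m3.aestronglyMeasurable).smul (m4.smul (m2.mul_const Q))
  · filter_upwards [Measure.quasiMeasurePreserving_fst.ae hdc.mem,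
      Measure.quasiMeasurePreserving_snd.ae ae_raySet] with p hp1 hp2
    obtain ⟨hb0, hbre, -⟩ := bcurve_on_raySet hβ (hβγ.trans hlt) hp2.1 hp2.2
    have hk := (norm_ker_ray_le hθ hA.lt_stolz hαβ.le hβγ.le hlt hb0 hbre hp1.1).2.2
    have hw := wt_mul_div_le hs (by linarith) (norm_pos_iff.2 hb0)
      (norm_nonneg (sectorBoundary ν p.1))
    have hgb := hb _ (hray _ hp2)
    have hr := h.left_le' hp1.2
    have hr' : ‖resolvent a (sectorBoundary ν p.1) * Q‖ ≤ K / ‖sectorBoundary ν p.1‖ * ‖Q‖ :=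
      (norm_mul_le _ _).trans (mul_le_mul_of_nonneg_right hr (norm_nonneg _))
    have hwn := wt_nonneg (norm_nonneg (bcurve β p.2)) s
    rw [norm_smul, norm_smul, norm_mul, norm_mul]
    calc _ ≤ ‖deriv (bcurve β) p.2‖ * (M * wt s ‖bcurve β p.2‖) * (2 / (1 - angleConst θ α γ) *
          (‖sectorBoundary ν p.1‖ / (‖bcurve β p.2‖ ^ 2 + ‖sectorBoundary ν p.1‖ ^ 2))) *
          (‖deriv (sectorBoundary ν) p.1‖ * (K / ‖sectorBoundary ν p.1‖ * ‖Q‖)) := by gcongr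
      _ = ‖deriv (bcurve β) p.2‖ * M * (2 / (1 - angleConst θ α γ)) *
          (‖deriv (sectorBoundary ν) p.1‖ * (K / ‖sectorBoundary ν p.1‖ * ‖Q‖)) *
          (wt s ‖bcurve β p.2‖ * (‖sectorBoundary ν p.1‖ /
            (‖bcurve β p.2‖ ^ 2 + ‖sectorBoundary ν p.1‖ ^ 2))) := by ring
      _ ≤ ‖deriv (bcurve β) p.2‖ * M * (2 / (1 - angleConst θ α γ)) *
          (‖deriv (sectorBoundary ν) p.1‖ * (K / ‖sectorBoundary ν p.1‖ * ‖Q‖)) *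
          (2 * (wt (s / 2) ‖bcurve β p.2‖ / ‖bcurve β p.2‖) *
            wt (s / 2) ‖sectorBoundary ν p.1‖) := by gcongr
      _ = _ := by ring

/-- The integral of `kerOp` over the segments of a Stolz boundary is the integral of the resolvent
against the transformed function over a sector boundary. -/
lemma integral_rayTransform (h : SectorStolzBound a ν₁ δ K) (hA : AngleChain ν₁ ν θ δ α γ)
    (hαβ : α < β) (hβγ : β < γ) {g : ℂ → ℂ} (hg : ContinuousOn g (dstolz γ)) {M s : ℝ}
    (hM : 0 ≤ M) (hs : 0 < s) (hs1 : s ≤ 1) (hb : ∀ z ∈ dstolz γ, ‖g z‖ ≤ M * wt s ‖z‖)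
    (Q : X →L[ℂ] X) :
    ∫ t in univ, deriv (sectorBoundary ν) t • (((2 * Real.pi * Complex.I)⁻¹ * ∫ u in raySet,
      deriv (bcurve β) u * g (bcurve β u) * ker (bcurve β u) (sectorBoundary ν t)) •
        (resolvent a (sectorBoundary ν t) * Q)) =
      ∫ u in raySet, deriv (bcurve β) u • (g (bcurve β u) • (kerOp a (bcurve β u) * Q)) := by
  have hlt := hA.lt
  have hβ : 0 < β := by linarith [hA.delta_pos, hA.delta_lt]
  have hpi : (2 * Real.pi * Complex.I : ℂ) ≠ 0 := Complex.two_pi_I_ne_zero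
  have e1 : ∀ t, deriv (sectorBoundary ν) t • (((2 * Real.pi * Complex.I)⁻¹ * ∫ u in raySet,
      deriv (bcurve β) u * g (bcurve β u) * ker (bcurve β u) (sectorBoundary ν t)) •
        (resolvent a (sectorBoundary ν t) * Q)) = (2 * Real.pi * Complex.I : ℂ)⁻¹ •
      ∫ u in raySet, (deriv (bcurve β) u * g (bcurve β u) *
        ker (bcurve β u) (sectorBoundary ν t)) • (deriv (sectorBoundary ν) t •
        (resolvent a (sectorBoundary ν t) * Q)) := fun t => by
    rw [integral_smul_const, smul_comm, mul_smul]
  simp_rw [e1]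
  -- After the swap the inner integral is the sectorial calculus of `ker z` at a fixed `z` on a
  -- segment, that is `2πi kerOp a z`, and the prefactor cancels.
  rw [integral_smul, integral_integral_swap
    (integrable_ker_prod h hA hαβ hβγ hg hM hs hs1 hb Q), ← integral_smul]
  refine integral_congr_ae ?_
  filter_upwards [ae_raySet] with u hu
  obtain ⟨hb0, hbre, -⟩ := bcurve_on_raySet hβ (hβγ.trans hlt) hu.1 hu.2
  have e2 := integral_sectorBoundary_ker h hA hαβ hβγ hb0 hbre
    (deriv (bcurve β) u * g (bcurve β u)) Q
  rw [Measure.restrict_univ]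
  simp_rw [smul_comm (_ * _ : ℂ) (deriv (sectorBoundary ν) _)]
  rw [e2, inv_smul_smul₀ hpi, mul_smul]

end Operator

/-! ### Converting one variable from a sector boundary to a Stolz boundary. -/

section Conversion

variable {X : Type*} [NormedAddCommGroup X] [NormedSpace ℂ X]

/-- Two contour integrals which differ in the variable `i` only, where the first one is taken over
the boundary of a sector and the second one over the boundary of a reflected Stolz domain. -/
structure Conversion {n : ℕ} (A : Fin (n + 1) → X →L[ℂ] X) (D D' : Fin (n + 1) → Set ℂ)
    (S S' : Fin (n + 1) → Set ℝ) (c c' : Fin (n + 1) → ℝ → ℂ) (i : Fin (n + 1))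
    (ν₁ ν θ δ α β γ K : ℝ) : Prop where
  comm : ∀ j k, Commute (A j) (A k)
  isOpen : ∀ j, IsOpen (D j)
  isOpen' : ∀ j, IsOpen (D' j)
  admissible : ∀ j, Admissible (A j) (D j) (S j) (c j)
  admissible' : ∀ j, Admissible (A j) (D' j) (S' j) (c' j)
  bound : SectorStolzBound (A i) ν₁ δ K
  chain : AngleChain ν₁ ν θ δ α γ
  lt_angle : α < β
  angle_lt : β < γ
  domain : D i = sector θ
  domain' : D' i = dstolz γ
  domain_rest : ∀ j, D' (i.succAbove j) = D (i.succAbove j)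
  set : S i = univ
  set' : S' i = Icc 0 3
  set_rest : ∀ j, S' (i.succAbove j) = S (i.succAbove j)
  curve : c i = sectorBoundary ν
  curve' : c' i = bcurve β
  curve_rest : ∀ j, c' (i.succAbove j) = c (i.succAbove j)

/-- Since `kerOp a z = -2 a R(z) R(-z)`, a change of base point only inserts `R(z) R(-z)` and the
inverse of `R(w) R(-w)`. Away from `0` and the spectrum all values of `kerOp` are bounded multiples
of a single one. -/
lemma kerOp_factor {a : X →L[ℂ] X} {z w : ℂ} (hz : z ∈ resolventSet ℂ a)
    (hz' : -z ∈ resolventSet ℂ a) (hw : w ∈ resolventSet ℂ a) (hw' : -w ∈ resolventSet ℂ a) :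
    kerOp a z = resolvent a z * resolvent a (-z) *
      ((algebraMap ℂ (X →L[ℂ] X) (-w) - a) * (algebraMap ℂ (X →L[ℂ] X) w - a)) * kerOp a w := by
  have hP : ∀ v : ℂ, (algebraMap ℂ (X →L[ℂ] X) v - a) * a =
      a * (algebraMap ℂ (X →L[ℂ] X) v - a) := fun v => by
    rw [sub_mul, mul_sub, Algebra.commutes]
  have h1 : (algebraMap ℂ (X →L[ℂ] X) (-w) - a) * (algebraMap ℂ (X →L[ℂ] X) w - a) *
      (a * (resolvent a w * resolvent a (-w))) = a := by
    calc _ = (algebraMap ℂ (X →L[ℂ] X) (-w) - a) * ((algebraMap ℂ (X →L[ℂ] X) w - a) * a) *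
          (resolvent a w * resolvent a (-w)) := by noncomm_ring
      _ = ((algebraMap ℂ (X →L[ℂ] X) (-w) - a) * a) * ((algebraMap ℂ (X →L[ℂ] X) w - a) *
          resolvent a w) * resolvent a (-w) := by rw [hP]; noncomm_ring
      _ = a * ((algebraMap ℂ (X →L[ℂ] X) (-w) - a) * resolvent a (-w)) := by
          rw [self_mul_resolvent hw, hP]; noncomm_ring
      _ = a := by rw [self_mul_resolvent hw', mul_one]
  rw [kerOp_eq hz hz', kerOp_eq hw hw', mul_smul_comm, mul_smul_comm, mul_smul_comm, mul_assoc _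
    (_ * _ : X →L[ℂ] X) (a * _), h1, mul_assoc, resolvent_mul_right hz', ← resolvent_mul_left hz',
    ← mul_assoc, ← mul_assoc (resolvent a z), resolvent_mul_right hz, ← resolvent_mul_left hz]

lemma norm_algebraMap_sub_le (a : X →L[ℂ] X) {w : ℂ} (hw : ‖w‖ = 1) :
    ‖algebraMap ℂ (X →L[ℂ] X) w - a‖ ≤ 1 + ‖a‖ := by
  refine (norm_sub_le _ _).trans (add_le_add_left ?_ _)
  rw [norm_algebraMap, hw, one_mul]
  exact ContinuousLinearMap.norm_id_le

variable [CompleteSpace X] {n : ℕ} {A : Fin (n + 1) → X →L[ℂ] X} {D D' : Fin (n + 1) → Set ℂ}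
  {S S' : Fin (n + 1) → Set ℝ} {c c' : Fin (n + 1) → ℝ → ℂ} {i : Fin (n + 1)}
  {ν₁ ν θ δ α β γ K : ℝ} {f : (Fin (n + 1) → ℂ) → ℂ}

lemma rayTransform_insertNth (w : ℂ) (ζ : Fin n → ℂ) : rayTransform β i f (i.insertNth w ζ) =
    (2 * Real.pi * Complex.I)⁻¹ * ∫ u in raySet, deriv (bcurve β) u *
      f (i.insertNth (bcurve β u) ζ) * ker (bcurve β u) w := by
  simp [rayTransform, rayIntegrand]

lemma integrable_iterated (hD : ∀ i, IsOpen (D i))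
    (h : ∀ i, Admissible (A i) (D i) (S i) (c i)) (hf : IsHZero D f) (i : Fin (n + 1)) :
    Integrable (fun τ => curveDeriv (fun j => c (i.succAbove j)) τ •
      (∫ t in S i, deriv (c i) t •
        (f (i.insertNth (c i t) (curvePt (fun j => c (i.succAbove j)) τ)) •
        (resolvent (A i) (c i t) * resolventProd (fun j => A (i.succAbove j))
          (curvePt (fun j => c (i.succAbove j)) τ)))))
      (paramMeasure fun j => S (i.succAbove j)) := by
  refine (integrable_contour_split hD h hf i).integral_prod_right.congr (.of_forall fun τ => ?_)
  simp only
  rw [← integral_smul]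
  refine integral_congr_ae (.of_forall fun t => ?_)
  simp only
  rw [mul_comm, mul_smul]

lemma Conversion.integrable_arc (H : Conversion A D D' S S' c c' i ν₁ ν θ δ α β γ K)
    (hf : IsHZero D' f) :
    Integrable (fun p : ℝ × (Fin n → ℝ) =>
      (deriv (bcurve β) p.1 * curveDeriv (fun j => c (i.succAbove j)) p.2) •
      (f (i.insertNth (bcurve β p.1) (curvePt (fun j => c (i.succAbove j)) p.2)) •
        (kerOp (A i) (bcurve β p.1) * resolventProd (fun j => A (i.succAbove j))
          (curvePt (fun j => c (i.succAbove j)) p.2))))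
      ((volume.restrict (Ioc 1 2)).prod (paramMeasure fun j => S (i.succAbove j))) := by
  obtain ⟨⟨hd, -⟩, C, s, hC, hs, hb⟩ := hf
  have hdc := H.chain.isDecayContour_bcurve H.lt_angle H.angle_lt
  have hsub : Ioc (1 : ℝ) 2 ⊆ Icc 0 3 := fun t ht => ⟨by linarith [ht.1], by linarith [ht.2]⟩
  have hV : IsOpen (dstolz γ \ cdstolz δ) := isOpen_dstolz_sdiff H.chain.delta_pos
    (H.chain.delta_lt.trans (H.chain.le.trans_lt H.chain.lt))
  have hmem : ∀ᵐ t ∂volume.restrict (Ioc (1 : ℝ) 2), bcurve β t ∈ dstolz γ \ cdstolz δ :=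
    ae_restrict_of_ae_restrict_of_subset hsub hdc.mem
  have hVD : dstolz γ \ cdstolz δ ⊆ D' i := by
    rw [H.domain']
    exact sdiff_subset
  refine integrable_split (fun j => H.admissible (i.succAbove j)) hs (k := fun z => wt s ‖z‖)
    (C := C) hV (fun j => H.isOpen _) hdc.measurable hmem (continuousOn_kerOp H.bound H.chain) ?_
    ?_ ?_
  · have := (continuousOn_insertNth hd i).mono (prod_mono_left hVD)
    simpa only [H.domain_rest] using this
  · refine (((hdc.integrable s hs).mono_set hsub).const_mul (2 * K)).mono' ?_ ?_
    · have m1 := aestronglyMeasurable_comp_of_continuousOn hV (continuousOn_kerOp H.bound H.chain)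
        hdc.measurable hmem
      exact (measurable_deriv _).norm.aestronglyMeasurable.mul
        (((measurable_wt s).comp hdc.measurable.norm).aestronglyMeasurable.mul m1.norm)
    · filter_upwards [hmem] with t ht
      have hw := wt_nonneg (norm_nonneg (bcurve β t)) s
      rw [Real.norm_of_nonneg (by positivity)]
      calc ‖deriv (bcurve β) t‖ * (wt s ‖bcurve β t‖ * ‖kerOp (A i) (bcurve β t)‖)
          ≤ ‖deriv (bcurve β) t‖ * (wt s ‖bcurve β t‖ * (2 * K / ‖bcurve β t‖)) := by
            gcongr
            exact norm_kerOp_le H.bound H.chain ht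
        _ = _ := by ring
  · intro z hz ζ hζ
    exact decay_insertNth hb i (hVD hz) (by simpa only [H.domain_rest] using hζ)

/-- A contour integral over a Stolz boundary in the variable `i` is the sum of a contour integral
over a sector boundary and an integral over a circular arc. -/
theorem Conversion.contourIntegral_eq (H : Conversion A D D' S S' c c' i ν₁ ν θ δ α β γ K)
    (hf : IsHZero D' f) :
    contourIntegral S' c' (fun z => f z • resolventProd A z) =
      contourIntegral S c (fun z => rayTransform β i f z • resolventProd A z) +
      ∫ u in Ioc 1 2, ∫ τ, (deriv (bcurve β) u * curveDeriv (fun j => c (i.succAbove j)) τ) •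
      (f (i.insertNth (bcurve β u) (curvePt (fun j => c (i.succAbove j)) τ)) •
        (kerOp (A i) (bcurve β u) * resolventProd (fun j => A (i.succAbove j))
          (curvePt (fun j => c (i.succAbove j)) τ))) ∂(paramMeasure fun j => S (i.succAbove j)) := by
  have hθ : 0 ≤ θ := by linarith [H.chain.pos, H.chain.lt_left, H.chain.lt_sector]
  have hP := isHZero_rayTransform H.isOpen hθ H.chain.lt_stolz H.lt_angle.le H.angle_lt H.chain.lt
    H.domain H.domain' H.domain_rest hf
  have harc := H.integrable_arc hf
  rw [integral_integral_swap harc, contourIntegral_eq_iterated H.comm H.isOpen H.admissible hP i,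
    contourIntegral_eq_iterated H.comm H.isOpen' H.admissible' hf i,
    ← integral_add (integrable_iterated H.isOpen H.admissible hP i)
      harc.integral_prod_right]
  simp_rw [H.set_rest, H.curve_rest]
  refine integral_congr_ae ?_
  have hfd := hf.1.1
  obtain ⟨C, s, hC, hs, hs1, hb⟩ := hf.exists_decay
  filter_upwards [ae_curvePt_mem_of_admissible (fun j => H.admissible (i.succAbove j))] with τ hτ
  set ζ := curvePt (fun j => c (i.succAbove j)) τ
  set Q := resolventProd (fun j => A (i.succAbove j)) ζ
  have hζ : ζ ∈ prodDomain fun j => D' (i.succAbove j) := by simpa only [H.domain_rest] using hτ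
  have hgd := differentiableOn_insertNth hfd i hζ
  have hgb := fun z (hz : z ∈ D' i) => decay_insertNth hb i hz hζ
  rw [H.domain'] at hgd hgb
  have hw : 0 ≤ ∏ j, wt s ‖ζ j‖ := Finset.prod_nonneg fun j _ => wt_nonneg (norm_nonneg _) s
  have hgb' : ∀ z ∈ dstolz γ, ‖f (i.insertNth z ζ)‖ ≤ (C * ∏ j, wt s ‖ζ j‖) * wt s ‖z‖ :=
    fun z hz => (hgb z hz).trans_eq (by ring)
  have e1 := integral_bcurve_kerOp H.bound H.chain H.lt_angle H.angle_lt
    (g := fun z => f (i.insertNth z ζ)) hgd (by positivity) hs hgb' Q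
  have e2 := integral_rayTransform H.bound H.chain H.lt_angle H.angle_lt
    (g := fun z => f (i.insertNth z ζ)) hgd.continuousOn (by positivity) hs hs1 hgb' Q
  rw [H.set, H.set', H.curve, H.curve']
  simp only [rayTransform_insertNth]
  rw [e1, e2, smul_add]
  congr 1
  rw [← integral_smul]
  refine integral_congr_ae (.of_forall fun u => ?_)
  simp only
  rw [mul_comm, mul_smul]

/-- The variable `i` of `f` is frozen at `b` and the kernel `ker z₀` fills its place. The assumed
bound applies to this function, and the contour integral in the variable `i` evaluates to `2πi kerOp
z₀`. -/
lemma Conversion.slice (H : Conversion A D D' S S' c c' i ν₁ ν θ δ α β γ K)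
    (hf : IsHZero D' f) {z₀ b : ℂ} (hz₀ : ‖z₀‖ = 1) (hre : z₀.re = ‖z₀‖ * Real.cos β)
    (hbm : b ∈ dstolz γ) {C : ℝ} (hC : 0 ≤ C)
    (hcalc : ∀ g, IsHZero D g → ‖contourIntegral S c (fun z => g z • resolventProd A z)‖ ≤
      C * supNorm (prodDomain D) g) :
    Integrable (fun τ => curveDeriv (fun j => c (i.succAbove j)) τ •
      (f (i.insertNth b (curvePt (fun j => c (i.succAbove j)) τ)) •
        (kerOp (A i) z₀ * resolventProd (fun j => A (i.succAbove j))
          (curvePt (fun j => c (i.succAbove j)) τ)))) (paramMeasure fun j => S (i.succAbove j)) ∧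
    2 * Real.pi * ‖∫ τ, curveDeriv (fun j => c (i.succAbove j)) τ •
      (f (i.insertNth b (curvePt (fun j => c (i.succAbove j)) τ)) •
        (kerOp (A i) z₀ * resolventProd (fun j => A (i.succAbove j))
          (curvePt (fun j => c (i.succAbove j)) τ))) ∂(paramMeasure fun j => S (i.succAbove j))‖ ≤
      C * (1 / (1 - angleConst θ α γ) * supNorm (prodDomain D') f) := by
  have hθ : 0 ≤ θ := by linarith [H.chain.pos, H.chain.lt_left, H.chain.lt_sector]
  obtain ⟨hG, hle⟩ := isHZero_slice_mul_ker hθ H.chain.lt_stolz H.lt_angle.le H.angle_lt H.chain.lt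
    H.domain H.domain' H.domain_rest hf hz₀ hre hbm
  have hz0 : z₀ ≠ 0 := norm_pos_iff.1 (hz₀ ▸ one_pos)
  have h1 := integrable_iterated H.isOpen H.admissible hG i
  have h2 := contourIntegral_eq_iterated H.comm H.isOpen H.admissible hG i
  have h3 := hcalc _ hG
  simp only [H.set, H.curve, Fin.insertNth_apply_same, Fin.insertNth_apply_succAbove,
    Measure.restrict_univ, integral_sectorBoundary_ker H.bound H.chain H.lt_angle H.angle_lt hz0
      hre] at h1 h2
  simp_rw [smul_comm _ (2 * (Real.pi : ℂ) * Complex.I)] at h1 h2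
  rw [integral_smul] at h2
  refine ⟨(h1.smul (2 * (Real.pi : ℂ) * Complex.I)⁻¹).congr (.of_forall fun τ => ?_), ?_⟩
  · exact inv_smul_smul₀ Complex.two_pi_I_ne_zero _
  · rw [h2, norm_smul, norm_mul, norm_mul, Complex.norm_I, Complex.norm_real, Complex.norm_ofNat,
      Real.norm_of_nonneg Real.pi_pos.le, mul_one] at h3
    exact h3.trans (mul_le_mul_of_nonneg_left hle hC)

/-- The factor by which the bound for contour integrals grows in a conversion. -/
def conversionConst (θ α γ K : ℝ) (a : X →L[ℂ] X) : ℝ :=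
  (1 + (K / Real.cos γ ^ 2 * (1 + ‖a‖)) ^ 2) * (1 / (1 - angleConst θ α γ))

/-- The point of the arc enters only through the value at which `f` is frozen and a bounded operator
factor `N`. With `kerOp` moved to `z₀ = exp (iβ)`, `Conversion.slice` bounds the remaining integral
uniformly along the arc. -/
lemma Conversion.norm_arc_le (H : Conversion A D D' S S' c c' i ν₁ ν θ δ α β γ K)
    (hf : IsHZero D' f) {C : ℝ} (hC : 0 ≤ C)
    (hcalc : ∀ g, IsHZero D g → ‖contourIntegral S c (fun z => g z • resolventProd A z)‖ ≤
      C * supNorm (prodDomain D) g) {u : ℝ} (hu : u ∈ Ioo (1 : ℝ) 2) :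
    ‖∫ τ, (deriv (bcurve β) u * curveDeriv (fun j => c (i.succAbove j)) τ) •
      (f (i.insertNth (bcurve β u) (curvePt (fun j => c (i.succAbove j)) τ)) •
        (kerOp (A i) (bcurve β u) * resolventProd (fun j => A (i.succAbove j))
          (curvePt (fun j => c (i.succAbove j)) τ))) ∂(paramMeasure fun j => S (i.succAbove j))‖ ≤
      (K / Real.cos γ ^ 2 * (1 + ‖A i‖)) ^ 2 *
        (C * (1 / (1 - angleConst θ α γ) * supNorm (prodDomain D') f)) := by
  have hlt := H.chain.lt
  have hβ : 0 < β := by linarith [H.chain.delta_pos, H.chain.delta_lt, H.lt_angle]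
  have hβ' : β < Real.pi / 2 := H.angle_lt.trans hlt
  have hδβ : δ < β := H.chain.delta_lt.trans H.lt_angle
  have hK := H.chain.nonneg H.bound
  have hν₁ : ν₁ < γ := by
    linarith [H.chain.lt_left, H.chain.lt_sector, H.chain.lt_stolz, H.chain.le]
  have hu' : u ∈ Icc (1 : ℝ) 2 := ⟨hu.1.le, hu.2.le⟩
  have hb : bcurve β u = arc β u := bcurve_of_mem_Ioc ⟨hu.1, hu.2.le⟩
  have hbD : bcurve β u ∈ dstolz γ := hb ▸ arc_mem_dstolz hβ H.angle_lt hlt u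
  have hbδ : bcurve β u ∉ cdstolz δ :=
    hb ▸ arc_notMem_cdstolz H.chain.delta_pos hδβ hβ' hu'
  have hneg := neg_mem_leftRegion H.chain.pos (hν₁.trans hlt) (H.chain.pos.trans hν₁) hlt hbD
  have hz₀ : ‖Complex.exp ((β : ℂ) * Complex.I)‖ = 1 := Complex.norm_exp_ofReal_mul_I β
  have hre : (Complex.exp ((β : ℂ) * Complex.I)).re =
      ‖Complex.exp ((β : ℂ) * Complex.I)‖ * Real.cos β := by
    rw [hz₀, one_mul, Complex.exp_ofReal_mul_I_re]
  set z₀ := Complex.exp ((β : ℂ) * Complex.I)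
  have hz0 : z₀ ≠ 0 := norm_pos_iff.1 (hz₀ ▸ one_pos)
  have hcβ : 0 < Real.cos β := Real.cos_pos_of_mem_Ioo ⟨by linarith, hβ'⟩
  have hcγ : 0 < Real.cos γ := Real.cos_pos_of_mem_Ioo ⟨by linarith [H.angle_lt], hlt⟩
  have hcν : 0 < Real.cos ν₁ :=
    Real.cos_pos_of_mem_Ioo ⟨by linarith [H.chain.pos], hν₁.trans hlt⟩
  have hz₀neg : -z₀ ∈ leftRegion ν₁ := by
    simp only [leftRegion, mem_ofPred_eq, Complex.neg_re, norm_neg]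
    rw [hre, hz₀]
    linarith
  have hfac := kerOp_factor (H.bound.out_mem hbδ) (H.bound.left_mem hneg) (w := z₀)
    (H.bound.out_mem (ray_notMem_cdstolz H.chain.delta_pos hδβ hβ' hz0 hre))
    (H.bound.left_mem hz₀neg)
  set N := resolvent (A i) (bcurve β u) * resolvent (A i) (-bcurve β u) *
    ((algebraMap ℂ (X →L[ℂ] X) (-z₀) - A i) * (algebraMap ℂ (X →L[ℂ] X) z₀ - A i))
  have hnb : Real.cos γ ^ 2 ≤ ‖bcurve β u‖ := by
    refine le_trans ?_ (hb ▸ cos_sq_le_norm_arc hβ hβ' hu')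
    have := Real.cos_le_cos_of_nonneg_of_le_pi hβ.le (by linarith [Real.pi_pos]) H.angle_lt.le
    gcongr
  have hN : ‖N‖ ≤ (K / Real.cos γ ^ 2 * (1 + ‖A i‖)) ^ 2 := by
    have r1 : ‖resolvent (A i) (bcurve β u)‖ ≤ K / Real.cos γ ^ 2 :=
      (H.bound.out_le _ hbδ).trans (by gcongr)
    have r2 : ‖resolvent (A i) (-bcurve β u)‖ ≤ K / Real.cos γ ^ 2 :=
      (H.bound.left_le' hneg).trans (by rw [norm_neg]; gcongr)
    have r3 := norm_algebraMap_sub_le (A i) hz₀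
    have r4 := norm_algebraMap_sub_le (A i) ((norm_neg z₀).trans hz₀)
    calc ‖N‖ ≤ (‖resolvent (A i) (bcurve β u)‖ * ‖resolvent (A i) (-bcurve β u)‖) *
          (‖algebraMap ℂ (X →L[ℂ] X) (-z₀) - A i‖ * ‖algebraMap ℂ (X →L[ℂ] X) z₀ - A i‖) :=
          (norm_mul_le _ _).trans (mul_le_mul (norm_mul_le _ _) (norm_mul_le _ _)
            (norm_nonneg _) (by positivity))
      _ ≤ (K / Real.cos γ ^ 2 * (K / Real.cos γ ^ 2)) * ((1 + ‖A i‖) * (1 + ‖A i‖)) := by gcongr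
      _ = _ := by ring
  obtain ⟨hint, hle⟩ := H.slice hf hz₀ hre hbD hC hcalc
  have hd : ‖deriv (bcurve β) u‖ ≤ 2 * Real.pi := by
    have hs := (sin_pos_of_mem hβ hβ').le
    rw [deriv_bcurve_of_mem_Ioo hu, norm_arc' hβ.le hs]
    calc Real.sin β * (Real.pi + 2 * β) ≤ 1 * (2 * Real.pi) :=
          mul_le_mul (Real.sin_le_one β) (by linarith) (by linarith [Real.pi_pos]) zero_le_one
      _ = _ := one_mul _
  have hpt : ∀ τ, (deriv (bcurve β) u * curveDeriv (fun j => c (i.succAbove j)) τ) •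
      (f (i.insertNth (bcurve β u) (curvePt (fun j => c (i.succAbove j)) τ)) •
        (kerOp (A i) (bcurve β u) * resolventProd (fun j => A (i.succAbove j))
          (curvePt (fun j => c (i.succAbove j)) τ))) = deriv (bcurve β) u • (N *
      (curveDeriv (fun j => c (i.succAbove j)) τ •
      (f (i.insertNth (bcurve β u) (curvePt (fun j => c (i.succAbove j)) τ)) •
        (kerOp (A i) z₀ * resolventProd (fun j => A (i.succAbove j))
          (curvePt (fun j => c (i.succAbove j)) τ))))) := fun τ => by
    rw [hfac, mul_smul_comm, mul_smul_comm, mul_smul, mul_assoc N]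
  simp_rw [hpt]
  rw [integral_smul, integral_const_mul_of_integrable hint, norm_smul]
  refine (mul_le_mul_of_nonneg_left (norm_mul_le _ _) (norm_nonneg _)).trans ?_
  -- The speed of the arc is at most `2π`, exactly the factor carried by the left side of
  -- `Conversion.slice`.
  calc _ ≤ 2 * Real.pi * ((K / Real.cos γ ^ 2 * (1 + ‖A i‖)) ^ 2 * _) :=
        mul_le_mul hd (mul_le_mul_of_nonneg_right hN (norm_nonneg _)) (by positivity)
          (by positivity)
    _ = (K / Real.cos γ ^ 2 * (1 + ‖A i‖)) ^ 2 * (2 * Real.pi * _) := by ring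
    _ ≤ _ := mul_le_mul_of_nonneg_left hle (by positivity)

/-- A bound for contour integrals carries over to the converted contour integrals. -/
theorem Conversion.norm_contourIntegral_le
    (H : Conversion A D D' S S' c c' i ν₁ ν θ δ α β γ K) {C : ℝ} (hC : 0 ≤ C)
    (hcalc : ∀ g, IsHZero D g → ‖contourIntegral S c (fun z => g z • resolventProd A z)‖ ≤
      C * supNorm (prodDomain D) g) (hf : IsHZero D' f) :
    ‖contourIntegral S' c' (fun z => f z • resolventProd A z)‖ ≤
      C * conversionConst θ α γ K (A i) * supNorm (prodDomain D') f := by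
  have hθ : 0 ≤ θ := by linarith [H.chain.pos, H.chain.lt_left, H.chain.lt_sector]
  have hc : 0 < 1 - angleConst θ α γ :=
    sub_pos.2 (angleConst_lt_one hθ H.chain.lt_stolz H.chain.le H.chain.lt)
  have hsup := supNorm_nonneg (prodDomain D') f
  have hP := isHZero_rayTransform H.isOpen hθ H.chain.lt_stolz H.lt_angle.le H.angle_lt H.chain.lt
    H.domain H.domain' H.domain_rest hf
  have h1 := (hcalc _ hP).trans (mul_le_mul_of_nonneg_left (supNorm_le (by positivity)
    fun y hy => norm_rayTransform_le hθ H.chain.lt_stolz H.lt_angle.le H.angle_lt H.chain.lt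
      H.domain H.domain' H.domain_rest hf.1 hy) hC)
  -- The endpoints are dropped because the curve has corners there; the parameter interval of the
  -- arc has length `1`, so the pointwise bound is already the bound for the integral.
  rw [H.contourIntegral_eq hf, ← integral_Icc_eq_integral_Ioc, integral_Icc_eq_integral_Ioo]
  have h2 := norm_setIntegral_le_of_norm_le_const (μ := volume) (s := Ioo (1 : ℝ) 2) (by simp)
    fun u hu => H.norm_arc_le hf hC hcalc hu
  have h3 : (volume : Measure ℝ).real (Ioo 1 2) = 1 := by simp; norm_num
  rw [h3, mul_one] at h2
  refine (norm_add_le _ _).trans ((add_le_add h1 h2).trans_eq ?_)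
  rw [conversionConst]
  ring

end Conversion

/-! ### From the calculus of `1 - T` to the calculus of `T` -/

section

variable {X : Type*} [NormedAddCommGroup X] [NormedSpace ℂ X]

lemma IsSectorialOfType.leftRegion_bound {a : X →L[ℂ] X} {ω ν₁ : ℝ} (h : IsSectorialOfType a ω)
    (hω : ω < ν₁) (hν : ν₁ < Real.pi) : leftRegion ν₁ ⊆ resolventSet ℂ a ∧
      ∃ K : ℝ, ∀ w ∈ leftRegion ν₁, ‖w‖ * ‖resolvent a w‖ ≤ K := by
  obtain ⟨⟨h0, h1⟩, hs, hb⟩ := h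
  have hout : ∀ w ∈ leftRegion ν₁, w ∉ closure (sector ν₁) := fun w hw hc =>
    absurd (closure_sector_subset (h0.trans hω).le hν.le hc)
      (not_le.2 (show w.re < ‖w‖ * Real.cos ν₁ from hw))
  refine ⟨fun w hw => ?_, ?_⟩
  · by_contra hc
    exact hout w hw (closure_mono (sector_mono hω.le) (hs hc))
  · obtain ⟨K, hK⟩ := (hb ν₁ ⟨hω, hν⟩).exists_norm_le
    refine ⟨K, fun w hw => ?_⟩
    rw [← norm_smul]
    exact hK _ (mem_image_of_mem _ (hout w hw))

lemma exists_sectorStolzBound {T : X →L[ℂ] X} {ω ν₁ α δ : ℝ}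
    (h : IsSectorialOfType (ContinuousLinearMap.id ℂ X - T) ω) (hω : ω < ν₁) (hν : ν₁ < Real.pi)
    (hT : IsRittOfType T α) (hα : α < δ) (hδ : δ < Real.pi / 2) :
    ∃ K, SectorStolzBound (ContinuousLinearMap.id ℂ X - T) ν₁ δ K := by
  obtain ⟨h1, K₁, hK₁⟩ := h.leftRegion_bound hω hν
  obtain ⟨h2, K₂, hK₂⟩ := hT.resolvent_bound hα hδ
  refine ⟨max K₁ K₂, h1, fun w hw => (hK₁ w hw).trans (le_max_left _ _), h2, fun w hw =>
    (hK₂ w hw).trans ?_⟩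
  gcongr
  exact le_max_right _ _

lemma norm_two_pi_I : ‖(2 * (Real.pi : ℂ) * Complex.I)‖ = 2 * Real.pi := by
  rw [norm_mul, norm_mul, Complex.norm_I, Complex.norm_real, Complex.norm_ofNat,
    Real.norm_of_nonneg Real.pi_pos.le, mul_one]

lemma conversionConst_nonneg {ν₁ ν θ δ α γ K : ℝ} (h : AngleChain ν₁ ν θ δ α γ) (a : X →L[ℂ] X) :
    0 ≤ conversionConst θ α γ K a := by
  have hθ : 0 ≤ θ := by linarith [h.pos, h.lt_left, h.lt_sector]
  have := angleConst_lt_one hθ h.lt_stolz h.le h.lt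
  refine mul_nonneg (by positivity) (div_nonneg zero_le_one (by linarith))

variable [CompleteSpace X]

/-- A bound for the calculus on a product of sectors gives a bound for contour integrals in which
the variables from `s` run over Stolz boundaries. -/
theorem exists_bound_mixed_contour {n : ℕ} {A : Fin n → X →L[ℂ] X}
    (hA : ∀ i j, Commute (A i) (A j)) {ν₁ ν θ δ α γ K : Fin n → ℝ}
    (hchain : ∀ i, AngleChain (ν₁ i) (ν i) (θ i) (δ i) (α i) (γ i))
    (hbound : ∀ i, SectorStolzBound (A i) (ν₁ i) (δ i) (K i)) {C : ℝ} (hC : 0 ≤ C)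
    (hcalc : ∀ f, IsHZero (fun i => sector (θ i)) f →
      ‖contourIntegral (fun _ => univ) (fun i => sectorBoundary (ν i))
        (fun z => f z • resolventProd A z)‖ ≤
        C * supNorm (prodDomain fun i => sector (θ i)) f) (s : Finset (Fin n)) :
    ∃ C' : ℝ, 0 ≤ C' ∧ ∀ β : Fin n → ℝ, (∀ i, β i ∈ Ioo (α i) (γ i)) →
      ∀ f, IsHZero (fun i => if i ∈ s then dstolz (γ i) else sector (θ i)) f →
      ‖contourIntegral (fun i => if i ∈ s then Icc 0 3 else univ)
        (fun i => if i ∈ s then bcurve (β i) else sectorBoundary (ν i))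
        (fun z => f z • resolventProd A z)‖ ≤
        C' * supNorm (prodDomain fun i => if i ∈ s then dstolz (γ i) else sector (θ i)) f := by
  have hopen : ∀ (s : Finset (Fin n)) i,
      IsOpen (if i ∈ s then dstolz (γ i) else sector (θ i)) := fun s i => by
    have h := hchain i
    split_ifs
    · exact isOpen_dstolz _
    · exact isOpen_sector (by linarith [h.pos, h.lt_left, h.lt_sector])
        (by linarith [h.lt_stolz, h.le, h.lt, Real.pi_pos])
  have hadm : ∀ (s : Finset (Fin n)) (β : Fin n → ℝ), (∀ i, β i ∈ Ioo (α i) (γ i)) → ∀ i,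
      Admissible (A i) (if i ∈ s then dstolz (γ i) else sector (θ i))
        (if i ∈ s then Icc 0 3 else univ)
        (if i ∈ s then bcurve (β i) else sectorBoundary (ν i)) := fun s β hβ i => by
    split_ifs
    · exact (hbound i).admissible_bcurve (hchain i) (hβ i).1 (hβ i).2
    · exact (hbound i).admissible_sectorBoundary (hchain i)
  induction s using Finset.induction_on with
  | empty => exact ⟨C, hC, fun β _ f hf => by simpa using hcalc f (by simpa using hf)⟩
  | insert i s his ih =>
    obtain ⟨C', hC', ih⟩ := ih
    -- The factor is independent of `β`, so one constant serves all admissible contours, as the Ritt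
    -- calculus requires.
    refine ⟨C' * conversionConst (θ i) (α i) (γ i) (K i) (A i),
      mul_nonneg hC' (conversionConst_nonneg (hchain i) _), fun β hβ f hf => ?_⟩
    cases n with
    | zero => exact i.elim0
    | succ n =>
      have H : Conversion A (fun j => if j ∈ s then dstolz (γ j) else sector (θ j))
          (fun j => if j ∈ insert i s then dstolz (γ j) else sector (θ j))
          (fun j => if j ∈ s then Icc 0 3 else univ)
          (fun j => if j ∈ insert i s then Icc 0 3 else univ)
          (fun j => if j ∈ s then bcurve (β j) else sectorBoundary (ν j))
          (fun j => if j ∈ insert i s then bcurve (β j) else sectorBoundary (ν j))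
          i (ν₁ i) (ν i) (θ i) (δ i) (α i) (β i) (γ i) (K i) :=
        { comm := hA
          isOpen := hopen s
          isOpen' := hopen _
          admissible := hadm s β hβ
          admissible' := hadm _ β hβ
          bound := hbound i
          chain := hchain i
          lt_angle := (hβ i).1
          angle_lt := (hβ i).2
          domain := by simp [his]
          domain' := by simp
          domain_rest := fun j => by simp [Fin.succAbove_ne]
          set := by simp [his]
          set' := by simp
          set_rest := fun j => by simp [Fin.succAbove_ne]
          curve := by simp [his]
          curve' := by simp
          curve_rest := fun j => by simp [Fin.succAbove_ne] }
      exact H.norm_contourIntegral_le hC' (fun g hg => ih β hβ g hg) hf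

theorem HasSectorialCalculus.exists_hasRittCalculus {n : ℕ} {T : Fin n → X →L[ℂ] X}
    (hcomm : ∀ i j, Commute (T i) (T j)) (hT : ∀ i, IsRitt (T i)) {θ : Fin n → ℝ}
    (hθ : ∀ i, θ i ∈ Ioo 0 (Real.pi / 2))
    (h : HasSectorialCalculus (fun i => ContinuousLinearMap.id ℂ X - T i) θ) :
    ∃ γ : Fin n → ℝ, (∀ i, γ i ∈ Ioo 0 (Real.pi / 2)) ∧ HasRittCalculus T γ := by
  obtain ⟨ω, hω, C, hC, hcalc⟩ := h
  choose α₀ hα₀ using hT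
  have hpi := Real.pi_pos
  have hω0 : ∀ i, 0 < ω i := fun i => (hω i).1.1.1
  have hα₀0 : ∀ i, 0 < α₀ i := fun i => (hα₀ i).1.1
  have hmax : ∀ i, max (α₀ i) (θ i) < Real.pi / 2 := fun i => max_lt (hα₀ i).1.2 (hθ i).2
  -- The type of `T i` is enlarged to an angle above both its own type and `θ i`. Every admissible
  -- `β i` then exceeds `θ i`, so the segments stay off the sector on which the calculus is given.
  set α : Fin n → ℝ := fun i => (max (α₀ i) (θ i) + Real.pi / 2) / 2 with hα
  have hα1 : ∀ i, α₀ i < α i ∧ θ i < α i ∧ α i < Real.pi / 2 := fun i => by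
    have h1 := le_max_left (α₀ i) (θ i)
    have h2 := le_max_right (α₀ i) (θ i)
    have h3 := hmax i
    simp only [hα]
    exact ⟨by linarith, by linarith, by linarith⟩
  have hαγ : ∀ i, α i < (α i + Real.pi / 2) / 2 := fun i => by linarith [(hα1 i).2.2]
  have hγ : ∀ i, (α i + Real.pi / 2) / 2 ∈ Ioo 0 (Real.pi / 2) := fun i =>
    ⟨by linarith [(hα1 i).1, hα₀0 i], by linarith [(hα1 i).2.2]⟩
  have hν : ∀ i, (ω i + θ i) / 2 ∈ Ioo (ω i) (θ i) := fun i =>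
    ⟨by linarith [(hω i).2], by linarith [(hω i).2]⟩
  have hchain : ∀ i, AngleChain ((ω i + (ω i + θ i) / 2) / 2) ((ω i + θ i) / 2) (θ i)
      ((α₀ i + α i) / 2) (α i) ((α i + Real.pi / 2) / 2) := fun i =>
    { pos := by linarith [hω0 i, (hν i).1]
      lt_left := by linarith [(hν i).1]
      lt_sector := (hν i).2
      lt_stolz := (hα1 i).2.1
      delta_pos := by linarith [hα₀0 i, (hα1 i).1]
      delta_lt := by linarith [(hα1 i).1]
      le := (hαγ i).le
      lt := (hγ i).2 }
  have hbound : ∀ i, ∃ K, SectorStolzBound (ContinuousLinearMap.id ℂ X - T i)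
      ((ω i + (ω i + θ i) / 2) / 2) ((α₀ i + α i) / 2) K := fun i =>
    exists_sectorStolzBound (hω i).1 (by linarith [(hν i).1])
      (by linarith [(hν i).1, (hν i).2, (hθ i).2]) (hα₀ i) (by linarith [(hα1 i).1])
      (by linarith [(hα1 i).1, (hα1 i).2.2])
  choose K hK using hbound
  obtain ⟨C', hC', hb⟩ := exists_bound_mixed_contour (commute_id_sub hcomm) hchain hK
    (C := (2 * Real.pi) ^ n * C) (by positivity) (fun f hf => by
      have h1 := hcalc f hf _ hν
      rw [sectorialCalculus, norm_smul, norm_pow, norm_div, norm_one, norm_two_pi_I, one_div,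
        inv_pow, inv_mul_le_iff₀ (by positivity)] at h1
      rwa [mul_assoc]) Finset.univ
  -- The summand `1` only makes the constant strictly positive.
  refine ⟨fun i => (α i + Real.pi / 2) / 2, hγ, α, fun i => ⟨(hα₀ i).mono (hα1 i).1.le
    (hα1 i).2.2, hαγ i⟩, (1 / (2 * Real.pi)) ^ n * C' + 1, by positivity, fun φ hφ β hβ => ?_⟩
  have h1 := hb β hβ (fun w => φ (1 - w)) (by simpa using hφ.isHZero hγ)
  simp only [Finset.mem_univ, if_true] at h1
  have hsup := supNorm_nonneg (prodDomain fun i => stolz ((α i + Real.pi / 2) / 2)) φ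
  rw [← supNorm_stolz hγ] at h1
  rw [rittCalculus_eq, norm_smul, norm_pow, norm_div, norm_one, norm_two_pi_I]
  calc _ ≤ (1 / (2 * Real.pi)) ^ n *
        (C' * supNorm (prodDomain fun i => stolz ((α i + Real.pi / 2) / 2)) φ) := by gcongr
    _ ≤ _ := by
        rw [add_mul, mul_assoc]
        linarith

end

end RittCalculus

end

theorem mainTheorem2 {X : Type*} [NormedAddCommGroup X] [NormedSpace ℂ X] [CompleteSpace X]
    {n : ℕ} (T : Fin n → X →L[ℂ] X)
    (hcomm : ∀ i j, Commute (T i) (T j))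
    (hRitt : ∀ i, RittCalculus.IsRitt (T i)) :
    (∃ γ : Fin n → ℝ, (∀ i, γ i ∈ Set.Ioo 0 (Real.pi / 2)) ∧
        RittCalculus.HasRittCalculus T γ) ↔
    (∃ θ : Fin n → ℝ, (∀ i, θ i ∈ Set.Ioo 0 (Real.pi / 2)) ∧
        RittCalculus.HasSectorialCalculus
          (fun i => ContinuousLinearMap.id ℂ X - T i) θ) := by
  constructor
  · rintro ⟨γ, hγ, h⟩
    exact ⟨γ, hγ, h.hasSectorialCalculus hcomm hγ⟩
  · rintro ⟨θ, hθ, h⟩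
    exact h.exists_hasRittCalculus hcomm hRitt hθ
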